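/- Let $\kappa>0$, $a=\sqrt{2/\kappa}$, $b=\sqrt{\kappa/8}-\sqrt{2/\kappa}$. Let $D\subsetneq\mathbb C$ be a simply connected domain, $q\in D$, $p$ a boundary point (prime end) of $D$, and $g_0:(D,p,q)\to(\mathbb D,1,0)$ the corresponding conformal map. Let $B$ be a standard Brownian motion with $B_0=0$ on a filtered probability space, $\theta_t=\sqrt\kappa B_t$, $\xi_t=e^{i\theta_t}$, and let radial $\mathrm{SLE}_\kappa$ in $(D,p,q)$ be given by $$\partial_t g_t(z)=g_t(z)\frac{\xi_t+g_t(z)}{\xi_t-g_t(z)},\qquad w_t(z)=g_t(z)/\xi_t,$$ where for $z\in D$ the solution exists up to time $\tau_z\in(0,\infty]$, and $w_t$ maps $D_t=\{z\in D:\tau_z>t\}$ conformally onto $\mathbb D$ with $w_t(q)=0$. For $\sigma,\sigma_*,\sigma_q,\sigma_{q*}\in\mathbb C$ let $M=M^{(\sigma,\sigma_*;\sigma_q,\sigma_{q*})}$ be the 1-point function of the formal rooted vertex field $\widehat{\mathcal O}^{(\sigma,\sigma_*;\sigma_q,\sigma_{q*})}$, that is, in the identity chart and for $z\in D_t\setminus\{q\}$,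 $$M_t(z)=(w')^{h}(\overline{w'})^{h_*}\,w^{\hat\nu}\,\bar w^{\hat\nu_*}\,(w'_q)^{\hat h_q}(\overline{w'_q})^{\hat h_{q*}}\,(1-w)^{a\sigma}(1-\bar w)^{a\sigma_*}(1-|w|^2)^{\sigma\sigma_*},$$ where $w=w_t(z)$, $w'=w_t'(z)$, $w_q'=w_t'(q)$, all powers are continued continuously in $t$, and $$h=\tfrac{\sigma^2}2-b\sigma,\quad \hat\nu=(b-\tfrac a2+\sigma_q)\sigma,\quad \hat h_q=\tfrac{\sigma_q(\sigma_q-a)}2,\qquad h_*=\tfrac{\sigma_*^2}2-b\sigma_*,\quad \hat\nu_*=(b-\tfrac a2+\sigma_{q*})\sigma_*,\quad \hat h_{q*}=\tfrac{\sigma_{q*}(\sigma_{q*}-a)}2 .$$ $M$ is called a martingale-observable for radial $\mathrm{SLE}_\kappa$ if for every $z\in D\setminus\{q\}$ the process $t\mapsto M_t(z)$ is a local martingale on $[0,\tau_z)$. **Proposition.** 1. If the neutrality condition $\sigma+\sigma_*+\sigma_q+\sigma_{q*}=0$ holds, then $M$ is a martingale-observable. 2. If $\sigma\neq0$, $\sigma_*\neq0$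 and $M$ is a martingale-observable, then the neutrality condition holds. (So for $\sigma\sigma_*\ne0$, $M$ is a martingale-observable if and only if the neutrality condition holds.) 3. In general, if $M$ is a martingale-observable, then the neutrality condition holds possibly after replacing $\sigma_q$ by $a-\sigma_q$ (allowed only if $\sigma=0$) and/or $\sigma_{q*}$ by $a-\sigma_{q*}$ (allowed only if $\sigma_*=0$); these replacements do not change the function $M$. -/

import Mathlib

open MeasureTheory ProbabilityTheory
open scoped NNReal ENNReal

noncomputable section

namespace RadialSLE

/-! ### The radial Loewner flow of a driving function -/

/-- `u` solves the radial Loewner equation `∂ₛ u = u (ξ + u) / (ξ - u)`, `ξₛ = exp (i θₛ)`,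
`u 0 = z`, on the closed time interval `[0, t]`. -/
def IsLoewnerSolution (θ : ℝ≥0 → ℝ) (z : ℂ) (t : ℝ≥0) (u : ℝ → ℂ) : Prop :=
  u 0 = z ∧ ∀ s : ℝ≥0, s ≤ t →
    u s ≠ Complex.exp (θ s * Complex.I) ∧
    HasDerivWithinAt u
      (u s * (Complex.exp (θ s * Complex.I) + u s) / (Complex.exp (θ s * Complex.I) - u s))
      (Set.Icc 0 (t : ℝ)) (s : ℝ)

/-- The lifetime of the solution of the radial Loewner equation started from `z`. -/
def loewnerTime (θ : ℝ≥0 → ℝ) (z : ℂ) : WithTop ℝ≥0 :=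
  sSup {T : WithTop ℝ≥0 | ∃ t : ℝ≥0, T = (t : WithTop ℝ≥0) ∧ ∃ u, IsLoewnerSolution θ z t u}

open Classical in
/-- The value at time `t` of the solution of the radial Loewner equation started from `z`
(and `0` if there is no solution up to time `t`). -/
def loewnerFlow (θ : ℝ≥0 → ℝ) (t : ℝ≥0) (z : ℂ) : ℂ :=
  if h : ∃ u, IsLoewnerSolution θ z t u then h.choose t else 0

/-- `g₀` is a conformal map of the planar domain `D` onto the unit disc that sends `q` to `0`.
The marked boundary point of `D` is the prime end that `g₀` sends to `1`, so letting `g₀` vary is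
the same as letting the marked boundary point vary. -/
structure IsUniformization (D : Set ℂ) (q : ℂ) (g₀ : ℂ → ℂ) : Prop where
  isOpen : IsOpen D
  mem : q ∈ D
  holomorphic : DifferentiableOn ℂ g₀ D
  bijOn : Set.BijOn g₀ D (Metric.ball 0 1)
  map_mark : g₀ q = 0

/-- The conformal map `w_t = g_t / ξ_t` from `(D_t, γ_t, q)` onto `(𝔻, 1, 0)`, where `g_t` is the
Loewner flow started from `g₀`. -/
def centeredMap (g₀ : ℂ → ℂ) (θ : ℝ≥0 → ℝ) (t : ℝ≥0) (z : ℂ) : ℂ :=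
  loewnerFlow θ t (g₀ z) * Complex.exp (-(θ t * Complex.I))

/-! ### The 1-point function of the rooted vertex field -/

open Classical in
/-- The value at time `t` of the continuous logarithm of `f` on `[0, t]` that starts from the
principal value at time `0` (and `0` if there is none). -/
def contLog (f : ℝ≥0 → ℂ) (t : ℝ≥0) : ℂ :=
  if h : ∃ L : ℝ≥0 → ℂ, ContinuousOn L (Set.Iic t) ∧ L 0 = Complex.log (f 0) ∧
      ∀ s ≤ t, Complex.exp (L s) = f s
  then h.choose t else 0

/-- `x ^ α * (conj x) ^ β` for the branch `ℓ` of `log x`. -/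
def biPow (ℓ α β : ℂ) : ℂ :=
  Complex.exp (α * ℓ + β * (starRingEnd ℂ) ℓ)

/-- `a = √(2/κ)`. -/
def aParam (κ : ℝ) : ℝ := Real.sqrt (2 / κ)

/-- `b = √(κ/8) - √(2/κ)`. -/
def bParam (κ : ℝ) : ℝ := Real.sqrt (κ / 8) - Real.sqrt (2 / κ)

/-- The conformal dimension `h = σ²/2 - bσ` at the node. -/
def nodeDim (κ : ℝ) (σ : ℂ) : ℂ := σ ^ 2 / 2 - bParam κ * σ

/-- The exponent `ν̂ = (b - a/2 + σ_q) σ`. -/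
def nodeExp (κ : ℝ) (σ σq : ℂ) : ℂ := (bParam κ - aParam κ / 2 + σq) * σ

/-- The conformal dimension `ĥ_q = σ_q (σ_q - a) / 2` at the marked interior point. -/
def rootDim (κ : ℝ) (σq : ℂ) : ℂ := σq * (σq - aParam κ) / 2

/-- The value of the 1-point function
`(w')^h (w̄')^{h_*} w^{ν̂} w̄^{ν̂_*} (w'_q)^{ĥ_q} (w̄'_q)^{ĥ_{q*}}
  (1-w)^{aσ} (1-w̄)^{aσ_*} (1-|w|²)^{σσ_*}`
where `ℓw`, `ℓw'`, `ℓq` are branches of `log w`, `log w'`, `log w'_q`; since `|w| < 1`, the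
principal branch of `log (1 - w)` is the continuous one. -/
def vertexOnePoint (κ : ℝ) (σ σs σq σqs : ℂ) (w ℓw ℓw' ℓq : ℂ) : ℂ :=
  biPow ℓw' (nodeDim κ σ) (nodeDim κ σs)
    * biPow ℓw (nodeExp κ σ σq) (nodeExp κ σs σqs)
    * biPow ℓq (rootDim κ σq) (rootDim κ σqs)
    * biPow (Complex.log (1 - w)) (aParam κ * σ) (aParam κ * σs)
    * ((1 - ‖w‖ ^ 2 : ℝ) : ℂ) ^ (σ * σs)

/-- The evolution `t ↦ M_{D_t, γ_t, q}(z)` of the 1-point function of the rooted vertex field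
(in the identity chart) along a family `w` of conformal maps `w_t : (D_t, γ_t, q) → (𝔻, 1, 0)`,
all multivalued powers being continued along `t`. -/
def vertexEvolution (κ : ℝ) (σ σs σq σqs : ℂ) (q : ℂ) (w : ℝ≥0 → ℂ → ℂ) (z : ℂ) (t : ℝ≥0) : ℂ :=
  vertexOnePoint κ σ σs σq σqs (w t z)
    (contLog (fun s => w s z) t)
    (contLog (fun s => deriv (w s) z) t)
    (contLog (fun s => deriv (w s) q) t)

/-! ### Martingale-observables -/

variable {Ω : Type*} {mΩ : MeasurableSpace Ω}

/-- `B` is a standard Brownian motion with respect to the filtration `𝓕`, started from `0`, with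
continuous paths. -/
structure IsFilteredBrownian (𝓕 : Filtration ℝ≥0 mΩ) (B : ℝ≥0 → Ω → ℝ) (P : Measure Ω) :
    Prop where
  isBrownian : IsBrownianReal B P
  adapted : StronglyAdapted 𝓕 B
  indep : ∀ s t : ℝ≥0, s ≤ t →
    Indep (MeasurableSpace.comap (fun ω => B t ω - B s ω) inferInstance) (𝓕 s) P
  zero : ∀ ω, B 0 ω = 0
  continuous : ∀ ω, Continuous fun t => B t ω

/-- The process `X`, defined on the random time interval `[0, τ)`, is a local martingale there:
there are stopping times `T 0 ≤ T 1 ≤ ⋯ < τ` that increase to `τ` such that `X` stopped at any of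
them is a martingale. -/
def IsLocalMartingaleUpTo (𝓕 : Filtration ℝ≥0 mΩ) (P : Measure Ω) (τ : Ω → WithTop ℝ≥0)
    (X : ℝ≥0 → Ω → ℂ) : Prop :=
  ∃ T : ℕ → Ω → WithTop ℝ≥0,
    (∀ n, IsStoppingTime 𝓕 (T n)) ∧
    (∀ᵐ ω ∂P, Monotone (fun n => T n ω) ∧ (∀ n, T n ω < τ ω) ∧
      IsLUB (Set.range fun n => T n ω) (τ ω)) ∧
    ∀ n, Martingale (stoppedProcess X (T n)) 𝓕 P

/-- The driving function `θ_t = √κ B_t` of radial SLE. -/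
def driving (κ : ℝ) (B : ℝ≥0 → Ω → ℝ) (ω : Ω) (t : ℝ≥0) : ℝ := Real.sqrt κ * B t ω

/-- A 1-point non-random field on `D ∖ {q}`, given through its evolution `M w z t` along families
`w` of conformal maps `w_t : (D_t, γ_t, q) → (𝔻, 1, 0)`, is a martingale-observable of the radial
SLE_κ in `D` that is driven by the Brownian motion `B`: for every `z`, the process
`t ↦ M_{D_t, γ_t, q}(z)` is a local martingale up to the time when `z` exits `D_t`. -/
def IsMartingaleObservable (κ : ℝ) (D : Set ℂ) (q : ℂ) (g₀ : ℂ → ℂ)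
    (𝓕 : Filtration ℝ≥0 mΩ) (P : Measure Ω) (B : ℝ≥0 → Ω → ℝ)
    (M : (ℝ≥0 → ℂ → ℂ) → ℂ → ℝ≥0 → ℂ) : Prop :=
  ∀ z ∈ D \ {q},
    IsLocalMartingaleUpTo 𝓕 P (fun ω => loewnerTime (driving κ B ω) (g₀ z))
      (fun t ω => M (centeredMap g₀ (driving κ B ω)) z t)

end RadialSLE

end

/-! Before `z` is swallowed, the three continued logarithms are explicit: `log w`, `log w'` and `log
w'_q` are their initial values plus time integrals of functions of `w`, minus `iθ`. Likewise `1 -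
|w|²` is its initial value times the exponential of a time integral. Hence, up to a nonzero
constant, the 1-point function is `exp (-iΔθ_t + ∫ rate(w)) (1 - w)^{aσ} (1 - w̄)^{aσ_*}`, where `Δ`
is the difference of the total dimensions `h + ν̂ + ĥ_q` of the two chiral halves
(`vertexEvolution_eq`). Its drift relative to its value is `c₀ + c₁ s + c₂ s̄` with `s = w / (1 -
w)`. The terms in `s²`, `s̄²` and `s s̄` cancel because `κ a² = 2` and `b = κ a / 4 - a`
(`itoRate_vertex`). Everything then rests on the vanishing of three numbers.

Put `x = σ + σ_q` and `y = σ_* + σ_{q*}`, so that `Δ = (x - y)(x + y - a) / 2`. Under neutrality, `y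
= -x` and `Δ = -a x`, and all three coefficients vanish. A zero drift makes the 1-point function a
martingale when stopped on leaving a smaller disc (`isMartingaleObservable_of_vertexDrift_eq_zero`).
Conversely, a martingale-observable has zero drift at its starting point, since otherwise optional
stopping over a short random time would give a nonzero mean increment
(`vertexDrift_eq_zero_of_isMartingaleObservable`). As `g₀` maps `D \ {q}` onto the punctured disc,
the drift vanishes there and so do `c₀`, `σ (2x + κ a Δ)` and `σ_* (2y - κ a Δ)`. If both node
charges are nonzero, adding the last two conditions gives `x + y = 0`. Otherwise the `c₀` condition
factors, each extra factor being neutrality after a reflection `σ_q ↦ a - σ_q` or `σ_{q*} ↦ a -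
σ_{q*}`.

Stochastic integration is avoided. For processes `exp (c θ + ∫ y)` the drift follows from
independent Gaussian increments and Fubini (`integral_mul_expTerm_sub`). The centered map `w` is
itself such a process, hence so are its monomials in `w` and `w̄`, and power series extend the
formula to holomorphic times antiholomorphic functions (`isDrift_holomorphic`). To have processes
defined for all times, with bounded rates, the Loewner field is cut off near the unit circle. The
truncated flow agrees with the true one until it leaves the disc of radius `r`. -/

noncomputable section

namespace RadialSLE

/-! ### Linear differential equations and the uniqueness of continuous logarithms -/

open Set intervalIntegral in
/-- A solution of the scalar linear equation `y' = k y` is an exponential. -/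
theorem eq_mul_exp_integral_of_hasDerivWithinAt {y k : ℝ → ℂ} {t : ℝ} (ht : 0 ≤ t)
    (hk : ContinuousOn k (Icc 0 t))
    (hy : ∀ s ∈ Icc 0 t, HasDerivWithinAt y (k s * y s) (Icc 0 t) s) :
    ∀ s ∈ Icc 0 t, y s = y 0 * Complex.exp (∫ r in (0 : ℝ)..s, k r) := by
  -- Extending `k` by constants outside `[0, t]` makes its primitive differentiable on all of `ℝ`,
  -- endpoints included.
  set k' : ℝ → ℂ := IccExtend ht ((Icc 0 t).domRestrict k) with hk'
  have hk'c : Continuous k' := (continuousOn_iff_continuous_domRestrict.1 hk).Icc_extend'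
  have hkk : ∀ s ∈ Icc 0 t, k' s = k s := fun s hs => by
    rw [hk', IccExtend_of_mem _ _ hs]; rfl
  have hint : ∀ s ∈ Icc 0 t, (∫ r in (0 : ℝ)..s, k r) = ∫ r in (0 : ℝ)..s, k' r := fun s hs => by
    refine integral_congr fun r hr => (hkk r ?_).symm
    rw [uIcc_of_le hs.1] at hr
    exact ⟨hr.1, hr.2.trans hs.2⟩
  have hE : ∀ s, HasDerivAt (fun s => Complex.exp (-∫ r in (0 : ℝ)..s, k' r))
      (Complex.exp (-∫ r in (0 : ℝ)..s, k' r) * -k' s) s := fun s =>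
    (integral_hasDerivAt_right (hk'c.intervalIntegrable _ _)
      (hk'c.stronglyMeasurableAtFilter _ _) hk'c.continuousAt).neg.cexp
  have hz : ∀ s ∈ Icc 0 t, y s * Complex.exp (-∫ r in (0 : ℝ)..s, k' r) =
      y 0 * Complex.exp (-∫ r in (0 : ℝ)..0, k' r) := by
    refine constant_of_has_deriv_right_zero (f := fun s => y s * Complex.exp (-∫ r in (0 : ℝ)..s, k' r)) ?_ ?_
    · exact (HasDerivWithinAt.continuousOn hy).mul fun s _ => (hE s).continuousAt.continuousWithinAt
    · intro s hs
      have h1 := (hy s (Ico_subset_Icc_self hs)).mul ((hE s).hasDerivWithinAt (s := Icc 0 t))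
      have h2 : HasDerivWithinAt (fun s => y s * Complex.exp (-∫ r in (0 : ℝ)..s, k' r)) 0
          (Icc 0 t) s := by
        refine h1.congr_deriv ?_
        rw [hkk s (Ico_subset_Icc_self hs)]
        ring
      refine h2.mono_of_mem_nhdsWithin ?_
      exact Filter.mem_of_superset (Icc_mem_nhdsGE hs.2) (Icc_subset_Icc_left hs.1)
  intro s hs
  have := hz s hs
  rw [intervalIntegral.integral_same, neg_zero, Complex.exp_zero, mul_one] at this
  rw [hint s hs, ← this, mul_assoc, ← Complex.exp_add, neg_add_cancel, Complex.exp_zero, mul_one]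

/-- A continuous logarithm is determined by its value at time `0`. -/
theorem contLog_eq {f L : ℝ≥0 → ℂ} {t : ℝ≥0} (hL : ContinuousOn L (Set.Iic t))
    (h0 : L 0 = Complex.log (f 0)) (hexp : ∀ s ≤ t, Complex.exp (L s) = f s) :
    contLog f t = L t := by
  have h : ∃ L : ℝ≥0 → ℂ, ContinuousOn L (Set.Iic t) ∧ L 0 = Complex.log (f 0) ∧
      ∀ s ≤ t, Complex.exp (L s) = f s := ⟨L, hL, h0, hexp⟩
  rw [contLog, dif_pos h]
  obtain ⟨hc, hc0, hce⟩ := h.choose_spec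
  set L' := h.choose
  have hn : ∀ s ≤ t, ∃ n : ℤ, L' s = L s + n * (2 * Real.pi * Complex.I) := fun s hs =>
    Complex.exp_eq_exp_iff_exists_int.1 ((hce s hs).trans (hexp s hs).symm)
  have hpi : (2 * Real.pi * Complex.I : ℂ) ≠ 0 := Complex.two_pi_I_ne_zero
  set g : ℝ≥0 → ℝ := fun s => ((L' s - L s) / (2 * Real.pi * Complex.I)).re with hg
  have hgc : ContinuousOn g (Set.Iic t) :=
    Complex.continuous_re.comp_continuousOn ((hc.sub hL).div_const _)
  have hgn : ∀ s ≤ t, ∃ n : ℤ, g s = n ∧ L' s = L s + n * (2 * Real.pi * Complex.I) := by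
    intro s hs
    obtain ⟨n, hn⟩ := hn s hs
    refine ⟨n, ?_, hn⟩
    have : (L' s - L s) / (2 * Real.pi * Complex.I) = (n : ℂ) := by
      rw [hn, add_sub_cancel_left, mul_div_assoc, div_self hpi, mul_one]
    simp [hg, this]
  -- The normalized difference `g` of the two logarithms is continuous with integer values. If it
  -- took two values `n < m`, connectedness would force the value `n + 1/2`.
  have hpre : IsPreconnected (g '' Set.Iic t) := isPreconnected_Iic.image g hgc
  have hsub : (g '' Set.Iic t).Subsingleton := by
    by_contra hns
    rw [Set.not_subsingleton_iff] at hns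
    obtain ⟨a, ha, b, hb, hab⟩ := hns.exists_lt
    obtain ⟨s, hs, rfl⟩ := ha
    obtain ⟨s', hs', rfl⟩ := hb
    obtain ⟨n, hn, -⟩ := hgn s hs
    obtain ⟨m, hm, -⟩ := hgn s' hs'
    have hmem : (n : ℝ) + 1 / 2 ∈ g '' Set.Iic t := by
      refine hpre.ordConnected.out ⟨s, hs, rfl⟩ ⟨s', hs', rfl⟩ ⟨by linarith, ?_⟩
      rw [hn, hm] at hab
      have h1 : n + 1 ≤ m := by exact_mod_cast hab
      have h2 : (n : ℝ) + 1 ≤ m := by exact_mod_cast h1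
      linarith
    obtain ⟨r, hr, hr'⟩ := hmem
    obtain ⟨l, hl, -⟩ := hgn r hr
    rw [hl] at hr'
    have : (2 * l : ℝ) = ((2 * n + 1 : ℤ) : ℝ) := by push_cast; linarith
    have h3 : 2 * l = 2 * n + 1 := by exact_mod_cast this
    omega
  obtain ⟨n, hn1, hn2⟩ := hgn t le_rfl
  have h0g : g 0 = 0 := by simp [hg, hc0, h0]
  have : g t = g 0 := hsub ⟨t, Set.mem_Iic.2 le_rfl, rfl⟩ ⟨0, Set.mem_Iic.2 (zero_le), rfl⟩
  rw [this, h0g] at hn1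
  have : n = 0 := by exact_mod_cast hn1.symm
  rw [hn2, this]; simp

/-! ### Global flows of bounded Lipschitz vector fields -/

open Set Metric in
/-- A bounded vector field that is continuous in time and uniformly Lipschitz in space has a
global integral curve through every point. -/
theorem exists_global_integralCurve {v : ℝ → ℂ → ℂ} {K L : ℝ≥0}
    (hv : ∀ t, LipschitzWith K (v t)) (hc : ∀ x, Continuous fun t => v t x)
    (hL : ∀ t x, ‖v t x‖ ≤ L) (x : ℂ) :
    ∃ u : ℝ → ℂ, u 0 = x ∧ ∀ t, HasDerivAt u (v t (u t)) t := by
  have key : ∀ T : ℝ≥0, ∃ u : ℝ → ℂ, u 0 = x ∧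
      ∀ t ∈ Icc (-(T : ℝ)) T, HasDerivWithinAt u (v t (u t)) (Icc (-(T : ℝ)) T) t := by
    intro T
    have h0 : (0 : ℝ) ∈ Icc (-(T : ℝ)) T := ⟨by simp, T.2⟩
    -- A curve of speed at most `L` stays within distance `L * T` during time `T`, so this radius
    -- imposes no restriction on the time interval.
    have hpl : IsPicardLindelof v (⟨0, h0⟩ : Icc (-(T : ℝ)) T) x (L * T) 0 L K :=
      { lipschitzOnWith := fun t _ => (hv t).lipschitzOnWith
        continuousOn := fun y _ => (hc y).continuousOn
        norm_le := fun t _ y _ => hL t y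
        mul_max_le := by simp }
    exact hpl.exists_eq_forall_mem_Icc_hasDerivWithinAt₀
  choose U hU0 hU using key
  have huniq : ∀ S T : ℝ≥0, S ≤ T → EqOn (U S) (U T) (Icc (-(S : ℝ)) S) := by
    intro S T hST
    rcases eq_or_lt_of_le (zero_le (a := S)) with h | h
    · intro t ht
      rw [← h] at ht ⊢
      have : t = 0 := le_antisymm (by simpa using ht.2) (by simpa using ht.1)
      rw [this, hU0, hU0]
    have hsub : Icc (-(S : ℝ)) S ⊆ Icc (-(T : ℝ)) T :=
      Icc_subset_Icc (neg_le_neg (by exact_mod_cast hST)) (by exact_mod_cast hST)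
    refine ODE_solution_unique_of_mem_Icc (v := v) (s := fun _ => univ) (K := K) (t₀ := 0)
      (fun t _ => (hv t).lipschitzOnWith) ⟨by simpa using h, by simpa using h⟩
      (HasDerivWithinAt.continuousOn (hU S)) (fun t ht => ?_) (fun _ _ => mem_univ _)
      (HasDerivWithinAt.continuousOn fun t ht => (hU T t (hsub ht)).mono hsub) (fun t ht => ?_)
      (fun _ _ => mem_univ _) ((hU0 S).trans (hU0 T).symm)
    · exact (hU S t (Ioo_subset_Icc_self ht)).hasDerivAt (Icc_mem_nhds ht.1 ht.2)
    · exact ((hU T t (hsub (Ioo_subset_Icc_self ht))).mono hsub).hasDerivAt (Icc_mem_nhds ht.1 ht.2)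
  -- The local solutions are glued along the diagonal. Within distance `1` of `t` they all agree
  -- with the single solution on `[-T, T]`, `T = ‖t‖ + 2`, which gives the derivative at `t`.
  refine ⟨fun t => U (‖t‖₊ + 1) t, hU0 _, fun t => ?_⟩
  set T : ℝ≥0 := ‖t‖₊ + 2
  have hmem : ∀ s : ℝ, ‖s‖₊ + 1 ≤ T → U (‖s‖₊ + 1) s = U T s := fun s hs => by
    refine huniq _ _ hs (abs_le.1 ?_)
    simp
  have htT : ‖t‖₊ + 1 ≤ T := by
    show ‖t‖₊ + 1 ≤ ‖t‖₊ + 2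
    exact add_le_add_right one_le_two _
  have hmemt : t ∈ Ioo (-(T : ℝ)) T := abs_lt.1 (by
    show |t| < ((‖t‖₊ + 2 : ℝ≥0) : ℝ)
    simp)
  have h := (hU T t (Ioo_subset_Icc_self hmemt)).hasDerivAt (Icc_mem_nhds hmemt.1 hmemt.2)
  show HasDerivAt (fun t => U (‖t‖₊ + 1) t) (v t (U (‖t‖₊ + 1) t)) t
  rw [hmem t htT]
  refine h.congr_of_eventuallyEq ?_
  filter_upwards [ball_mem_nhds t one_pos] with s hs
  refine hmem s ?_
  have h1 : ‖s‖ ≤ ‖t‖ + 1 := by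
    have := norm_sub_norm_le s t
    have h2 : ‖s - t‖ < 1 := by simpa [dist_eq_norm] using hs
    linarith
  rw [← NNReal.coe_le_coe]
  simp only [T, NNReal.coe_add, coe_nnnorm, NNReal.coe_one, NNReal.coe_ofNat]
  linarith

/-! ### The truncated Loewner flow -/

/-- The point `exp (i θ_t)` of the unit circle, for a real time `t` (clipped at `0`). -/
def drivingPoint (θ : ℝ≥0 → ℝ) (t : ℝ) : ℂ := Complex.exp (θ t.toNNReal * Complex.I)

/-- A cut-off that equals `1` up to `r` and vanishes from `(1 + r) / 2` on. -/
def cutWeight (r x : ℝ) : ℝ := max 0 (min 1 ((1 + r - 2 * x) / (1 - r)))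

/-- The radial Loewner vector field, cut off near the unit circle. -/
def cutField (r : ℝ) (ξ u : ℂ) : ℂ := cutWeight r ‖u‖ * (u * (ξ + u) / (ξ - u))

theorem norm_drivingPoint (θ : ℝ≥0 → ℝ) (t : ℝ) : ‖drivingPoint θ t‖ = 1 :=
  Complex.norm_exp_ofReal_mul_I _

theorem continuous_drivingPoint {θ : ℝ≥0 → ℝ} (hθ : Continuous θ) :
    Continuous (drivingPoint θ) := by
  unfold drivingPoint
  have : Continuous fun t : ℝ => θ t.toNNReal := hθ.comp continuous_real_toNNReal
  fun_prop

theorem cutWeight_nonneg (r x : ℝ) : 0 ≤ cutWeight r x := le_max_left _ _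

theorem cutWeight_le_one (r x : ℝ) : cutWeight r x ≤ 1 := max_le zero_le_one (min_le_left _ _)

theorem cutWeight_eq_one {r x : ℝ} (hr : r < 1) (hx : x ≤ r) : cutWeight r x = 1 := by
  have : 1 ≤ (1 + r - 2 * x) / (1 - r) := by
    rw [le_div_iff₀ (by linarith)]; linarith
  rw [cutWeight, min_eq_left this, max_eq_right zero_le_one]

theorem cutWeight_eq_zero {r x : ℝ} (hr : r < 1) (hx : (1 + r) / 2 ≤ x) : cutWeight r x = 0 := by
  have : (1 + r - 2 * x) / (1 - r) ≤ 0 := div_nonpos_of_nonpos_of_nonneg (by linarith) (by linarith)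
  rw [cutWeight, min_eq_right (by linarith), max_eq_left this]

theorem abs_cutWeight_sub_le {r : ℝ} (hr : r < 1) (x y : ℝ) :
    |cutWeight r x - cutWeight r y| ≤ 2 / (1 - r) * |x - y| := by
  refine (abs_max_sub_max_le_max _ _ _ _).trans ?_
  have h1 : |min 1 ((1 + r - 2 * x) / (1 - r)) - min 1 ((1 + r - 2 * y) / (1 - r))| ≤
      2 / (1 - r) * |x - y| := by
    refine (abs_min_sub_min_le_max _ _ _ _).trans ?_
    rw [sub_self, abs_zero, ← sub_div, max_eq_right (abs_nonneg _), abs_div,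
      abs_of_pos (by linarith : 0 < 1 - r), div_mul_eq_mul_div]
    refine (div_le_div_iff_of_pos_right (by linarith)).2 (le_of_eq ?_)
    rw [show 1 + r - 2 * x - (1 + r - 2 * y) = -(2 * (x - y)) by ring, abs_neg, abs_mul,
      abs_of_pos (by norm_num : (0:ℝ) < 2)]
  rw [sub_self, abs_zero]
  exact max_le (by have := abs_nonneg (x - y); have : 0 < 1 - r := by linarith
                   positivity) h1

theorem continuous_cutWeight (r : ℝ) : Continuous (cutWeight r) := by
  unfold cutWeight
  fun_prop

theorem sub_ne_zero_of_norm {ξ u : ℂ} (hξ : ‖ξ‖ = 1) (hu : ‖u‖ < 1) : ξ - u ≠ 0 := fun h => by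
  rw [sub_eq_zero] at h
  rw [← h, hξ] at hu
  exact lt_irrefl _ hu

/-- In partial fractions `u (ξ + u) / (ξ - u) = -u - 2ξ + 2ξ² / (ξ - u)`. The exact factor `u - v`
makes the difference of two solutions satisfy a linear equation, and the other factor at `v = u`
governs the derivative in the initial point. -/
theorem loewnerField_sub {ξ u v : ℂ} (hu : ξ - u ≠ 0) (hv : ξ - v ≠ 0) :
    u * (ξ + u) / (ξ - u) - v * (ξ + v) / (ξ - v) =
      (-1 + 2 * ξ ^ 2 / ((ξ - u) * (ξ - v))) * (u - v) := by
  field_simp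
  ring

theorem norm_sub_ge {r : ℝ} {ξ u : ℂ} (hξ : ‖ξ‖ = 1) (hu : ‖u‖ ≤ r) : 1 - r ≤ ‖ξ - u‖ := by
  have := norm_sub_norm_le ξ u
  linarith

theorem norm_loewnerField_sub_le {R : ℝ} (hR : R < 1) {ξ u v : ℂ} (hξ : ‖ξ‖ = 1)
    (hu : ‖u‖ ≤ R) (hv : ‖v‖ ≤ R) :
    ‖u * (ξ + u) / (ξ - u) - v * (ξ + v) / (ξ - v)‖ ≤ (1 + 2 / (1 - R) ^ 2) * ‖u - v‖ := by
  rw [loewnerField_sub (sub_ne_zero_of_norm hξ (hu.trans_lt hR))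
    (sub_ne_zero_of_norm hξ (hv.trans_lt hR)), norm_mul]
  refine mul_le_mul_of_nonneg_right ((norm_add_le _ _).trans ?_) (norm_nonneg _)
  have h1 := norm_sub_ge hξ hu
  have h2 := norm_sub_ge hξ hv
  have h0 : 0 < 1 - R := by linarith
  rw [norm_neg, norm_one, norm_div, norm_mul, norm_mul, norm_pow, hξ, one_pow, mul_one,
    Complex.norm_ofNat, sq]
  gcongr

theorem norm_loewnerField_le {R : ℝ} (hR : R < 1) {ξ u : ℂ} (hξ : ‖ξ‖ = 1) (hu : ‖u‖ ≤ R) :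
    ‖u * (ξ + u) / (ξ - u)‖ ≤ 1 + 2 / (1 - R) ^ 2 := by
  have hR0 : 0 ≤ R := (norm_nonneg u).trans hu
  have := norm_loewnerField_sub_le hR hξ hu (v := 0) (by simpa using hR0)
  simp only [zero_mul, zero_div, sub_zero] at this
  refine this.trans (mul_le_of_le_one_right (by positivity) (by linarith))

/-- A Lipschitz constant of the cut-off Loewner field that is also a bound. -/
def cutConst (r : ℝ) : ℝ≥0 :=
  (((1 + 2 / (1 - (1 + r) / 2) ^ 2) * (1 + 2 / (1 - r)))).toNNReal

theorem coe_cutConst {r : ℝ} (hr : r < 1) :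
    (cutConst r : ℝ) = (1 + 2 / (1 - (1 + r) / 2) ^ 2) * (1 + 2 / (1 - r)) :=
  Real.coe_toNNReal _ (by have : 0 < 1 - r := by linarith
                          positivity)

theorem norm_cutField_le {r : ℝ} (hr : r < 1) {ξ : ℂ} (hξ : ‖ξ‖ = 1) (u : ℂ) :
    ‖cutField r ξ u‖ ≤ cutConst r := by
  have h1r : 0 < 1 - r := by linarith
  rw [coe_cutConst hr]
  rcases le_total ((1 + r) / 2) ‖u‖ with h | h
  · rw [cutField, cutWeight_eq_zero hr h, Complex.ofReal_zero, zero_mul, norm_zero]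
    positivity
  · rw [cutField, norm_mul, Complex.norm_real, Real.norm_of_nonneg (cutWeight_nonneg _ _)]
    calc _ ≤ 1 * (1 + 2 / (1 - (1 + r) / 2) ^ 2) :=
          mul_le_mul (cutWeight_le_one _ _) (norm_loewnerField_le (by linarith) hξ h)
            (norm_nonneg _) zero_le_one
      _ ≤ _ := by
          rw [mul_comm]
          have : 0 < 2 / (1 - r) := by positivity
          exact mul_le_mul_of_nonneg_left (by linarith) (by positivity)

theorem norm_cutField_sub_le {r : ℝ} (hr : r < 1) {ξ : ℂ} (hξ : ‖ξ‖ = 1) (u v : ℂ) :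
    ‖cutField r ξ u - cutField r ξ v‖ ≤ cutConst r * ‖u - v‖ := by
  -- With `u` the point of smaller norm, either both cut-offs vanish or the Loewner field at `u` is
  -- bounded. In the splitting `(χ(u) - χ(v)) F(u) + χ(v) (F(u) - F(v))` the field at `v` then
  -- matters only when `χ(v) ≠ 0`.
  wlog huv : ‖u‖ ≤ ‖v‖ generalizing u v
  · rw [norm_sub_rev, norm_sub_rev u]
    exact this v u (le_of_not_ge huv)
  have h1r : 0 < 1 - r := by linarith
  rw [coe_cutConst hr]
  set C : ℝ := 1 + 2 / (1 - (1 + r) / 2) ^ 2 with hC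
  have hC0 : 0 ≤ C := by positivity
  rcases le_total ((1 + r) / 2) ‖u‖ with h | h
  · rw [cutField, cutField, cutWeight_eq_zero hr h, cutWeight_eq_zero hr (h.trans huv)]
    simp only [Complex.ofReal_zero, zero_mul, sub_self, norm_zero]
    positivity
  have hw : ‖(cutWeight r ‖u‖ : ℂ) - cutWeight r ‖v‖‖ ≤ 2 / (1 - r) * ‖u - v‖ := by
    rw [← Complex.ofReal_sub, Complex.norm_real]
    refine (abs_cutWeight_sub_le hr _ _).trans ?_
    exact mul_le_mul_of_nonneg_left (abs_norm_sub_norm_le _ _) (by positivity)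
  have hp := norm_loewnerField_le (by linarith : (1 + r) / 2 < 1) hξ h
  have h1 : ‖((cutWeight r ‖u‖ : ℂ) - cutWeight r ‖v‖) * (u * (ξ + u) / (ξ - u))‖ ≤
      2 / (1 - r) * ‖u - v‖ * C := by
    rw [norm_mul]
    exact mul_le_mul hw hp (norm_nonneg _) (by positivity)
  have h2 : ‖(cutWeight r ‖v‖ : ℂ) * (u * (ξ + u) / (ξ - u) - v * (ξ + v) / (ξ - v))‖ ≤
      C * ‖u - v‖ := by
    rw [norm_mul, Complex.norm_real, Real.norm_of_nonneg (cutWeight_nonneg _ _)]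
    rcases le_total ((1 + r) / 2) ‖v‖ with h' | h'
    · rw [cutWeight_eq_zero hr h', zero_mul]; positivity
    · calc _ ≤ 1 * (C * ‖u - v‖) :=
            mul_le_mul (cutWeight_le_one _ _) (norm_loewnerField_sub_le (by linarith) hξ h h')
              (norm_nonneg _) zero_le_one
        _ = _ := one_mul _
  calc ‖cutField r ξ u - cutField r ξ v‖
      = ‖((cutWeight r ‖u‖ : ℂ) - cutWeight r ‖v‖) * (u * (ξ + u) / (ξ - u)) +
        (cutWeight r ‖v‖ : ℂ) * (u * (ξ + u) / (ξ - u) - v * (ξ + v) / (ξ - v))‖ := by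
        rw [cutField, cutField]; ring_nf
    _ ≤ _ := (norm_add_le _ _).trans (add_le_add h1 h2)
    _ = _ := by ring

theorem lipschitzWith_cutField {r : ℝ} (hr : r < 1) {ξ : ℂ} (hξ : ‖ξ‖ = 1) :
    LipschitzWith (cutConst r) (cutField r ξ) :=
  LipschitzWith.of_dist_le_mul fun u v => by
    simpa only [dist_eq_norm] using norm_cutField_sub_le hr hξ u v

theorem continuous_cutField_left {r : ℝ} (hr : r < 1) {ξ : ℝ → ℂ} (hξ : Continuous ξ)
    (h1 : ∀ t, ‖ξ t‖ = 1) (u : ℂ) : Continuous fun t => cutField r (ξ t) u := by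
  rcases le_total ((1 + r) / 2) ‖u‖ with h | h
  · simp only [cutField, cutWeight_eq_zero hr h, Complex.ofReal_zero, zero_mul]
    exact continuous_const
  · refine continuous_const.mul ((by fun_prop : Continuous fun t => u * (ξ t + u)).div
      (by fun_prop) fun t => ?_)
    exact sub_ne_zero_of_norm (h1 t) (by linarith)

open Classical in
/-- The flow of the cut-off Loewner field. -/
def cutFlow (r : ℝ) (θ : ℝ≥0 → ℝ) (ζ : ℂ) : ℝ → ℂ :=
  if h : ∃ u : ℝ → ℂ, u 0 = ζ ∧ ∀ t, HasDerivAt u (cutField r (drivingPoint θ t) (u t)) t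
  then h.choose else 0

theorem cutFlow_spec {r : ℝ} (hr : r < 1) {θ : ℝ≥0 → ℝ} (hθ : Continuous θ) (ζ : ℂ) :
    cutFlow r θ ζ 0 = ζ ∧
      ∀ t, HasDerivAt (cutFlow r θ ζ) (cutField r (drivingPoint θ t) (cutFlow r θ ζ t)) t := by
  have h : ∃ u : ℝ → ℂ, u 0 = ζ ∧ ∀ t, HasDerivAt u (cutField r (drivingPoint θ t) (u t)) t :=
    exists_global_integralCurve (v := fun t => cutField r (drivingPoint θ t))
      (fun t => lipschitzWith_cutField hr (norm_drivingPoint θ t))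
      (continuous_cutField_left hr (continuous_drivingPoint hθ) (norm_drivingPoint θ))
      (fun t => norm_cutField_le hr (norm_drivingPoint θ t)) ζ
  rw [cutFlow, dif_pos h]
  exact h.choose_spec

theorem continuous_cutFlow {r : ℝ} (hr : r < 1) {θ : ℝ≥0 → ℝ} (hθ : Continuous θ) (ζ : ℂ) :
    Continuous (cutFlow r θ ζ) :=
  continuous_iff_continuousAt.2 fun t => ((cutFlow_spec hr hθ ζ).2 t).continuousAt

/-- The field vanishes on and beyond the circle of radius `(1 + r) / 2`. After the last time spent
inside the closed disc a trajectory would be constant, so it cannot have left. -/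
theorem norm_cutFlow_le {r : ℝ} (hr : r < 1) {θ : ℝ≥0 → ℝ} (hθ : Continuous θ) {ζ : ℂ}
    (hζ : ‖ζ‖ ≤ (1 + r) / 2) {t : ℝ} (ht : 0 ≤ t) : ‖cutFlow r θ ζ t‖ ≤ (1 + r) / 2 := by
  obtain ⟨h0, hd⟩ := cutFlow_spec hr hθ ζ
  have hc := continuous_cutFlow hr hθ ζ
  set u := cutFlow r θ ζ
  by_contra! hlt
  set S : Set ℝ := Set.Icc 0 t ∩ {x | ‖u x‖ ≤ (1 + r) / 2} with hS
  have hSc : IsCompact S := isCompact_Icc.inter_right (isClosed_le hc.norm continuous_const)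
  have hSn : S.Nonempty := ⟨0, ⟨le_rfl, ht⟩, by simpa [h0] using hζ⟩
  obtain ⟨s, hs, hmax⟩ := hSc.exists_isGreatest hSn
  have hst : s < t := lt_of_le_of_ne hs.1.2 fun h => by
    have := hs.2
    rw [h] at this
    exact absurd hlt (not_lt.2 this)
  have hgt : ∀ x ∈ Set.Ioc s t, (1 + r) / 2 < ‖u x‖ := fun x hx => by
    by_contra! h
    exact absurd (hmax ⟨⟨hs.1.1.trans hx.1.le, hx.2⟩, h⟩) (not_le.2 hx.1)
  have hzero : ∀ x ∈ Set.Icc s t, (1 + r) / 2 ≤ ‖u x‖ := by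
    have hcl : IsClosed {x | (1 + r) / 2 ≤ ‖u x‖} := isClosed_le continuous_const hc.norm
    have : closure (Set.Ioc s t) ⊆ {x | (1 + r) / 2 ≤ ‖u x‖} :=
      closure_minimal (fun x hx => (hgt x hx).le) hcl
    rwa [closure_Ioc hst.ne] at this
  have hconst := constant_of_has_deriv_right_zero (f := u) (a := s) (b := t) hc.continuousOn
    (fun x hx => by
      have h1 := hd x
      rw [cutField, cutWeight_eq_zero hr (hzero x ⟨hx.1, hx.2.le⟩), Complex.ofReal_zero,
        zero_mul] at h1
      exact h1.hasDerivWithinAt)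
  have := hconst t ⟨hst.le, le_rfl⟩
  rw [this] at hlt
  exact absurd hs.2 (not_le.2 hlt)

theorem norm_cutFlow_sub_le {r : ℝ} (hr : r < 1) {θ : ℝ≥0 → ℝ} (hθ : Continuous θ) (ζ ζ' : ℂ)
    {t : ℝ} (ht : 0 ≤ t) :
    ‖cutFlow r θ ζ t - cutFlow r θ ζ' t‖ ≤ ‖ζ - ζ'‖ * Real.exp (cutConst r * t) := by
  obtain ⟨h0, hd⟩ := cutFlow_spec hr hθ ζ
  obtain ⟨h0', hd'⟩ := cutFlow_spec hr hθ ζ'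
  have := dist_le_of_trajectories_ODE (v := fun t => cutField r (drivingPoint θ t))
    (K := cutConst r) (a := 0) (b := t) (δ := ‖ζ - ζ'‖)
    (fun t => lipschitzWith_cutField hr (norm_drivingPoint θ t))
    (continuous_cutFlow hr hθ ζ).continuousOn (fun s _ => (hd s).hasDerivWithinAt)
    (continuous_cutFlow hr hθ ζ').continuousOn (fun s _ => (hd' s).hasDerivWithinAt)
    (by rw [h0, h0', dist_eq_norm]) t ⟨ht, le_rfl⟩
  simpa [dist_eq_norm] using this

/-! ### Comparison of the truncated flow with the Loewner flow -/

theorem drivingPoint_coe (θ : ℝ≥0 → ℝ) (s : ℝ≥0) :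
    drivingPoint θ s = Complex.exp (θ s * Complex.I) := by
  rw [drivingPoint, Real.toNNReal_coe]

theorem IsLoewnerSolution.ne {θ : ℝ≥0 → ℝ} {ζ : ℂ} {t : ℝ≥0} {u : ℝ → ℂ}
    (h : IsLoewnerSolution θ ζ t u) {s : ℝ} (hs : s ∈ Set.Icc 0 (t : ℝ)) :
    drivingPoint θ s - u s ≠ 0 := by
  lift s to ℝ≥0 using hs.1
  rw [drivingPoint_coe]
  exact sub_ne_zero.2 (h.2 s (by exact_mod_cast hs.2)).1.symm

theorem IsLoewnerSolution.hasDerivWithinAt {θ : ℝ≥0 → ℝ} {ζ : ℂ} {t : ℝ≥0} {u : ℝ → ℂ}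
    (h : IsLoewnerSolution θ ζ t u) {s : ℝ} (hs : s ∈ Set.Icc 0 (t : ℝ)) :
    HasDerivWithinAt u (u s * (drivingPoint θ s + u s) / (drivingPoint θ s - u s))
      (Set.Icc 0 (t : ℝ)) s := by
  lift s to ℝ≥0 using hs.1
  rw [drivingPoint_coe]
  exact (h.2 s (by exact_mod_cast hs.2)).2

theorem IsLoewnerSolution.continuousOn {θ : ℝ≥0 → ℝ} {ζ : ℂ} {t : ℝ≥0} {u : ℝ → ℂ}
    (h : IsLoewnerSolution θ ζ t u) : ContinuousOn u (Set.Icc 0 (t : ℝ)) :=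
  HasDerivWithinAt.continuousOn fun _ hs => h.hasDerivWithinAt hs

theorem IsLoewnerSolution.of_hasDerivWithinAt {θ : ℝ≥0 → ℝ} {ζ : ℂ} {t : ℝ≥0} {u : ℝ → ℂ}
    (h0 : u 0 = ζ) (h1 : ∀ s ∈ Set.Icc 0 (t : ℝ), drivingPoint θ s - u s ≠ 0)
    (h2 : ∀ s ∈ Set.Icc 0 (t : ℝ), HasDerivWithinAt u
      (u s * (drivingPoint θ s + u s) / (drivingPoint θ s - u s)) (Set.Icc 0 (t : ℝ)) s) :
    IsLoewnerSolution θ ζ t u := by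
  refine ⟨h0, fun s hs => ?_⟩
  have hs' : (s : ℝ) ∈ Set.Icc 0 (t : ℝ) := ⟨s.2, by exact_mod_cast hs⟩
  rw [← drivingPoint_coe]
  exact ⟨(sub_ne_zero.1 (h1 s hs')).symm, h2 s hs'⟩

theorem IsLoewnerSolution.mono {θ : ℝ≥0 → ℝ} {ζ : ℂ} {s t : ℝ≥0} {u : ℝ → ℂ}
    (h : IsLoewnerSolution θ ζ t u) (hst : s ≤ t) : IsLoewnerSolution θ ζ s u :=
  ⟨h.1, fun x hx => ⟨(h.2 x (hx.trans hst)).1,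
    (h.2 x (hx.trans hst)).2.mono (Set.Icc_subset_Icc_right (by exact_mod_cast hst))⟩⟩

/-- The difference of two solutions of the Loewner equation. -/
theorem IsLoewnerSolution.sub_eq {θ : ℝ≥0 → ℝ} (hθ : Continuous θ) {ζ ζ' : ℂ} {t : ℝ≥0}
    {u v : ℝ → ℂ} (hu : IsLoewnerSolution θ ζ t u) (hv : IsLoewnerSolution θ ζ' t v) {s : ℝ}
    (hs : s ∈ Set.Icc 0 (t : ℝ)) :
    u s - v s = (ζ - ζ') * Complex.exp (∫ x in (0 : ℝ)..s, (-1 + 2 * drivingPoint θ x ^ 2 /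
      ((drivingPoint θ x - u x) * (drivingPoint θ x - v x)))) := by
  have hξ := (continuous_drivingPoint hθ).continuousOn (s := Set.Icc 0 (t : ℝ))
  have := eq_mul_exp_integral_of_hasDerivWithinAt (y := fun s => u s - v s)
    (k := fun x => -1 + 2 * drivingPoint θ x ^ 2 /
      ((drivingPoint θ x - u x) * (drivingPoint θ x - v x))) t.2
    (continuousOn_const.add ((continuousOn_const.mul (hξ.pow 2)).div
      ((hξ.sub hu.continuousOn).mul (hξ.sub hv.continuousOn))
        fun x hx => mul_ne_zero (hu.ne hx) (hv.ne hx)))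
    (fun x hx => ((hu.hasDerivWithinAt hx).sub (hv.hasDerivWithinAt hx)).congr_deriv
      (loewnerField_sub (hu.ne hx) (hv.ne hx))) s hs
  simpa only [hu.1, hv.1] using this

theorem IsLoewnerSolution.eqOn {θ : ℝ≥0 → ℝ} (hθ : Continuous θ) {ζ : ℂ} {t : ℝ≥0}
    {u v : ℝ → ℂ} (hu : IsLoewnerSolution θ ζ t u) (hv : IsLoewnerSolution θ ζ t v) :
    Set.EqOn u v (Set.Icc 0 (t : ℝ)) := fun s hs => by
  have := hu.sub_eq hθ hv hs
  rwa [sub_self, zero_mul, sub_eq_zero] at this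

/-- The flow is defined by a choice made separately for each time. Uniqueness of solutions makes all
these choices consistent with one solution. -/
theorem IsLoewnerSolution.loewnerFlow_eq {θ : ℝ≥0 → ℝ} (hθ : Continuous θ) {ζ : ℂ} {t : ℝ≥0}
    {u : ℝ → ℂ} (hu : IsLoewnerSolution θ ζ t u) {s : ℝ≥0} (hs : s ≤ t) :
    loewnerFlow θ s ζ = u s := by
  have h : ∃ u, IsLoewnerSolution θ ζ s u := ⟨u, hu.mono hs⟩
  rw [loewnerFlow, dif_pos h]
  exact h.choose_spec.eqOn hθ (hu.mono hs) ⟨s.2, le_rfl⟩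

theorem IsLoewnerSolution.eq_mul_exp {θ : ℝ≥0 → ℝ} (hθ : Continuous θ) {ζ : ℂ} {t : ℝ≥0}
    {u : ℝ → ℂ} (hu : IsLoewnerSolution θ ζ t u) {s : ℝ} (hs : s ∈ Set.Icc 0 (t : ℝ)) :
    u s = ζ * Complex.exp (∫ x in (0 : ℝ)..s,
      (drivingPoint θ x + u x) / (drivingPoint θ x - u x)) := by
  have hξ := (continuous_drivingPoint hθ).continuousOn (s := Set.Icc 0 (t : ℝ))
  have := eq_mul_exp_integral_of_hasDerivWithinAt (y := u)
    (k := fun x => (drivingPoint θ x + u x) / (drivingPoint θ x - u x)) t.2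
    ((hξ.add hu.continuousOn).div (hξ.sub hu.continuousOn) fun x hx => hu.ne hx)
    (fun x hx => (hu.hasDerivWithinAt hx).congr_deriv (by ring)) s hs
  rwa [hu.1] at this

theorem normSq_deriv_identity {ξ u : ℂ} (hξ : ‖ξ‖ = 1) (h : ξ - u ≠ 0) :
    -(u * (ξ + u) / (ξ - u) * (starRingEnd ℂ) u +
        u * (starRingEnd ℂ) (u * (ξ + u) / (ξ - u))) =
      -2 * (u * (starRingEnd ℂ) u) / ((ξ - u) * (starRingEnd ℂ) (ξ - u)) *
        (1 - u * (starRingEnd ℂ) u) := by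
  have hξ' : ξ * (starRingEnd ℂ) ξ = 1 := by
    rw [Complex.mul_conj, Complex.normSq_eq_norm_sq, hξ]; simp
  have h' : (starRingEnd ℂ) ξ - (starRingEnd ℂ) u ≠ 0 := by
    rw [← map_sub]; exact (map_ne_zero _).2 h
  simp only [map_mul, map_div₀, map_add, map_sub]
  field_simp
  linear_combination (-2) * u * (starRingEnd ℂ) u * hξ'

/-- Because `|ξ| = 1`, the derivative of `1 - u ū` is a multiple of `1 - u ū` itself. The resulting
exponential keeps solutions in the disc and gives the logarithm needed for the factor `(1 -
|w|²)^{σσ_*}`. -/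
theorem IsLoewnerSolution.one_sub_normSq {θ : ℝ≥0 → ℝ} (hθ : Continuous θ) {ζ : ℂ} {t : ℝ≥0}
    {u : ℝ → ℂ} (hu : IsLoewnerSolution θ ζ t u) {s : ℝ} (hs : s ∈ Set.Icc 0 (t : ℝ)) :
    1 - u s * (starRingEnd ℂ) (u s) = (1 - ζ * (starRingEnd ℂ) ζ) *
      Complex.exp (∫ x in (0 : ℝ)..s, -2 * (u x * (starRingEnd ℂ) (u x)) /
        ((drivingPoint θ x - u x) * (starRingEnd ℂ) (drivingPoint θ x - u x))) := by
  have hξ := (continuous_drivingPoint hθ).continuousOn (s := Set.Icc 0 (t : ℝ))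
  have hc := hu.continuousOn
  have hconj : Continuous (starRingEnd ℂ) := Complex.continuous_conj
  have := eq_mul_exp_integral_of_hasDerivWithinAt (y := fun s => 1 - u s * (starRingEnd ℂ) (u s))
    (k := fun x => -2 * (u x * (starRingEnd ℂ) (u x)) /
        ((drivingPoint θ x - u x) * (starRingEnd ℂ) (drivingPoint θ x - u x))) t.2
    ((continuousOn_const.mul (hc.mul (hconj.comp_continuousOn hc))).div
      ((hξ.sub hc).mul (hconj.comp_continuousOn (hξ.sub hc)))
      fun x hx => mul_ne_zero (hu.ne hx) ((map_ne_zero _).2 (hu.ne hx)))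
    (fun x hx => by
      have h1 := hu.hasDerivWithinAt hx
      have h2 := ((h1.mul h1.star).const_sub 1)
      exact h2.congr_deriv (normSq_deriv_identity (norm_drivingPoint θ x) (hu.ne hx))) s hs
  simpa only [hu.1] using this

theorem IsLoewnerSolution.one_sub_norm_sq {θ : ℝ≥0 → ℝ} (hθ : Continuous θ) {ζ : ℂ} {t : ℝ≥0}
    {u : ℝ → ℂ} (hu : IsLoewnerSolution θ ζ t u) {s : ℝ} (hs : s ∈ Set.Icc 0 (t : ℝ)) :
    1 - ‖u s‖ ^ 2 = (1 - ‖ζ‖ ^ 2) * Real.exp (∫ x in (0 : ℝ)..s,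
      -2 * ‖u x‖ ^ 2 / ‖drivingPoint θ x - u x‖ ^ 2) := by
  have := hu.one_sub_normSq hθ hs
  simp only [Complex.mul_conj, Complex.normSq_eq_norm_sq] at this
  have h2 : (∫ x in (0 : ℝ)..s, -2 * ((‖u x‖ ^ 2 : ℝ) : ℂ) /
      ((‖drivingPoint θ x - u x‖ ^ 2 : ℝ) : ℂ)) = ((∫ x in (0 : ℝ)..s,
      -2 * ‖u x‖ ^ 2 / ‖drivingPoint θ x - u x‖ ^ 2 : ℝ) : ℂ) := by
    rw [← intervalIntegral.integral_ofReal]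
    push_cast; rfl
  rw [h2] at this
  exact_mod_cast this

theorem IsLoewnerSolution.norm_lt_one {θ : ℝ≥0 → ℝ} (hθ : Continuous θ) {ζ : ℂ} (hζ : ‖ζ‖ < 1)
    {t : ℝ≥0} {u : ℝ → ℂ} (hu : IsLoewnerSolution θ ζ t u) {s : ℝ}
    (hs : s ∈ Set.Icc 0 (t : ℝ)) : ‖u s‖ < 1 := by
  have h := hu.one_sub_norm_sq hθ hs
  have h1 : 0 < 1 - ‖ζ‖ ^ 2 := by
    have := norm_nonneg ζ
    nlinarith
  have h2 : 0 < 1 - ‖u s‖ ^ 2 := by rw [h]; positivity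
  have := norm_nonneg (u s)
  nlinarith

theorem isLoewnerSolution_cutFlow {r : ℝ} (hr : r < 1) {θ : ℝ≥0 → ℝ} (hθ : Continuous θ) {ζ : ℂ}
    {t : ℝ≥0} (h : ∀ s ∈ Set.Icc 0 (t : ℝ), ‖cutFlow r θ ζ s‖ ≤ r) :
    IsLoewnerSolution θ ζ t (cutFlow r θ ζ) := by
  obtain ⟨h0, hd⟩ := cutFlow_spec hr hθ ζ
  refine .of_hasDerivWithinAt h0
    (fun s hs => sub_ne_zero_of_norm (norm_drivingPoint θ s) ((h s hs).trans_lt hr))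
    (fun s hs => ?_)
  have := (hd s).hasDerivWithinAt (s := Set.Icc 0 (t : ℝ))
  rwa [cutField, cutWeight_eq_one hr (h s hs), Complex.ofReal_one, one_mul] at this

theorem IsLoewnerSolution.eqOn_cutFlow {r : ℝ} (hr : r < 1) {θ : ℝ≥0 → ℝ} (hθ : Continuous θ)
    {ζ : ℂ} {t : ℝ≥0} {u : ℝ → ℂ} (hu : IsLoewnerSolution θ ζ t u)
    (h : ∀ s ∈ Set.Icc 0 (t : ℝ), ‖u s‖ ≤ r) :
    Set.EqOn u (cutFlow r θ ζ) (Set.Icc 0 (t : ℝ)) := by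
  obtain ⟨h0, hd⟩ := cutFlow_spec hr hθ ζ
  refine ODE_solution_unique_of_mem_Icc_right (v := fun t => cutField r (drivingPoint θ t))
    (s := fun _ => Set.univ) (K := cutConst r)
    (fun t _ => (lipschitzWith_cutField hr (norm_drivingPoint θ t)).lipschitzOnWith)
    hu.continuousOn (fun s hs => ?_) (fun _ _ => Set.mem_univ _)
    (continuous_cutFlow hr hθ ζ).continuousOn (fun s _ => (hd s).hasDerivWithinAt)
    (fun _ _ => Set.mem_univ _) (by rw [hu.1, h0])
  have h1 := hu.hasDerivWithinAt (Set.Ico_subset_Icc_self hs)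
  have h2 : cutField r (drivingPoint θ s) (u s) =
      u s * (drivingPoint θ s + u s) / (drivingPoint θ s - u s) := by
    rw [cutField, cutWeight_eq_one hr (h s (Set.Ico_subset_Icc_self hs)), Complex.ofReal_one,
      one_mul]
  rw [h2]
  exact h1.mono_of_mem_nhdsWithin (Filter.mem_of_superset (Icc_mem_nhdsGE hs.2)
    (Set.Icc_subset_Icc_left hs.1))

/-! ### Injective holomorphic functions -/

open Filter Topology in
/-- The derivative of an injective holomorphic function has no zeros. -/
theorem deriv_ne_zero_of_injOn {f : ℂ → ℂ} {D : Set ℂ} (hD : IsOpen D)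
    (hf : DifferentiableOn ℂ f D) (hinj : Set.InjOn f D) {z : ℂ} (hz : z ∈ D) :
    deriv f z ≠ 0 := by
  intro hd
  have hDz : D ∈ 𝓝 z := hD.mem_nhds hz
  have han : AnalyticAt ℂ (fun x => f x - f z) z :=
    ((hf.analyticAt hDz)).sub analyticAt_const
  have hne : ¬ ∀ᶠ x in 𝓝 z, f x - f z = 0 := by
    intro h
    obtain ⟨x, ⟨hx1, hxD⟩, hxz⟩ := (((h.and hDz).filter_mono
      (nhdsWithin_le_nhds (s := {z}ᶜ))).and self_mem_nhdsWithin).exists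
    exact hxz (hinj hxD hz (sub_eq_zero.1 hx1))
  -- The order `n` of the zero of `f - f z` is neither `0` nor, as the derivative vanishes, `1`. An
  -- order of at least `2` will contradict injectivity.
  obtain ⟨n, g, hg, hg0, hfg⟩ := han.exists_eventuallyEq_pow_smul_nonzero_iff.2 hne
  have hn0 : n ≠ 0 := by
    rintro rfl
    have := hfg.self_of_nhds
    simp at this
    exact hg0 this.symm
  have hn1 : n ≠ 1 := by
    rintro rfl
    have h1 : HasDerivAt (fun x => (x - z) ^ 1 • g x) (g z) z := by
      have := (((hasDerivAt_id z).sub_const z).pow 1).mul hg.differentiableAt.hasDerivAt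
      exact this.congr_deriv (by simp)
    have h2 : HasDerivAt (fun x => f x - f z) (deriv f z) z :=
      ((hf.differentiableAt hDz).hasDerivAt).sub_const _
    exact hg0 ((h1.congr_of_eventuallyEq hfg).unique h2 |>.trans hd)
  -- An `n`-th root of `g` near `z`: a fixed root of `g z` times the principal root of `g / g z`,
  -- which is near `1` and so away from the branch cut.
  set c := Complex.exp (Complex.log (g z) / n) with hc
  have hnC : (n : ℂ) ≠ 0 := Nat.cast_ne_zero.2 hn0
  set h : ℂ → ℂ := fun x => c * Complex.exp (Complex.log (g x / g z) / n) with hh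
  have hhn : ∀ᶠ x in 𝓝 z, h x ^ n = g x := by
    filter_upwards [hg.continuousAt.eventually_ne hg0] with x hx
    rw [hh, mul_pow, hc, ← Complex.exp_nat_mul, ← Complex.exp_nat_mul, mul_div_cancel₀ _ hnC,
      mul_div_cancel₀ _ hnC, Complex.exp_log hg0, Complex.exp_log (div_ne_zero hx hg0),
      mul_div_cancel₀ _ hg0]
  have hhan : AnalyticAt ℂ h z := by
    refine analyticAt_const.mul ((AnalyticAt.clog (hg.div analyticAt_const hg0) ?_).div
      analyticAt_const hnC).cexp
    simp [div_self hg0]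
  set φ : ℂ → ℂ := fun x => (x - z) * h x with hφ
  have hφd : HasDerivAt φ (h z) z := by
    have := ((hasDerivAt_id z).sub_const z).mul hhan.differentiableAt.hasDerivAt
    exact this.congr_deriv (by simp)
  have hφan : AnalyticAt ℂ φ z := (analyticAt_id.sub analyticAt_const).mul hhan
  have hhz : h z ≠ 0 := by simp [hh, hc, div_self hg0, Complex.exp_ne_zero]
  have hmap : map φ (𝓝 z) = 𝓝 (φ z) :=
    (by simpa [hφd.deriv] using hφan.hasStrictDerivAt : HasStrictDerivAt φ (h z) z).map_nhds_eq hhz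
  have hφz : φ z = 0 := by simp [hφ]
  have hgood : ∀ᶠ x in 𝓝 z, x ∈ D ∧ f x - f z = φ x ^ n := by
    filter_upwards [hDz, hfg, hhn] with x hx1 hx2 hx3
    exact ⟨hx1, by rw [hx2, hφ, mul_pow, hx3, smul_eq_mul]⟩
  have himg : φ '' {x | x ∈ D ∧ f x - f z = φ x ^ n} ∈ 𝓝 (0 : ℂ) := by
    rw [← hφz, ← hmap]
    exact image_mem_map hgood
  -- Near `z` one has `f - f z = φ ^ n` with `φ` open at `z`. Small values `y` and `ζ y` are both
  -- attained by `φ`, and they yield the same value of `f` at two different points.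
  set ζ : ℂ := Complex.exp (2 * Real.pi * Complex.I / n)
  have hζ : IsPrimitiveRoot ζ n := Complex.isPrimitiveRoot_exp n hn0
  have hζ1 : ζ ≠ 1 := hζ.ne_one (by omega)
  have hlim : Tendsto (fun y : ℂ => ζ * y) (𝓝 0) (𝓝 0) := by
    have : Continuous fun y : ℂ => ζ * y := by fun_prop
    simpa using this.tendsto 0
  have hev : ∀ᶠ y in 𝓝 (0 : ℂ), y ∈ φ '' {x | x ∈ D ∧ f x - f z = φ x ^ n} ∧
      ζ * y ∈ φ '' {x | x ∈ D ∧ f x - f z = φ x ^ n} :=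
    (eventually_mem_set.2 himg).and (hlim.eventually himg)
  obtain ⟨y, ⟨⟨x₁, ⟨hx₁D, hx₁⟩, h₁⟩, x₂, ⟨hx₂D, hx₂⟩, h₂⟩, hy⟩ :=
    ((hev.filter_mono (nhdsWithin_le_nhds (s := {0}ᶜ))).and self_mem_nhdsWithin).exists
  have hff : f x₁ = f x₂ := by
    rw [h₁] at hx₁
    rw [h₂, mul_pow, hζ.pow_eq_one, one_mul, ← hx₁] at hx₂
    exact (sub_left_inj.1 hx₂).symm
  have hxx := hinj hx₁D hx₂D hff
  rw [hxx, h₂] at h₁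
  have hy' : y ≠ 0 := hy
  exact hζ1 (mul_right_cancel₀ hy' (by rw [h₁, one_mul]))

/-! ### Derivative of the Loewner flow in the initial point -/

-- The difference quotient of the flow is the exponential of an explicit integral over both
-- trajectories. For nearby initial points the truncated flow stays in a slightly larger disc and
-- depends continuously on its start, so dominated convergence passes to the diagonal.
open Filter Topology in
theorem IsLoewnerSolution.hasDerivAt_loewnerFlow {θ : ℝ≥0 → ℝ} (hθ : Continuous θ) {ζ : ℂ}
    {t : ℝ≥0} {u : ℝ → ℂ} (hu : IsLoewnerSolution θ ζ t u) {r : ℝ} (hr : r < 1)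
    (hur : ∀ s ∈ Set.Icc 0 (t : ℝ), ‖u s‖ ≤ r) :
    HasDerivAt (loewnerFlow θ t) (Complex.exp (∫ x in (0 : ℝ)..t,
      (-1 + 2 * drivingPoint θ x ^ 2 / (drivingPoint θ x - u x) ^ 2))) ζ := by
  have ht : (t : ℝ) ∈ Set.Icc 0 (t : ℝ) := ⟨t.2, le_rfl⟩
  set R := (1 + r) / 2 with hR
  have hR1 : R < 1 := by linarith
  have hrR : r < R := by linarith
  have huR := hu.eqOn_cutFlow hR1 hθ fun s hs => (hur s hs).trans hrR.le
  set E := Real.exp (cutConst R * t) with hE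
  have hclose : ∀ ζ' : ℂ, ∀ s ∈ Set.Icc 0 (t : ℝ), ‖cutFlow R θ ζ' s - u s‖ ≤ ‖ζ' - ζ‖ * E := by
    intro ζ' s hs
    rw [huR hs]
    refine (norm_cutFlow_sub_le hR1 hθ ζ' ζ hs.1).trans ?_
    refine mul_le_mul_of_nonneg_left (Real.exp_le_exp.2 ?_) (norm_nonneg _)
    exact mul_le_mul_of_nonneg_left hs.2 (cutConst R).2
  have hev : ∀ᶠ ζ' in 𝓝 ζ, ∀ s ∈ Set.Icc 0 (t : ℝ), ‖cutFlow R θ ζ' s‖ ≤ R := by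
    have : ∀ᶠ ζ' in 𝓝 ζ, ‖ζ' - ζ‖ * E < R - r := by
      have hcont : Continuous fun ζ' : ℂ => ‖ζ' - ζ‖ * E := by fun_prop
      exact (hcont.tendsto ζ).eventually_lt_const (by simp; linarith)
    filter_upwards [this] with ζ' h s hs
    have h1 := hclose ζ' s hs
    have h2 := norm_sub_norm_le (cutFlow R θ ζ' s) (u s)
    have h3 := hur s hs
    linarith
  rw [hasDerivAt_iff_tendsto_slope]
  set k : ℂ → ℝ → ℂ := fun ζ' x => -1 + 2 * drivingPoint θ x ^ 2 /
      ((drivingPoint θ x - cutFlow R θ ζ' x) * (drivingPoint θ x - u x)) with hk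
  have hslope : ∀ᶠ ζ' in 𝓝[≠] ζ, Complex.exp (∫ x in (0 : ℝ)..t, k ζ' x) =
      slope (loewnerFlow θ t) ζ ζ' := by
    filter_upwards [hev.filter_mono nhdsWithin_le_nhds, self_mem_nhdsWithin] with ζ' h hne
    have hv := isLoewnerSolution_cutFlow hR1 hθ h
    have hne' : ζ' - ζ ≠ 0 := sub_ne_zero.2 hne
    rw [slope_def_field, hv.loewnerFlow_eq hθ le_rfl, hu.loewnerFlow_eq hθ le_rfl,
      hv.sub_eq hθ hu ht, mul_div_cancel_left₀ _ hne']
  refine Tendsto.congr' hslope ?_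
  refine (Complex.continuous_exp.tendsto _).comp ?_
  have hξ := (continuous_drivingPoint hθ).continuousOn (s := Set.Icc 0 (t : ℝ))
  refine intervalIntegral.tendsto_integral_filter_of_dominated_convergence
    (fun _ => 1 + 2 / ((1 - R) * (1 - R))) ?_ ?_ (by simp) ?_
  · filter_upwards [hev.filter_mono nhdsWithin_le_nhds] with ζ' h
    rw [Set.uIoc_of_le t.coe_nonneg]
    refine ContinuousOn.aestronglyMeasurable (ContinuousOn.mono ?_ Set.Ioc_subset_Icc_self)
      measurableSet_Ioc
    have hv := isLoewnerSolution_cutFlow hR1 hθ h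
    exact continuousOn_const.add ((continuousOn_const.mul (hξ.pow 2)).div
      ((hξ.sub hv.continuousOn).mul (hξ.sub hu.continuousOn))
        fun x hx => mul_ne_zero (hv.ne hx) (hu.ne hx))
  · filter_upwards [hev.filter_mono nhdsWithin_le_nhds] with ζ' h
    refine Eventually.of_forall fun x hx => ?_
    rw [Set.uIoc_of_le t.coe_nonneg] at hx
    have hx' := Set.Ioc_subset_Icc_self hx
    have h1 := norm_sub_ge (norm_drivingPoint θ x) (h x hx')
    have h2 := norm_sub_ge (norm_drivingPoint θ x) ((hur x hx').trans hrR.le)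
    have h0 : 0 < 1 - R := by linarith
    refine (norm_add_le _ _).trans ?_
    rw [norm_neg, norm_one, norm_div, norm_mul, norm_mul, norm_pow, norm_drivingPoint, one_pow,
      mul_one, Complex.norm_ofNat]
    gcongr
  · refine Eventually.of_forall fun x hx => ?_
    rw [Set.uIoc_of_le t.coe_nonneg] at hx
    have hx' := Set.Ioc_subset_Icc_self hx
    have hlim : Tendsto (fun ζ' => cutFlow R θ ζ' x) (𝓝[≠] ζ) (𝓝 (u x)) := by
      refine Tendsto.mono_left ?_ nhdsWithin_le_nhds
      rw [tendsto_iff_norm_sub_tendsto_zero]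
      have hcont : Continuous fun ζ' : ℂ => ‖ζ' - ζ‖ * E := by fun_prop
      exact squeeze_zero (fun _ => norm_nonneg _) (fun ζ' => hclose ζ' x hx')
        (by simpa using hcont.tendsto ζ)
    have hne := hu.ne hx'
    rw [sq (drivingPoint θ x - u x)]
    exact tendsto_const_nhds.add (tendsto_const_nhds.div
      ((tendsto_const_nhds.sub hlim).mul tendsto_const_nhds) (mul_ne_zero hne hne))

/-! ### The centered truncated flow -/

/-- The truncated Loewner flow, rotated by the driving function (and stationary before time `0`). -/
def cutCentered (r : ℝ) (θ : ℝ≥0 → ℝ) (ζ : ℂ) (t : ℝ) : ℂ :=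
  cutFlow r θ ζ t.toNNReal * Complex.exp (-(θ t.toNNReal * Complex.I))

/-- `(1 + w) / (1 - w)`. -/
def radialPhi (w : ℂ) : ℂ := -1 + 2 / (1 - w)

/-- The derivative of `w (1 + w) / (1 - w)`. -/
def radialPsi (w : ℂ) : ℂ := -1 + 2 / (1 - w) ^ 2

theorem norm_exp_neg_ofReal_mul_I (x : ℝ) : ‖Complex.exp (-(x * Complex.I))‖ = 1 := by
  rw [← neg_mul, ← Complex.ofReal_neg, Complex.norm_exp_ofReal_mul_I]

theorem norm_cutCentered (r : ℝ) (θ : ℝ≥0 → ℝ) (ζ : ℂ) (t : ℝ) :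
    ‖cutCentered r θ ζ t‖ = ‖cutFlow r θ ζ t.toNNReal‖ := by
  rw [cutCentered, norm_mul, norm_exp_neg_ofReal_mul_I, mul_one]

theorem norm_cutCentered_le {r : ℝ} (hr : r < 1) {θ : ℝ≥0 → ℝ} (hθ : Continuous θ) {ζ : ℂ}
    (hζ : ‖ζ‖ ≤ (1 + r) / 2) (t : ℝ) : ‖cutCentered r θ ζ t‖ ≤ (1 + r) / 2 := by
  rw [norm_cutCentered]
  exact norm_cutFlow_le hr hθ hζ (NNReal.coe_nonneg _)

theorem continuous_cutCentered {r : ℝ} (hr : r < 1) {θ : ℝ≥0 → ℝ} (hθ : Continuous θ) (ζ : ℂ) :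
    Continuous (cutCentered r θ ζ) := by
  unfold cutCentered
  have h1 : Continuous fun t : ℝ => θ t.toNNReal := hθ.comp continuous_real_toNNReal
  have h2 : Continuous fun t : ℝ => cutFlow r θ ζ t.toNNReal :=
    (continuous_cutFlow hr hθ ζ).comp (NNReal.continuous_coe.comp continuous_real_toNNReal)
  fun_prop

theorem one_sub_ne_zero_of_norm_lt {w : ℂ} (h : ‖w‖ < 1) : 1 - w ≠ 0 :=
  sub_ne_zero_of_norm norm_one h

theorem drivingPoint_sub_eq (r : ℝ) (θ : ℝ≥0 → ℝ) (ζ : ℂ) {x : ℝ} (hx : 0 ≤ x) :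
    drivingPoint θ x - cutFlow r θ ζ x = drivingPoint θ x * (1 - cutCentered r θ ζ x) := by
  rw [cutCentered, drivingPoint, Real.coe_toNNReal x hx, mul_sub, mul_one, mul_left_comm,
    ← Complex.exp_add, add_neg_cancel, Complex.exp_zero, mul_one]

theorem drivingPoint_ne_zero (θ : ℝ≥0 → ℝ) (x : ℝ) : drivingPoint θ x ≠ 0 := Complex.exp_ne_zero _

theorem cutFlow_eq_mul (r : ℝ) (θ : ℝ≥0 → ℝ) (ζ : ℂ) {x : ℝ} (hx : 0 ≤ x) :
    cutFlow r θ ζ x = drivingPoint θ x * cutCentered r θ ζ x := by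
  have := drivingPoint_sub_eq r θ ζ hx
  linear_combination -this

theorem radialPhi_cutCentered (r : ℝ) (θ : ℝ≥0 → ℝ) (ζ : ℂ) {x : ℝ} (hx : 0 ≤ x)
    (h : cutCentered r θ ζ x ≠ 1) :
    (drivingPoint θ x + cutFlow r θ ζ x) / (drivingPoint θ x - cutFlow r θ ζ x) =
      radialPhi (cutCentered r θ ζ x) := by
  have h1 : 1 - cutCentered r θ ζ x ≠ 0 := sub_ne_zero.2 h.symm
  have h2 := drivingPoint_ne_zero θ x
  rw [drivingPoint_sub_eq r θ ζ hx, cutFlow_eq_mul r θ ζ hx, radialPhi]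
  field_simp
  ring

theorem radialPsi_cutCentered (r : ℝ) (θ : ℝ≥0 → ℝ) (ζ : ℂ) {x : ℝ} (hx : 0 ≤ x) :
    -1 + 2 * drivingPoint θ x ^ 2 / (drivingPoint θ x - cutFlow r θ ζ x) ^ 2 =
      radialPsi (cutCentered r θ ζ x) := by
  rw [drivingPoint_sub_eq r θ ζ hx, mul_pow, mul_comm 2, mul_div_mul_left _ _
    (pow_ne_zero 2 (drivingPoint_ne_zero θ x)), radialPsi]

theorem normSq_cutCentered (r : ℝ) (θ : ℝ≥0 → ℝ) (ζ : ℂ) {x : ℝ} (hx : 0 ≤ x) :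
    -2 * ‖cutFlow r θ ζ x‖ ^ 2 / ‖drivingPoint θ x - cutFlow r θ ζ x‖ ^ 2 =
      -2 * ‖cutCentered r θ ζ x‖ ^ 2 / ‖1 - cutCentered r θ ζ x‖ ^ 2 := by
  rw [drivingPoint_sub_eq r θ ζ hx, norm_mul, norm_drivingPoint, one_mul, cutFlow_eq_mul r θ ζ hx,
    norm_mul, norm_drivingPoint, one_mul]

theorem continuous_radialPhi {w : ℝ → ℂ} (hw : Continuous w) (h : ∀ t, ‖w t‖ < 1) :
    Continuous fun t => radialPhi (w t) :=
  continuous_const.add (continuous_const.div (by fun_prop) fun t => one_sub_ne_zero_of_norm_lt (h t))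

theorem continuous_radialPsi {w : ℝ → ℂ} (hw : Continuous w) (h : ∀ t, ‖w t‖ < 1) :
    Continuous fun t => radialPsi (w t) :=
  continuous_const.add (continuous_const.div (by fun_prop)
    fun t => pow_ne_zero 2 (one_sub_ne_zero_of_norm_lt (h t)))

/-! ### The 1-point function along the truncated flow -/

/-- The displayed exponent is a continuous branch of the logarithm. Since `θ 0 = 0` and the integral
over `[0, 0]` is zero, it starts from the principal value. -/
theorem contLog_exp_integral {f : ℝ≥0 → ℂ} {c : ℂ} {k : ℝ → ℂ} {θ : ℝ≥0 → ℝ} {t : ℝ≥0}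
    (hc : c ≠ 0) (hk : ContinuousOn k (Set.Icc 0 (t : ℝ))) (hθ : Continuous θ) (hθ0 : θ 0 = 0)
    (hf : ∀ s ≤ t, f s = c * Complex.exp (∫ x in (0 : ℝ)..s, k x) *
      Complex.exp (-(θ s * Complex.I))) :
    contLog f t = Complex.log c + (∫ x in (0 : ℝ)..t, k x) - θ t * Complex.I := by
  refine contLog_eq (L := fun s => Complex.log c + (∫ x in (0 : ℝ)..s, k x) - θ s * Complex.I)
    ?_ ?_ ?_
  · have h1 : ContinuousOn (fun s : ℝ => ∫ x in (0 : ℝ)..s, k x) (Set.Icc 0 (t : ℝ)) := by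
      have := intervalIntegral.continuousOn_primitive_interval (μ := volume) (f := k) (a := 0)
        (b := (t : ℝ)) (by
          rw [Set.uIcc_of_le t.coe_nonneg]
          exact hk.integrableOn_Icc)
      rwa [Set.uIcc_of_le t.coe_nonneg] at this
    have h2 : ContinuousOn (fun s : ℝ≥0 => ∫ x in (0 : ℝ)..s, k x) (Set.Iic t) :=
      h1.comp NNReal.continuous_coe.continuousOn fun s hs => ⟨s.coe_nonneg, by exact_mod_cast hs⟩
    exact (continuousOn_const.add h2).sub (by fun_prop)
  · rw [hf 0 zero_le]
    simp [hθ0]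
  · intro s hs
    rw [hf s hs, sub_eq_add_neg, Complex.exp_add, Complex.exp_add, Complex.exp_log hc]

theorem IsLoewnerSolution.deriv_centeredMap {D : Set ℂ} {q : ℂ} {g₀ : ℂ → ℂ}
    (hg : IsUniformization D q g₀) {θ : ℝ≥0 → ℝ} (hθ : Continuous θ) {z : ℂ} (hz : z ∈ D)
    {t : ℝ≥0} {u : ℝ → ℂ} (hu : IsLoewnerSolution θ (g₀ z) t u) {r : ℝ} (hr : r < 1)
    (hur : ∀ s ∈ Set.Icc 0 (t : ℝ), ‖u s‖ ≤ r) {s : ℝ≥0} (hs : s ≤ t) :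
    deriv (centeredMap g₀ θ s) z = deriv g₀ z * Complex.exp (∫ x in (0 : ℝ)..s,
      (-1 + 2 * drivingPoint θ x ^ 2 / (drivingPoint θ x - u x) ^ 2)) *
        Complex.exp (-(θ s * Complex.I)) := by
  have h1 := (hu.mono hs).hasDerivAt_loewnerFlow hθ hr fun x hx =>
    hur x ⟨hx.1, hx.2.trans (by exact_mod_cast hs)⟩
  have h2 : HasDerivAt g₀ (deriv g₀ z) z :=
    (hg.holomorphic.differentiableAt (hg.isOpen.mem_nhds hz)).hasDerivAt
  have h3 := (h1.comp z h2).mul_const (Complex.exp (-(θ s * Complex.I)))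
  rw [mul_comm (deriv g₀ z)]
  exact h3.deriv

theorem IsLoewnerSolution.contLog_deriv_centeredMap {D : Set ℂ} {q : ℂ} {g₀ : ℂ → ℂ}
    (hg : IsUniformization D q g₀) {θ : ℝ≥0 → ℝ} (hθ : Continuous θ) (hθ0 : θ 0 = 0) {z : ℂ}
    (hz : z ∈ D) {t : ℝ≥0} {u : ℝ → ℂ} (hu : IsLoewnerSolution θ (g₀ z) t u) {r : ℝ} (hr : r < 1)
    (hur : ∀ s ∈ Set.Icc 0 (t : ℝ), ‖u s‖ ≤ r) :
    contLog (fun s => deriv (centeredMap g₀ θ s) z) t = Complex.log (deriv g₀ z) +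
      (∫ x in (0 : ℝ)..t, (-1 + 2 * drivingPoint θ x ^ 2 / (drivingPoint θ x - u x) ^ 2)) -
        θ t * Complex.I := by
  have hξ := (continuous_drivingPoint hθ).continuousOn (s := Set.Icc 0 (t : ℝ))
  refine contLog_exp_integral (deriv_ne_zero_of_injOn hg.isOpen hg.holomorphic hg.bijOn.injOn hz)
    (continuousOn_const.add ((continuousOn_const.mul (hξ.pow 2)).div
      ((hξ.sub hu.continuousOn).pow 2) fun x hx => pow_ne_zero 2 (hu.ne hx))) hθ hθ0
    fun s hs => hu.deriv_centeredMap hg hθ hz hr hur hs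

/-- The total charge gap `(h + ν̂ + ĥ_q) - (h_* + ν̂_* + ĥ_{q*})`. -/
def vertexGap (κ : ℝ) (σ σs σq σqs : ℂ) : ℂ :=
  (nodeDim κ σ + nodeExp κ σ σq + rootDim κ σq) -
    (nodeDim κ σs + nodeExp κ σs σqs + rootDim κ σqs)

/-- The rate of the finite variation part of the logarithm of the 1-point function. -/
def vertexRate (κ : ℝ) (σ σs σq σqs w : ℂ) : ℂ :=
  nodeDim κ σ * radialPsi w + nodeDim κ σs * radialPsi ((starRingEnd ℂ) w) +
    (nodeExp κ σ σq * radialPhi w + nodeExp κ σs σqs * radialPhi ((starRingEnd ℂ) w)) +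
    (rootDim κ σq + rootDim κ σqs) +
    σ * σs * (-2 * (w * (starRingEnd ℂ) w) / ((1 - w) * (1 - (starRingEnd ℂ) w)))

/-- The semimartingale part of the 1-point function. -/
def vertexModel (κ : ℝ) (σ σs σq σqs : ℂ) (θ : ℝ≥0 → ℝ) (W : ℝ → ℂ) (t : ℝ≥0) : ℂ :=
  Complex.exp (-(vertexGap κ σ σs σq σqs * Complex.I) * θ t) *
    Complex.exp (∫ x in (0 : ℝ)..t, vertexRate κ σ σs σq σqs (W x)) *
    Complex.exp (aParam κ * σ * Complex.log (1 - W t)) *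
    Complex.exp (aParam κ * σs * Complex.log (1 - (starRingEnd ℂ) (W t)))

/-- The deterministic factor of the 1-point function. -/
def vertexConst (κ : ℝ) (σ σs σq σqs : ℂ) (ζ ℓw' ℓq : ℂ) : ℂ :=
  biPow ℓw' (nodeDim κ σ) (nodeDim κ σs) *
    biPow (Complex.log ζ) (nodeExp κ σ σq) (nodeExp κ σs σqs) *
    biPow ℓq (rootDim κ σq) (rootDim κ σqs) *
    Complex.exp (σ * σs * Real.log (1 - ‖ζ‖ ^ 2))

theorem vertexConst_ne_zero (κ : ℝ) (σ σs σq σqs ζ ℓw' ℓq : ℂ) :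
    vertexConst κ σ σs σq σqs ζ ℓw' ℓq ≠ 0 := by
  simp [vertexConst, biPow, Complex.exp_ne_zero]

theorem conj_radialPhi (w : ℂ) :
    (starRingEnd ℂ) (radialPhi w) = radialPhi ((starRingEnd ℂ) w) := by
  simp [radialPhi, Complex.conj_ofNat]

theorem conj_radialPsi (w : ℂ) :
    (starRingEnd ℂ) (radialPsi w) = radialPsi ((starRingEnd ℂ) w) := by
  simp [radialPsi, Complex.conj_ofNat]

theorem conj_intervalIntegral {f : ℝ → ℂ} {a b : ℝ} :
    (starRingEnd ℂ) (∫ x in a..b, f x) = ∫ x in a..b, (starRingEnd ℂ) (f x) := by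
  simp only [intervalIntegral, map_sub, integral_conj]

theorem conj_log_one_sub {w : ℂ} (hw : ‖w‖ < 1) :
    (starRingEnd ℂ) (Complex.log (1 - w)) = Complex.log (1 - (starRingEnd ℂ) w) := by
  rw [← Complex.log_conj, map_sub, map_one]
  have h1 : 0 < (1 - w).re := by
    have := (Complex.abs_re_le_norm w).trans_lt hw
    rw [abs_lt] at this
    simp; linarith
  exact fun h => by
    have := Complex.arg_eq_pi_iff.1 h
    linarith [this.1]

theorem integral_vertexRate (κ : ℝ) (σ σs σq σqs : ℂ) {W : ℝ → ℂ} (hW : Continuous W)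
    (hW1 : ∀ t, ‖W t‖ < 1) (t : ℝ) :
    (∫ x in (0 : ℝ)..t, vertexRate κ σ σs σq σqs (W x)) =
      nodeDim κ σ * (∫ x in (0 : ℝ)..t, radialPsi (W x)) +
      nodeDim κ σs * (starRingEnd ℂ) (∫ x in (0 : ℝ)..t, radialPsi (W x)) +
      (nodeExp κ σ σq * (∫ x in (0 : ℝ)..t, radialPhi (W x)) +
      nodeExp κ σs σqs * (starRingEnd ℂ) (∫ x in (0 : ℝ)..t, radialPhi (W x))) +
      (rootDim κ σq + rootDim κ σqs) * t +
      σ * σs * ((∫ x in (0 : ℝ)..t, -2 * ‖W x‖ ^ 2 / ‖1 - W x‖ ^ 2 : ℝ) : ℂ) := by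
  have h1 := (continuous_radialPsi hW hW1).intervalIntegrable (μ := volume) 0 t
  have h2 : IntervalIntegrable (fun x => (starRingEnd ℂ) (radialPsi (W x))) volume 0 t :=
    (Complex.continuous_conj.comp (continuous_radialPsi hW hW1)).intervalIntegrable
    0 t
  have h3 := (continuous_radialPhi hW hW1).intervalIntegrable (μ := volume) 0 t
  have h4 : IntervalIntegrable (fun x => (starRingEnd ℂ) (radialPhi (W x))) volume 0 t :=
    (Complex.continuous_conj.comp (continuous_radialPhi hW hW1)).intervalIntegrable
    0 t
  have hg : Continuous fun x => -2 * ‖W x‖ ^ 2 / ‖1 - W x‖ ^ 2 :=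
    (by fun_prop : Continuous fun x => -2 * ‖W x‖ ^ 2).div (by fun_prop) fun x =>
      pow_ne_zero 2 (norm_ne_zero_iff.2 (one_sub_ne_zero_of_norm_lt (hW1 x)))
  have h5 : IntervalIntegrable (fun x => ((-2 * ‖W x‖ ^ 2 / ‖1 - W x‖ ^ 2 : ℝ) : ℂ)) volume 0 t :=
    (Complex.continuous_ofReal.comp hg).intervalIntegrable (μ := volume) 0 t
  have heq : ∀ x, vertexRate κ σ σs σq σqs (W x) =
      nodeDim κ σ * radialPsi (W x) + nodeDim κ σs * (starRingEnd ℂ) (radialPsi (W x)) +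
      (nodeExp κ σ σq * radialPhi (W x) + nodeExp κ σs σqs * (starRingEnd ℂ) (radialPhi (W x))) +
      (rootDim κ σq + rootDim κ σqs) +
      σ * σs * ((-2 * ‖W x‖ ^ 2 / ‖1 - W x‖ ^ 2 : ℝ) : ℂ) := by
    intro x
    rw [vertexRate, conj_radialPhi, conj_radialPsi]
    have e1 : (1 - W x) * (1 - (starRingEnd ℂ) (W x)) = ((‖1 - W x‖ ^ 2 : ℝ) : ℂ) := by
      rw [← Complex.normSq_eq_norm_sq, ← Complex.mul_conj, map_sub, map_one]
    have e2 : W x * (starRingEnd ℂ) (W x) = ((‖W x‖ ^ 2 : ℝ) : ℂ) := by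
      rw [← Complex.normSq_eq_norm_sq, ← Complex.mul_conj]
    rw [e1, e2]
    push_cast
    ring
  simp only [heq]
  have i12 := (h1.const_mul (nodeDim κ σ)).add (h2.const_mul (nodeDim κ σs))
  have i34 := (h3.const_mul (nodeExp κ σ σq)).add (h4.const_mul (nodeExp κ σs σqs))
  have ic := intervalIntegrable_const (μ := volume) (a := 0) (b := t)
    (c := rootDim κ σq + rootDim κ σqs)
  rw [intervalIntegral.integral_add ((i12.add i34).add ic) (h5.const_mul _),
    intervalIntegral.integral_add (i12.add i34) ic, intervalIntegral.integral_add i12 i34,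
    intervalIntegral.integral_add (h1.const_mul _) (h2.const_mul _),
    intervalIntegral.integral_add (h3.const_mul _) (h4.const_mul _),
    intervalIntegral.integral_const_mul, intervalIntegral.integral_const_mul,
    intervalIntegral.integral_const_mul, intervalIntegral.integral_const_mul,
    intervalIntegral.integral_const_mul, intervalIntegral.integral_const,
    conj_intervalIntegral, conj_intervalIntegral, ← intervalIntegral.integral_ofReal, sub_zero,
    Complex.real_smul, mul_comm (t : ℂ)]

theorem IsUniformization.norm_lt_one {D : Set ℂ} {q : ℂ} {g₀ : ℂ → ℂ}
    (hg : IsUniformization D q g₀) {z : ℂ} (hz : z ∈ D) : ‖g₀ z‖ < 1 := by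
  simpa using hg.bijOn.mapsTo hz

theorem IsUniformization.ne_zero {D : Set ℂ} {q : ℂ} {g₀ : ℂ → ℂ}
    (hg : IsUniformization D q g₀) {z : ℂ} (hz : z ∈ D \ {q}) : g₀ z ≠ 0 := fun h =>
  hz.2 (hg.bijOn.injOn hz.1 hg.mem (h.trans hg.map_mark.symm))

/-- All logarithms are explicit along the truncated flow. The three of them contain `-iθ`, with
coefficients `h`, `ν̂`, `ĥ_q`, and their conjugates contain `+iθ`, with the starred coefficients, so
`θ` enters only through `exp (-iΔθ)`. The remaining integrals add up to that of `vertexRate`. -/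
theorem vertexEvolution_eq {D : Set ℂ} {q : ℂ} {g₀ : ℂ → ℂ}
    (hg : IsUniformization D q g₀) {θ : ℝ≥0 → ℝ} (hθ : Continuous θ) (hθ0 : θ 0 = 0) {z : ℂ}
    (hz : z ∈ D \ {q}) (κ : ℝ) (σ σs σq σqs : ℂ) {r : ℝ} (hr : r < 1) {t : ℝ≥0}
    (h : ∀ s ∈ Set.Icc 0 (t : ℝ), ‖cutFlow r θ (g₀ z) s‖ ≤ r) :
    vertexEvolution κ σ σs σq σqs q (centeredMap g₀ θ) z t =
      vertexConst κ σ σs σq σqs (g₀ z) (Complex.log (deriv g₀ z)) (Complex.log (deriv g₀ q)) *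
        vertexModel κ σ σs σq σqs θ (cutCentered r θ (g₀ z)) t := by
  set ζ := g₀ z with hζ
  have hζ1 : ‖ζ‖ < 1 := hg.norm_lt_one hz.1
  have hζ0 : ζ ≠ 0 := hg.ne_zero hz
  have hζr : ‖ζ‖ ≤ (1 + r) / 2 := by
    have := h 0 ⟨le_rfl, t.coe_nonneg⟩
    rw [(cutFlow_spec hr hθ ζ).1] at this
    linarith
  have hu := isLoewnerSolution_cutFlow hr hθ h
  set W := cutCentered r θ ζ with hW
  have hWc : Continuous W := continuous_cutCentered hr hθ ζ
  have hW1 : ∀ t, ‖W t‖ < 1 := fun t => (norm_cutCentered_le hr hθ hζr t).trans_lt (by linarith)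
  have hWne : ∀ x, W x ≠ 1 := fun x hx => by
    have := hW1 x
    rw [hx, norm_one] at this
    exact lt_irrefl _ this
  have hint : ∀ s : ℝ≥0, (∫ x in (0 : ℝ)..s, (drivingPoint θ x + cutFlow r θ ζ x) /
      (drivingPoint θ x - cutFlow r θ ζ x)) = ∫ x in (0 : ℝ)..s, radialPhi (W x) := fun s =>
    intervalIntegral.integral_congr fun x hx => by
      rw [Set.uIcc_of_le s.coe_nonneg] at hx
      exact radialPhi_cutCentered r θ ζ hx.1 (hWne x)
  have hcw : ∀ s ≤ t, centeredMap g₀ θ s z = W s := fun s hs => by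
    rw [centeredMap, ← hζ, hu.loewnerFlow_eq hθ hs, hW, cutCentered, Real.toNNReal_coe]
  have hlogw : contLog (fun s => centeredMap g₀ θ s z) t =
      Complex.log ζ + (∫ x in (0 : ℝ)..t, radialPhi (W x)) - θ t * Complex.I := by
    refine contLog_exp_integral hζ0 (continuous_radialPhi hWc hW1).continuousOn hθ hθ0
      fun s hs => ?_
    rw [centeredMap, ← hζ, hu.loewnerFlow_eq hθ hs,
      hu.eq_mul_exp hθ ⟨s.coe_nonneg, by exact_mod_cast hs⟩, hint]
  have hlogw' : contLog (fun s => deriv (centeredMap g₀ θ s) z) t =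
      Complex.log (deriv g₀ z) + (∫ x in (0 : ℝ)..t, radialPsi (W x)) - θ t * Complex.I := by
    rw [hu.contLog_deriv_centeredMap hg hθ hθ0 hz.1 hr h]
    congr 2
    refine intervalIntegral.integral_congr fun x hx => ?_
    rw [Set.uIcc_of_le t.coe_nonneg] at hx
    exact radialPsi_cutCentered r θ ζ hx.1
  have hlogq : contLog (fun s => deriv (centeredMap g₀ θ s) q) t =
      Complex.log (deriv g₀ q) + t - θ t * Complex.I := by
    -- The point `g₀ q = 0` is fixed by the Loewner flow. The logarithmic derivative there grows at
    -- rate `-1 + 2ξ² / ξ² = 1`, whence the term `t`.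
    have h0 : IsLoewnerSolution θ (g₀ q) t fun _ => 0 :=
      .of_hasDerivWithinAt hg.map_mark.symm (fun s _ => by simpa using drivingPoint_ne_zero θ s)
        (fun s _ => by simpa using hasDerivWithinAt_const s _ (0 : ℂ))
    rw [h0.contLog_deriv_centeredMap hg hθ hθ0 hg.mem zero_lt_one (by simp)]
    congr 2
    have : ∀ x, (-1 + 2 * drivingPoint θ x ^ 2 / (drivingPoint θ x - 0) ^ 2) = 1 := fun x => by
      have := drivingPoint_ne_zero θ x
      field_simp
      ring
    exact (intervalIntegral.integral_congr fun x _ => this x).trans (by simp)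
  have hnorm : 1 - ‖W t‖ ^ 2 = (1 - ‖ζ‖ ^ 2) * Real.exp (∫ x in (0 : ℝ)..t,
      -2 * ‖W x‖ ^ 2 / ‖1 - W x‖ ^ 2) := by
    have e := hu.one_sub_norm_sq hθ (s := t) ⟨t.coe_nonneg, le_rfl⟩
    have e2 : (∫ x in (0 : ℝ)..t, -2 * ‖cutFlow r θ ζ x‖ ^ 2 /
        ‖drivingPoint θ x - cutFlow r θ ζ x‖ ^ 2) =
        ∫ x in (0 : ℝ)..t, -2 * ‖W x‖ ^ 2 / ‖1 - W x‖ ^ 2 :=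
      intervalIntegral.integral_congr fun x hx => by
        rw [Set.uIcc_of_le t.coe_nonneg] at hx
        exact normSq_cutCentered r θ ζ hx.1
    rw [e2] at e
    rw [← e, hW, norm_cutCentered, Real.toNNReal_coe]
  have hpos : 0 < 1 - ‖ζ‖ ^ 2 := by
    have := norm_nonneg ζ
    nlinarith
  have hcpow : ((1 - ‖W t‖ ^ 2 : ℝ) : ℂ) ^ (σ * σs) =
      Complex.exp (σ * σs * Real.log (1 - ‖ζ‖ ^ 2) + σ * σs * ((∫ x in (0 : ℝ)..t,
        -2 * ‖W x‖ ^ 2 / ‖1 - W x‖ ^ 2 : ℝ) : ℂ)) := by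
    rw [hnorm, Complex.cpow_def_of_ne_zero (by
      exact_mod_cast (mul_pos hpos (Real.exp_pos _)).ne'), ← Complex.ofReal_log
      (mul_pos hpos (Real.exp_pos _)).le, Real.log_mul hpos.ne' (Real.exp_pos _).ne', Real.log_exp]
    push_cast
    ring_nf
  rw [vertexEvolution, vertexOnePoint, hlogw, hlogw', hlogq, hcw t le_rfl, hcpow, vertexModel,
    integral_vertexRate κ σ σs σq σqs hWc hW1, vertexConst]
  simp only [biPow, conj_log_one_sub (hW1 t)]
  simp only [← Complex.exp_add, map_add, map_sub, map_mul, Complex.conj_ofReal, Complex.conj_I]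
  congr 1
  rw [vertexGap]
  ring

variable {Ω : Type*} {mΩ : MeasurableSpace Ω}

/-! ### Adapted integrals -/

theorem stronglyMeasurable_intervalIntegral {D : ℝ → Ω → ℂ} {a b : ℝ}
    (hD : ∀ x, StronglyMeasurable (D x)) (hc : ∀ ω, Continuous fun x => D x ω) :
    StronglyMeasurable fun ω => ∫ x in a..b, D x ω := by
  have h := stronglyMeasurable_uncurry_of_continuous_of_stronglyMeasurable hc hD
  simp only [intervalIntegral]
  exact (h.integral_prod_left (μ := volume.restrict (Set.Ioc a b))).sub
    (h.integral_prod_left (μ := volume.restrict (Set.Ioc b a)))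

theorem stronglyAdapted_integral {𝓕 : Filtration ℝ≥0 mΩ} {D : ℝ≥0 → Ω → ℂ}
    (hD : StronglyAdapted 𝓕 D) (hc : ∀ ω, Continuous fun x => D x ω) :
    StronglyAdapted 𝓕 fun t ω => ∫ x in (0 : ℝ)..t, D x.toNNReal ω := by
  intro t
  -- Clipping the time at `t` does not change the integrand on `[0, t]`, and makes it measurable
  -- with respect to `𝓕 t` for every `x`.
  have h := @stronglyMeasurable_intervalIntegral Ω (𝓕 t) (fun x ω => D (min x.toNNReal t) ω) 0 t
    (fun x => (hD _).mono (𝓕.mono (min_le_right _ _)))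
    (fun ω => (hc ω).comp (continuous_real_toNNReal.min continuous_const))
  convert h using 2 with ω
  refine intervalIntegral.integral_congr fun x hx => ?_
  rw [Set.uIcc_of_le t.coe_nonneg] at hx
  show D x.toNNReal ω = D (min x.toNNReal t) ω
  rw [min_eq_left (Real.toNNReal_le_iff_le_coe.2 hx.2)]

theorem continuous_integral_toNNReal {f : ℝ≥0 → ℂ} (hf : Continuous f) :
    Continuous fun t : ℝ≥0 => ∫ x in (0 : ℝ)..t, f x.toNNReal :=
  (intervalIntegral.continuous_primitive (fun a b =>
    (hf.comp continuous_real_toNNReal).intervalIntegrable a b) 0).comp NNReal.continuous_coe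

/-- The solution of an ordinary differential equation with a bounded Lipschitz right-hand side that
is driven by an adapted continuous process is adapted. -/
theorem stronglyAdapted_of_hasDerivAt {𝓕 : Filtration ℝ≥0 mΩ} {G : ℂ → ℂ → ℂ}
    (hG : Measurable (Function.uncurry G)) {K : ℝ≥0} {ξ : ℝ → Ω → ℂ}
    (hξ : StronglyAdapted 𝓕 fun (t : ℝ≥0) ω => ξ t ω)
    (hv : ∀ t ω, LipschitzWith K (G (ξ t ω))) (hc : ∀ u ω, Continuous fun t => G (ξ t ω) u)
    (hL : ∀ t ω u, ‖G (ξ t ω) u‖ ≤ K) {x : ℂ} {u : ℝ → Ω → ℂ} (hu0 : ∀ ω, u 0 ω = x)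
    (hu : ∀ ω t, HasDerivAt (fun s => u s ω) (G (ξ t ω) (u t ω)) t) :
    StronglyAdapted 𝓕 fun (t : ℝ≥0) ω => u t ω := by
  have hGc : ∀ ω (y : ℝ → ℂ), Continuous y → Continuous fun t => G (ξ t ω) (y t) := by
    intro ω y hy
    have : Continuous fun p : ℝ × ℂ => G (ξ p.1 ω) p.2 :=
      continuous_prod_of_continuous_lipschitzWith' (fun p : ℝ × ℂ => G (ξ p.1 ω) p.2) K
        (fun t => hv t ω) (fun u => hc u ω)
    exact this.comp (continuous_id.prodMk hy)
  have huc : ∀ ω, Continuous fun t => u t ω := fun ω =>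
    continuous_iff_continuousAt.2 fun t => (hu ω t).continuousAt
  have hui : ∀ ω t, u t ω = x + ∫ s in (0 : ℝ)..t, G (ξ s ω) (u s ω) := fun ω t => by
    rw [intervalIntegral.integral_eq_sub_of_hasDerivAt (fun s _ => hu ω s)
      ((hGc ω _ (huc ω)).intervalIntegrable _ _), hu0]
    ring
  -- Picard iterates from the constant `x`. Each is adapted, being built from the previous one by an
  -- adapted integral, and at every time they converge to `u` with error at most `(K t)^(n+1) /
  -- (n+1)!`.
  set y : ℕ → ℝ → Ω → ℂ := fun n => Nat.rec (fun _ _ => x)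
    (fun _ z t ω => x + ∫ s in (0 : ℝ)..t, G (ξ s ω) (z s ω)) n with hy
  have hyS : ∀ n t ω, y (n + 1) t ω = x + ∫ s in (0 : ℝ)..t, G (ξ s ω) (y n s ω) :=
    fun n t ω => rfl
  have hyc : ∀ n ω, Continuous fun t => y n t ω := by
    intro n
    induction n with
    | zero => exact fun ω => continuous_const
    | succ n ih =>
      intro ω
      simp only [hyS]
      exact continuous_const.add (intervalIntegral.continuous_primitive
        (fun a b => (hGc ω _ (ih ω)).intervalIntegrable a b) 0)
  have hym : ∀ n, StronglyAdapted 𝓕 fun (t : ℝ≥0) ω => y n t ω := by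
    intro n
    induction n with
    | zero => exact fun t => stronglyMeasurable_const
    | succ n ih =>
      have h1 : StronglyAdapted 𝓕 fun (t : ℝ≥0) ω => G (ξ t ω) (y n t ω) := fun t =>
        (hG.comp ((hξ t).measurable.prodMk (ih t).measurable)).stronglyMeasurable
      have h2 := stronglyAdapted_integral h1 fun ω =>
        (hGc ω _ (hyc n ω)).comp NNReal.continuous_coe
      intro t
      have h3 : (fun ω => y (n + 1) t ω) =
          fun ω => x + ∫ s in (0 : ℝ)..t, G (ξ s.toNNReal ω) (y n s.toNNReal ω) := by
        funext ω
        rw [hyS]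
        congr 1
        refine intervalIntegral.integral_congr fun s hs => ?_
        rw [Set.uIcc_of_le t.coe_nonneg] at hs
        simp only [Real.coe_toNNReal s hs.1]
      show StronglyMeasurable[𝓕 t] fun ω => y (n + 1) t ω
      rw [h3]
      exact stronglyMeasurable_const.add (h2 t)
  have hbound : ∀ n ω (t : ℝ), 0 ≤ t → ‖y n t ω - u t ω‖ ≤ (K * t) ^ (n + 1) / (n + 1).factorial := by
    intro n ω
    induction n with
    | zero =>
      intro t ht
      have : y 0 t ω - u t ω = -∫ s in (0 : ℝ)..t, G (ξ s ω) (u s ω) := by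
        rw [hui ω t]; simp [hy]
      rw [this, norm_neg]
      have h := intervalIntegral.norm_integral_le_of_norm_le_const (a := 0) (b := t)
        (f := fun s => G (ξ s ω) (u s ω)) (C := K) fun s _ => hL s ω _
      simpa [abs_of_nonneg ht] using h
    | succ n ih =>
      intro t ht
      have h1 : y (n + 1) t ω - u t ω =
          ∫ s in (0 : ℝ)..t, (G (ξ s ω) (y n s ω) - G (ξ s ω) (u s ω)) := by
        rw [hyS, hui ω t, intervalIntegral.integral_sub
          ((hGc ω _ (hyc n ω)).intervalIntegrable _ _) ((hGc ω _ (huc ω)).intervalIntegrable _ _)]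
        ring
      rw [h1]
      have h2 := intervalIntegral.norm_integral_le_of_norm_le (μ := volume) ht
        (f := fun s => G (ξ s ω) (y n s ω) - G (ξ s ω) (u s ω))
        (g := fun s => K * ((K * s) ^ (n + 1) / (n + 1).factorial))
        (Filter.Eventually.of_forall fun s hs => by
          refine ((hv s ω).norm_sub_le _ _).trans ?_
          exact mul_le_mul_of_nonneg_left (ih s hs.1.le) K.2)
        ((by fun_prop : Continuous fun s : ℝ =>
          (K : ℝ) * ((K * s) ^ (n + 1) / (n + 1).factorial)).intervalIntegrable _ _)
      refine h2.trans (le_of_eq ?_)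
      have h3 : ∀ s : ℝ, (K : ℝ) * ((K * s) ^ (n + 1) / (n + 1).factorial) =
          (K : ℝ) ^ (n + 2) / (n + 1).factorial * s ^ (n + 1) := fun s => by ring
      simp only [h3]
      rw [intervalIntegral.integral_const_mul, integral_pow, Nat.factorial_succ (n + 1)]
      have : ((n + 1).factorial : ℝ) ≠ 0 := by positivity
      push_cast
      field_simp
      simp
      ring
  intro t
  refine stronglyMeasurable_of_tendsto (f := fun n ω => y n t ω) Filter.atTop (fun n => hym n t) ?_
  rw [tendsto_pi_nhds]
  intro ω
  rw [tendsto_iff_norm_sub_tendsto_zero]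
  have h0 := (FloorSemiring.tendsto_pow_div_factorial_atTop ((K : ℝ) * t)).comp
    (Filter.tendsto_add_atTop_nat 1)
  exact squeeze_zero (fun _ => norm_nonneg _) (fun n => hbound n ω t t.coe_nonneg) h0

/-! ### First passage times of continuous adapted processes -/

/-- The first time at which `z` reaches the level `c`. -/
def firstTime (z : ℝ≥0 → ℝ) (c : ℝ) : WithTop ℝ≥0 :=
  sInf ((fun t : ℝ≥0 => (t : WithTop ℝ≥0)) '' {t | c ≤ z t})

theorem firstTime_le_iff {z : ℝ≥0 → ℝ} (hz : Continuous z) {c : ℝ} {t : ℝ≥0} :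
    firstTime z c ≤ t ↔ ∃ s ≤ t, c ≤ z s := by
  constructor
  · intro h
    have hcl : IsClosed {s | c ≤ z s} := isClosed_le continuous_const hz
    by_contra! hne
    have hne' : {s | c ≤ z s}.Nonempty := by
      by_contra hemp
      rw [Set.not_nonempty_iff_eq_empty] at hemp
      rw [firstTime, hemp, Set.image_empty, sInf_empty, top_le_iff] at h
      exact WithTop.coe_ne_top h
    have hmem : sInf {s | c ≤ z s} ∈ {s | c ≤ z s} := hcl.csInf_mem hne' (OrderBot.bddBelow _)
    have hlt : t < sInf {s | c ≤ z s} := by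
      by_contra! hle
      exact absurd (hne _ hle) (not_lt.2 hmem)
    have h2 : ((sInf {s | c ≤ z s} : ℝ≥0) : WithTop ℝ≥0) ≤ firstTime z c := by
      refine le_sInf ?_
      rintro _ ⟨s, hs, rfl⟩
      exact WithTop.coe_le_coe.2 (csInf_le (OrderBot.bddBelow _) hs)
    exact absurd (h2.trans h) (not_le.2 (WithTop.coe_lt_coe.2 hlt))
  · rintro ⟨s, hs, hcs⟩
    have hmem : (s : WithTop ℝ≥0) ∈ (fun t : ℝ≥0 => (t : WithTop ℝ≥0)) '' {t | c ≤ z t} :=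
      ⟨s, hcs, rfl⟩
    exact (sInf_le hmem).trans (WithTop.coe_le_coe.2 hs)

theorem lt_firstTime_iff {z : ℝ≥0 → ℝ} (hz : Continuous z) {c : ℝ} {t : ℝ≥0} :
    (t : WithTop ℝ≥0) < firstTime z c ↔ ∀ s ≤ t, z s < c := by
  rw [← not_le, firstTime_le_iff hz]
  push Not
  rfl

theorem le_of_le_firstTime {z : ℝ≥0 → ℝ} (hz : Continuous z) {c : ℝ} (h0 : z 0 ≤ c) {t : ℝ≥0}
    (ht : (t : WithTop ℝ≥0) ≤ firstTime z c) : z t ≤ c := by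
  -- At `t = 0` the bound is the hypothesis on `z 0`. For `t > 0` it follows by continuity from the
  -- strict bound at all earlier times.
  rcases eq_or_lt_of_le (zero_le (a := t)) with rfl | hpos
  · exact h0
  have hlt : ∀ s ∈ Set.Iio t, z s ≤ c := fun s hs =>
    ((lt_firstTime_iff hz).1 ((WithTop.coe_lt_coe.2 hs).trans_le ht) s le_rfl).le
  have hcl : IsClosed {s | z s ≤ c} := isClosed_le hz continuous_const
  have : t ∈ closure (Set.Iio t) := by
    rw [closure_Iio' (a := t) ⟨0, hpos⟩]
    exact Set.mem_Iic.2 le_rfl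
  exact closure_minimal hlt hcl this

/-- By continuity the level is reached by time `t` exactly when `Z` comes within every `1 / (n + 1)`
of it on a countable dense set of times clipped at `t`. This requires neither right-continuity nor
completeness of the filtration. -/
theorem isStoppingTime_firstTime {𝓕 : Filtration ℝ≥0 mΩ} {Z : ℝ≥0 → Ω → ℝ}
    (hZ : StronglyAdapted 𝓕 Z) (hc : ∀ ω, Continuous fun t => Z t ω) (c : ℝ) :
    IsStoppingTime 𝓕 fun ω => firstTime (fun t => Z t ω) c := by
  intro t
  set d : ℕ → ℝ≥0 := TopologicalSpace.denseSeq ℝ≥0 with hd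
  have hset : {ω | firstTime (fun t => Z t ω) c ≤ t} =
      ⋂ n : ℕ, ⋃ k : ℕ, {ω | c - 1 / (n + 1 : ℝ) < Z (min (d k) t) ω} := by
    ext ω
    simp only [Set.mem_ofPred_eq, Set.mem_iInter, Set.mem_iUnion, firstTime_le_iff (hc ω)]
    have hcm : Continuous fun s => Z (min s t) ω := (hc ω).comp (continuous_id.min continuous_const)
    constructor
    · rintro ⟨s, hs, hcs⟩ n
      have hopen : IsOpen {s | c - 1 / (n + 1 : ℝ) < Z (min s t) ω} :=
        isOpen_lt continuous_const hcm
      have hpos : (0 : ℝ) < 1 / (n + 1 : ℝ) := by positivity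
      obtain ⟨k, hk⟩ := (TopologicalSpace.denseRange_denseSeq ℝ≥0).exists_mem_open hopen
        ⟨s, by
          show c - 1 / (n + 1 : ℝ) < Z (min s t) ω
          rw [min_eq_left hs]; linarith⟩
      exact ⟨k, hk⟩
    · intro h
      obtain ⟨s, hs, hmax⟩ := (isCompact_Icc (a := (0 : ℝ≥0)) (b := t)).exists_isMaxOn
        ⟨0, le_rfl, zero_le⟩ (hc ω).continuousOn
      refine ⟨s, hs.2, ?_⟩
      refine le_of_forall_pos_sub_le fun ε hε => ?_
      obtain ⟨n, hn⟩ := exists_nat_one_div_lt hε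
      obtain ⟨k, hk⟩ := h n
      have h2 : Z (min (d k) t) ω ≤ Z s ω := hmax ⟨zero_le, min_le_right _ _⟩
      linarith
  rw [hset]
  refine MeasurableSet.iInter fun n => MeasurableSet.iUnion fun k => ?_
  exact measurableSet_lt measurable_const
    ((hZ (min (d k) t)).mono (𝓕.mono (min_le_right _ _))).measurable

/-! ### Optional stopping in continuous time -/

/-- The discretisation of a time from above, on the grid of mesh `1 / (k + 1)`. -/
def gridTime (k : ℕ) (t : ℝ≥0) : ℝ≥0 := (⌊(k + 1 : ℝ≥0) * t⌋₊ + 1) / (k + 1)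

theorem gridTime_le (k : ℕ) (t : ℝ≥0) : gridTime k t ≤ t + 1 / (k + 1) := by
  have h := Nat.floor_le (zero_le (a := (k + 1 : ℝ≥0) * t))
  rw [gridTime, add_div]
  gcongr
  rw [div_le_iff₀ (by positivity), mul_comm t]
  exact h

theorem lt_gridTime (k : ℕ) (t : ℝ≥0) : t < gridTime k t := by
  rw [gridTime, lt_div_iff₀ (by positivity), mul_comm t]
  exact Nat.lt_floor_add_one _

/-- The grid time lies strictly after `s`. It is therefore at most `t` exactly when `s` lies
strictly before the last grid point not exceeding `t`, and that event is already decided at time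
`t`. -/
theorem gridTime_le_iff (k : ℕ) (s t : ℝ≥0) :
    gridTime k s ≤ t ↔ s < (⌊(k + 1 : ℝ≥0) * t⌋₊ : ℝ≥0) / (k + 1) := by
  rw [gridTime, div_le_iff₀ (by positivity), lt_div_iff₀ (by positivity), mul_comm s, mul_comm t,
    ← Nat.floor_lt zero_le, ← Nat.add_one_le_iff, Nat.le_floor_iff zero_le]
  push_cast
  rfl

theorem isStoppingTime_gridTime {𝓕 : Filtration ℝ≥0 mΩ} {T : Ω → ℝ≥0}
    (hT : IsStoppingTime 𝓕 fun ω => (T ω : WithTop ℝ≥0)) (k : ℕ) :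
    IsStoppingTime 𝓕 fun ω => ((gridTime k (T ω) : ℝ≥0) : WithTop ℝ≥0) := by
  intro t
  have h := hT.measurableSet_lt_le (i := (⌊(k + 1 : ℝ≥0) * t⌋₊ : ℝ≥0) / (k + 1)) (j := t) (by
    rw [div_le_iff₀ (by positivity), mul_comm t]
    exact Nat.floor_le zero_le)
  convert h using 1
  ext ω
  simp only [Set.mem_ofPred_eq, WithTop.coe_le_coe, WithTop.coe_lt_coe]
  exact gridTime_le_iff k _ _

theorem tendsto_gridTime (t : ℝ≥0) :
    Filter.Tendsto (fun k => gridTime k t) Filter.atTop (nhds t) := by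
  refine tendsto_of_tendsto_of_tendsto_of_le_of_le (tendsto_const_nhds)
    (h := fun k : ℕ => t + 1 / ((k : ℝ≥0) + 1)) ?_ (fun k => (lt_gridTime k t).le)
    fun k => gridTime_le k t
  simpa using (tendsto_const_nhds (x := t)).add (tendsto_one_div_add_atTop_nhds_zero_nat (𝕜 := ℝ≥0))

open Filter in
/-- **Optional stopping** for a continuous martingale at a bounded stopping time. -/
theorem integral_stopped_eq {P : Measure Ω} [IsProbabilityMeasure P] {𝓕 : Filtration ℝ≥0 mΩ}
    {X : ℝ≥0 → Ω → ℂ} (hX : Martingale X 𝓕 P) (hc : ∀ᵐ ω ∂P, Continuous fun t => X t ω)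
    {T : Ω → ℝ≥0} (hT : IsStoppingTime 𝓕 fun ω => (T ω : WithTop ℝ≥0)) {N : ℝ≥0}
    (hN : ∀ ω, T ω ≤ N) :
    Integrable (fun ω => X (T ω) ω) P ∧ ∫ ω, X (T ω) ω ∂P = ∫ ω, X 0 ω ∂P := by
  set S : ℕ → Ω → WithTop ℝ≥0 := fun k ω => ((gridTime k (T ω) : ℝ≥0) : WithTop ℝ≥0) with hSdef
  have hS : ∀ k, IsStoppingTime 𝓕 (S k) := isStoppingTime_gridTime hT
  have hSN : ∀ k ω, S k ω ≤ ((N + 1 : ℝ≥0) : WithTop ℝ≥0) := fun k ω => by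
    refine WithTop.coe_le_coe.2 ((gridTime_le k _).trans (add_le_add (hN ω) ?_))
    rw [div_le_one (by positivity)]
    simp
  have hcount : ∀ k, (Set.range (S k)).Countable := fun k => by
    refine (Set.countable_range fun n : ℕ =>
      ((((n : ℝ≥0) + 1) / (k + 1) : ℝ≥0) : WithTop ℝ≥0)).mono ?_
    rintro _ ⟨ω, rfl⟩
    exact ⟨_, rfl⟩
  -- The discretized stopping times take countably many values, so the countable form of optional
  -- sampling applies.
  have hcond : ∀ k, (fun ω => X (gridTime k (T ω)) ω) =ᵐ[P] P[X (N + 1) | (hS k).measurableSpace] :=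
    fun k => hX.stoppedValue_ae_eq_condExp_of_le_const_of_countable_range (hS k) (hSN k) (hcount k)
  have hle : ∀ k, (hS k).measurableSpace ≤ mΩ := fun k => (hS k).measurableSpace_le
  have hint : ∀ k, Integrable (fun ω => X (gridTime k (T ω)) ω) P := fun k =>
    integrable_condExp.congr (hcond k).symm
  have hval : ∀ k, ∫ ω, X (gridTime k (T ω)) ω ∂P = ∫ ω, X 0 ω ∂P := fun k => by
    rw [integral_congr_ae (hcond k), integral_condExp (hle k)]
    have := hX.setIntegral_eq (zero_le (a := N + 1)) MeasurableSet.univ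
    simpa using this.symm
  have hlim : ∀ᵐ ω ∂P, Tendsto (fun k => X (gridTime k (T ω)) ω) atTop (nhds (X (T ω) ω)) := by
    filter_upwards [hc] with ω hω
    exact (hω.tendsto _).comp (tendsto_gridTime _)
  -- The sampled values are conditional expectations of the one variable `X (N + 1)`, and are
  -- dominated by those of its norm, which form a uniformly integrable family. Together with almost
  -- sure convergence this gives convergence in `L¹`.
  have hUI : UnifIntegrable (fun k ω => X (gridTime k (T ω)) ω) 1 P := by
    have hg := (hX.integrable (N + 1)).norm.uniformIntegrable_condExp hle
    intro ε hε
    obtain ⟨δ, hδ, h⟩ := hg.2.1 hε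
    refine ⟨δ, hδ, fun k s hs hμ => le_trans (eLpNorm_mono_ae ?_) (h k s hs hμ)⟩
    filter_upwards [hcond k, norm_condExp_le (m := (hS k).measurableSpace) (μ := P) (X (N + 1))]
      with ω h1 h2
    by_cases hω : ω ∈ s
    · simp only [Set.indicator_of_mem hω, h1]
      exact h2.trans (Real.le_norm_self _)
    · simp [Set.indicator_of_notMem hω]
  have hXm : AEStronglyMeasurable (fun ω => X (T ω) ω) P :=
    aestronglyMeasurable_of_tendsto_ae atTop (fun k => (hint k).aestronglyMeasurable) hlim
  have hbd : ∀ k, eLpNorm (fun ω => X (gridTime k (T ω)) ω) 1 P ≤ eLpNorm (X (N + 1)) 1 P :=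
    fun k => by
      rw [eLpNorm_congr_ae (hcond k)]
      exact eLpNorm_condExp_le_eLpNorm _ le_rfl
  have hmem : MemLp (fun ω => X (T ω) ω) 1 P := by
    refine ⟨hXm, lt_of_le_of_lt (Lp.eLpNorm_lim_le_liminf_eLpNorm
      (fun k => (hint k).aestronglyMeasurable) _ hlim) ?_⟩
    refine lt_of_le_of_lt (liminf_le_of_le (by isBoundedDefault) (a := eLpNorm (X (N + 1)) 1 P) ?_)
      (memLp_one_iff_integrable.2 (hX.integrable (N + 1))).2
    intro b hb
    obtain ⟨k, hk⟩ := hb.exists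
    exact hk.trans (hbd k)
  have hI : Integrable (fun ω => X (T ω) ω) P := memLp_one_iff_integrable.1 hmem
  refine ⟨hI, ?_⟩
  have hL1 := tendsto_Lp_finite_of_tendsto_ae le_rfl ENNReal.one_ne_top
    (fun k => (hint k).aestronglyMeasurable) hmem hUI hlim
  have := tendsto_integral_of_L1' _ hI.aestronglyMeasurable (Eventually.of_forall hint) hL1
  simp only [hval] at this
  exact tendsto_nhds_unique this tendsto_const_nhds

theorem coe_untopA_of_ne_top {x : WithTop ℝ≥0} (hx : x ≠ ⊤) : ((x.untopA : ℝ≥0) : WithTop ℝ≥0) = x := by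
  lift x to ℝ≥0 using hx
  rfl

theorem integrable_stoppedProcess_of_martingale {P : Measure Ω} [IsProbabilityMeasure P]
    {𝓕 : Filtration ℝ≥0 mΩ} {X : ℝ≥0 → Ω → ℂ} (hX : Martingale X 𝓕 P)
    (hc : ∀ᵐ ω ∂P, Continuous fun t => X t ω)
    {T : Ω → WithTop ℝ≥0} (hT : IsStoppingTime 𝓕 T) (t : ℝ≥0) :
    Integrable (stoppedProcess X T t) P ∧
      ∫ ω, stoppedProcess X T t ω ∂P = ∫ ω, X 0 ω ∂P := by
  have hcoe : ∀ ω, ((min (t : WithTop ℝ≥0) (T ω)).untopA : WithTop ℝ≥0) = min (t : WithTop ℝ≥0) (T ω) :=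
    fun ω => coe_untopA_of_ne_top (ne_top_of_le_ne_top WithTop.coe_ne_top (min_le_left _ _))
  refine integral_stopped_eq hX hc (T := fun ω => (min (t : WithTop ℝ≥0) (T ω)).untopA) (N := t) ?_ ?_
  · simp only [hcoe]
    exact (isStoppingTime_const 𝓕 t).min hT
  · intro ω
    rw [← WithTop.coe_le_coe, hcoe]
    exact min_le_left _ _

open Classical in
/-- A stopped continuous martingale is a martingale. -/
theorem martingale_stoppedProcess {P : Measure Ω} [IsProbabilityMeasure P] {𝓕 : Filtration ℝ≥0 mΩ}
    {X : ℝ≥0 → Ω → ℂ} (hX : Martingale X 𝓕 P) (hc : ∀ ω, Continuous fun t => X t ω)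
    {T : Ω → WithTop ℝ≥0} (hT : IsStoppingTime 𝓕 T) :
    Martingale (stoppedProcess X T) 𝓕 P := by
  have hc' : ∀ᵐ ω ∂P, Continuous fun t => X t ω := Filter.Eventually.of_forall hc
  have hadp : StronglyAdapted 𝓕 (stoppedProcess X T) := hX.stronglyAdapted.stoppedProcess hc hT
  have hint := fun t => (integrable_stoppedProcess_of_martingale hX hc' hT t).1
  refine ⟨hadp, fun s t hst => ?_⟩
  refine (ae_eq_condExp_of_forall_setIntegral_eq (𝓕.le s) (hint t)
    (fun A _ _ => (hint s).integrableOn) (fun A hA _ => ?_)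
    (hadp s).aestronglyMeasurable).symm
  have hAm : MeasurableSet A := 𝓕.le s _ hA
  -- The competing stopping time equals `t` on `A` and `s` off `A`, cut at `T`. Its mean agrees with
  -- that at `s`, the parts off `A` coincide, and the martingale identity on `A` is left.
  have hR := (isStoppingTime_piecewise_const (𝒢 := 𝓕) hst hA.compl).min hT
  have e := (integrable_stoppedProcess_of_martingale hX hc' hR t).2
  rw [← (integrable_stoppedProcess_of_martingale hX hc' hT s).2, ← integral_add_compl hAm
    (integrable_stoppedProcess_of_martingale hX hc' hR t).1, ← integral_add_compl hAm (hint s)] at e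
  have e1 : ∫ ω in A, stoppedProcess X (fun ω =>
      min (Aᶜ.piecewise (fun _ => (s : WithTop ℝ≥0)) (fun _ => (t : WithTop ℝ≥0)) ω) (T ω)) t ω ∂P =
      ∫ ω in A, stoppedProcess X T t ω ∂P := by
    refine setIntegral_congr_fun hAm fun ω hω => ?_
    have : ω ∉ Aᶜ := fun h => h hω
    simp only [stoppedProcess, Set.piecewise_eq_of_notMem _ _ _ this]
    rw [← min_assoc, min_self]
  have e2 : ∫ ω in Aᶜ, stoppedProcess X (fun ω =>
      min (Aᶜ.piecewise (fun _ => (s : WithTop ℝ≥0)) (fun _ => (t : WithTop ℝ≥0)) ω) (T ω)) t ω ∂P =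
      ∫ ω in Aᶜ, stoppedProcess X T s ω ∂P := by
    refine setIntegral_congr_fun hAm.compl fun ω hω => ?_
    simp only [stoppedProcess, Set.piecewise_eq_of_mem _ _ _ hω]
    rw [← min_assoc, min_eq_right (WithTop.coe_le_coe.2 hst)]
  rw [e1, e2] at e
  exact (add_right_cancel e).symm

/-! ### Exponentials of the driving process -/

section Exponential

variable {P : Measure Ω} {𝓕 : Filtration ℝ≥0 mΩ} {B : ℝ≥0 → Ω → ℝ}

theorem IsFilteredBrownian.isProbabilityMeasure (hB : IsFilteredBrownian 𝓕 B P) :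
    IsProbabilityMeasure P :=
  (hB.isBrownian.toIsPreBrownianReal.hasLaw_eval 0).isProbabilityMeasure

theorem continuous_driving (hB : IsFilteredBrownian 𝓕 B P) (κ : ℝ) (ω : Ω) :
    Continuous (driving κ B ω) :=
  continuous_const.mul (hB.continuous ω)

theorem driving_zero (hB : IsFilteredBrownian 𝓕 B P) (κ : ℝ) (ω : Ω) : driving κ B ω 0 = 0 := by
  simp [driving, hB.zero ω]

theorem stronglyAdapted_driving (hB : IsFilteredBrownian 𝓕 B P) (κ : ℝ) :
    StronglyAdapted 𝓕 fun t ω => driving κ B ω t :=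
  fun t => (hB.adapted t).const_mul _

theorem integral_exp_driving_sub (hB : IsFilteredBrownian 𝓕 B P) {κ : ℝ} (hκ : 0 < κ) (c : ℂ)
    {s t : ℝ≥0} (hst : s ≤ t) :
    ∫ ω, Complex.exp (c * (driving κ B ω t - driving κ B ω s : ℝ)) ∂P =
      Complex.exp (κ * c ^ 2 / 2 * (t - s)) := by
  have hlaw := (hB.isBrownian.toIsPreBrownianReal.hasLaw_sub t s).map_eq
  have h := complexMGF_gaussianReal hlaw (c * Real.sqrt κ)
  rw [complexMGF] at h
  have hd : ((nndist t.1 s.1 : ℝ≥0) : ℂ) = t - s := by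
    show (((nndist t.1 s.1 : ℝ≥0) : ℝ) : ℂ) = t - s
    have h1 : ((nndist t.1 s.1 : ℝ≥0) : ℝ) = (t : ℝ) - s := by
      rw [coe_nndist, Real.dist_eq]
      exact abs_of_nonneg (sub_nonneg.2 (NNReal.coe_le_coe.2 hst))
    rw [h1, Complex.ofReal_sub]
  have hs : ((Real.sqrt κ : ℝ) : ℂ) ^ 2 = κ := by
    rw [← Complex.ofReal_pow, Real.sq_sqrt hκ.le]
  convert h using 2
  · funext ω
    simp only [driving, Pi.sub_apply]
    push_cast
    ring_nf
  · rw [Complex.ofReal_zero, mul_zero, zero_add, mul_pow, hs]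
    rw [hd]
    ring

/-- The increment of `θ` after time `s` is independent of `𝓕 s`, so its exponential moment factors
out. This is the only use of independence from the filtration. -/
theorem integral_mul_exp_driving (hB : IsFilteredBrownian 𝓕 B P) {κ : ℝ} (hκ : 0 < κ) (c : ℂ)
    {s t : ℝ≥0} (hst : s ≤ t) {Z : Ω → ℂ} (hZ : StronglyMeasurable[𝓕 s] Z) :
    ∫ ω, Z ω * Complex.exp (c * driving κ B ω t) ∂P =
      (∫ ω, Z ω * Complex.exp (c * driving κ B ω s) ∂P) *
        Complex.exp (κ * c ^ 2 / 2 * (t - s)) := by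
  have hm : StronglyMeasurable[𝓕 s] fun ω => Z ω * Complex.exp (c * driving κ B ω s) := by
    refine hZ.mul (Measurable.stronglyMeasurable ?_)
    have := (stronglyAdapted_driving hB κ s).measurable
    exact Complex.measurable_exp.comp ((Complex.measurable_ofReal.comp this).const_mul c)
  set G : ℝ → ℂ := fun x => Complex.exp (c * (Real.sqrt κ * x : ℝ)) with hG
  have hGm : Measurable G := by fun_prop
  have hBm : ∀ t, Measurable (B t) := fun t => ((hB.adapted t).mono (𝓕.le t)).measurable
  have hind : IndepFun (fun ω => Z ω * Complex.exp (c * driving κ B ω s))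
      (fun ω => G (B t ω - B s ω)) P := by
    have h1 : IndepFun (fun ω => Z ω * Complex.exp (c * driving κ B ω s))
        (fun ω => B t ω - B s ω) P := by
      rw [IndepFun_iff_Indep]
      exact (indep_of_indep_of_le_right (hB.indep s t hst) hm.measurable.comap_le).symm
    exact h1.comp measurable_id hGm
  have h := hind.integral_fun_mul_eq_mul_integral
    ((hm.mono (𝓕.le s)).aestronglyMeasurable)
    (hGm.comp ((hBm t).sub (hBm s))).aestronglyMeasurable
  rw [← integral_exp_driving_sub hB hκ c hst]
  convert h using 1
  · refine integral_congr_ae (Filter.Eventually.of_forall fun ω => ?_)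
    simp only [hG, driving]
    rw [mul_assoc, ← Complex.exp_add]
    push_cast
    ring_nf
  · congr 2
    funext ω
    simp only [hG, driving]
    push_cast
    ring_nf

theorem integrable_exp_driving (hB : IsFilteredBrownian 𝓕 B P) (κ : ℝ) (c : ℝ) (t : ℝ≥0) :
    Integrable (fun ω => Real.exp (c * driving κ B ω t)) P := by
  have hlaw := hB.isBrownian.toIsPreBrownianReal.hasLaw_eval t
  have h := integrable_exp_mul_gaussianReal (μ := 0) (v := t) (c * Real.sqrt κ)
  rw [← hlaw.map_eq] at h
  have h2 := (integrable_map_measure (by fun_prop) hlaw.aemeasurable).1 h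
  refine h2.congr (Filter.Eventually.of_forall fun ω => ?_)
  simp only [Function.comp, driving]
  ring_nf

theorem integral_exp_driving (hB : IsFilteredBrownian 𝓕 B P) {κ : ℝ} (hκ : 0 < κ) (c : ℝ) (t : ℝ≥0) :
    ∫ ω, Real.exp (c * driving κ B ω t) ∂P = Real.exp (κ * c ^ 2 / 2 * t) := by
  have hlaw := hB.isBrownian.toIsPreBrownianReal.hasLaw_eval t
  have h := mgf_gaussianReal hlaw.map_eq (c * Real.sqrt κ)
  rw [mgf] at h
  convert h using 2
  · funext ω
    simp only [driving]
    ring_nf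
  · rw [mul_pow, Real.sq_sqrt hκ.le]
    ring

theorem measurable_driving (hB : IsFilteredBrownian 𝓕 B P) (κ : ℝ) (t : ℝ≥0) :
    Measurable fun ω => driving κ B ω t :=
  ((stronglyAdapted_driving hB κ t).mono (𝓕.le t)).measurable

theorem integrable_prod_exp_driving (hB : IsFilteredBrownian 𝓕 B P) {κ : ℝ} (hκ : 0 < κ) (c : ℝ)
    (s t : ℝ) :
    Integrable (Function.uncurry fun (x : ℝ) ω => Real.exp (c * driving κ B ω x.toNNReal))
      ((volume.restrict (Set.Ioc s t)).prod P) := by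
  have := hB.isProbabilityMeasure
  have hm : StronglyMeasurable
      (Function.uncurry fun (x : ℝ) ω => Real.exp (c * driving κ B ω x.toNNReal)) := by
    refine stronglyMeasurable_uncurry_of_continuous_of_stronglyMeasurable (fun ω => ?_) fun x => ?_
    · exact Real.continuous_exp.comp (continuous_const.mul
        ((continuous_driving hB κ ω).comp continuous_real_toNNReal))
    · exact (Real.measurable_exp.comp ((measurable_driving hB κ _).const_mul c)).stronglyMeasurable
  rw [integrable_prod_iff hm.aestronglyMeasurable]
  refine ⟨Filter.Eventually.of_forall fun x => integrable_exp_driving hB κ c x.toNNReal, ?_⟩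
  simp only [Function.uncurry, Real.norm_eq_abs, Real.abs_exp, integral_exp_driving hB hκ]
  have : Continuous fun x : ℝ => Real.exp (κ * c ^ 2 / 2 * x.toNNReal) := by fun_prop
  exact (this.integrableOn_Icc (a := s) (b := t)).mono_set Set.Ioc_subset_Icc_self

theorem integrable_prod_of_le (hB : IsFilteredBrownian 𝓕 B P) {κ : ℝ} (hκ : 0 < κ) {F : ℝ → Ω → ℂ}
    {c K s t : ℝ}
    (hF : AEStronglyMeasurable (Function.uncurry F) ((volume.restrict (Set.Ioc s t)).prod P))
    (h : ∀ x ∈ Set.Ioc s t, ∀ ω, ‖F x ω‖ ≤ K * Real.exp (c * driving κ B ω x.toNNReal)) :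
    Integrable (Function.uncurry F) ((volume.restrict (Set.Ioc s t)).prod P) := by
  have := hB.isProbabilityMeasure
  refine ((integrable_prod_exp_driving hB hκ c s t).const_mul K).mono' hF ?_
  have h1 : ∀ᵐ x ∂(volume.restrict (Set.Ioc s t)), x ∈ Set.Ioc s t :=
    ae_restrict_mem measurableSet_Ioc
  have h2 := (Measure.quasiMeasurePreserving_fst (μ := volume.restrict (Set.Ioc s t)) (ν := P)).ae h1
  filter_upwards [h2] with p hp
  exact h p.1 hp p.2

theorem norm_exp_integral_le {f : ℝ → ℂ} {C : ℝ} (hf : ∀ x, ‖f x‖ ≤ C) {t : ℝ} (ht : 0 ≤ t) :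
    ‖Complex.exp (∫ x in (0 : ℝ)..t, f x)‖ ≤ Real.exp (C * t) := by
  refine (Complex.norm_exp_le_exp_norm _).trans (Real.exp_le_exp.2 ?_)
  have := intervalIntegral.norm_integral_le_of_norm_le_const (a := 0) (b := t) (f := f) (C := C)
    fun x _ => hf x
  rwa [sub_zero, abs_of_nonneg ht] at this

theorem hasDerivAt_exp_integral {f : ℝ → ℂ} (hf : Continuous f) (c : ℂ) (x : ℝ) :
    HasDerivAt (fun t : ℝ => Complex.exp (c * t) * Complex.exp (∫ x in (0 : ℝ)..t, f x))
      (Complex.exp (c * x) * ((c + f x) * Complex.exp (∫ x in (0 : ℝ)..x, f x))) x := by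
  have h1 : HasDerivAt (fun t : ℝ => ∫ x in (0 : ℝ)..t, f x) (f x) x :=
    intervalIntegral.integral_hasDerivAt_right (hf.intervalIntegrable _ _)
      hf.aestronglyMeasurable.stronglyMeasurableAtFilter hf.continuousAt
  have h2 : HasDerivAt (fun t : ℝ => c * (t : ℂ)) c x := by
    simpa using (Complex.ofRealCLM.hasDerivAt (x := x)).const_mul c
  refine (h2.cexp.mul h1.cexp).congr_deriv ?_
  ring

end Exponential

/-! ### Conditional increments of `exp (c θ_t + ∫ y)` -/

section ExpTerm

variable {P : Measure Ω} {𝓕 : Filtration ℝ≥0 mΩ} {B : ℝ≥0 → Ω → ℝ}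

/-- The process `exp (c θ_t + ∫₀ᵗ y)`. -/
def expTerm (κ : ℝ) (B : ℝ≥0 → Ω → ℝ) (c : ℂ) (y : ℝ≥0 → Ω → ℂ) (t : ℝ≥0) (ω : Ω) : ℂ :=
  Complex.exp (c * driving κ B ω t) * Complex.exp (∫ x in (0 : ℝ)..t, y x.toNNReal ω)

theorem norm_exp_mul_driving (κ : ℝ) (c : ℂ) (t : ℝ≥0) (ω : Ω) :
    ‖Complex.exp (c * driving κ B ω t)‖ = Real.exp (c.re * driving κ B ω t) := by
  rw [Complex.norm_exp, Complex.re_mul_ofReal]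

variable {y : ℝ≥0 → Ω → ℂ}

theorem norm_expTerm_le (κ : ℝ) (c : ℂ) {C : ℝ} (hC : ∀ t ω, ‖y t ω‖ ≤ C) (t : ℝ≥0) (ω : Ω) :
    ‖expTerm κ B c y t ω‖ ≤ Real.exp (C * t) * Real.exp (c.re * driving κ B ω t) := by
  rw [expTerm, norm_mul, norm_exp_mul_driving, mul_comm]
  gcongr
  exact norm_exp_integral_le (fun x => hC _ _) t.coe_nonneg

theorem continuous_exp_mul_driving (hB : IsFilteredBrownian 𝓕 B P) (κ : ℝ) (c : ℂ) (ω : Ω) :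
    Continuous fun t => Complex.exp (c * driving κ B ω t) :=
  Complex.continuous_exp.comp (continuous_const.mul
    (Complex.continuous_ofReal.comp (continuous_driving hB κ ω)))

theorem stronglyAdapted_exp_mul_driving (hB : IsFilteredBrownian 𝓕 B P) (κ : ℝ) (c : ℂ) :
    StronglyAdapted 𝓕 fun t ω => Complex.exp (c * driving κ B ω t) := fun t =>
  Measurable.stronglyMeasurable (Complex.measurable_exp.comp ((Complex.measurable_ofReal.comp
    (stronglyAdapted_driving hB κ t).measurable).const_mul c))

theorem continuous_exp_integral (hyc : ∀ ω, Continuous fun t => y t ω) (ω : Ω) :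
    Continuous fun t : ℝ≥0 => Complex.exp (∫ x in (0 : ℝ)..t, y x.toNNReal ω) :=
  Complex.continuous_exp.comp (continuous_integral_toNNReal (hyc ω))

theorem stronglyAdapted_exp_integral (hy : StronglyAdapted 𝓕 y)
    (hyc : ∀ ω, Continuous fun t => y t ω) :
    StronglyAdapted 𝓕 fun t ω => Complex.exp (∫ x in (0 : ℝ)..t, y x.toNNReal ω) := fun t =>
  Measurable.stronglyMeasurable (Complex.measurable_exp.comp
    (stronglyAdapted_integral hy hyc t).measurable)

theorem continuous_expTerm (hB : IsFilteredBrownian 𝓕 B P) (κ : ℝ) (c : ℂ)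
    (hyc : ∀ ω, Continuous fun t => y t ω) (ω : Ω) : Continuous fun t => expTerm κ B c y t ω :=
  (continuous_exp_mul_driving hB κ c ω).mul (continuous_exp_integral hyc ω)

theorem stronglyAdapted_expTerm (hB : IsFilteredBrownian 𝓕 B P) (κ : ℝ) (c : ℂ)
    (hy : StronglyAdapted 𝓕 y) (hyc : ∀ ω, Continuous fun t => y t ω) :
    StronglyAdapted 𝓕 (expTerm κ B c y) := fun t =>
  (stronglyAdapted_exp_mul_driving hB κ c t).mul (stronglyAdapted_exp_integral hy hyc t)

theorem integrable_of_norm_le_exp_driving (hB : IsFilteredBrownian 𝓕 B P) (κ : ℝ) {f : Ω → ℂ}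
    (hf : StronglyMeasurable f) {K c : ℝ} {t : ℝ≥0}
    (h : ∀ ω, ‖f ω‖ ≤ K * Real.exp (c * driving κ B ω t)) : Integrable f P :=
  ((integrable_exp_driving hB κ c t).const_mul K).mono' hf.aestronglyMeasurable
    (Filter.Eventually.of_forall h)

/-- This is Itô's formula for these processes in integrated form. Write `γ = κ c² / 2`, `E_t = exp
(c θ_t)` and `Y_t = exp (∫ y)`. The function `exp (γ x) Y_x` is differentiable in `x`, so the
fundamental theorem of calculus handles it pathwise. Multiplying by `Z E_t` and conditioning `E_t`
on an earlier time `x` replaces it by `exp (γ (t - x)) E_x`. -/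
theorem integral_mul_expTerm_sub (hB : IsFilteredBrownian 𝓕 B P) {κ : ℝ} (hκ : 0 < κ) (c : ℂ)
    (hy : StronglyAdapted 𝓕 y) (hyc : ∀ ω, Continuous fun t => y t ω) {C : ℝ}
    (hC : ∀ t ω, ‖y t ω‖ ≤ C) {s t : ℝ≥0} (hst : s ≤ t) {Z : Ω → ℂ}
    (hZ : StronglyMeasurable[𝓕 s] Z) (hZ1 : ∀ ω, ‖Z ω‖ ≤ 1) :
    ∫ ω, Z ω * (expTerm κ B c y t ω - expTerm κ B c y s ω) ∂P =
      ∫ ω, Z ω * (∫ x in (s : ℝ)..t,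
        (κ * c ^ 2 / 2 + y x.toNNReal ω) * expTerm κ B c y x.toNNReal ω) ∂P := by
  have := hB.isProbabilityMeasure
  have hst' : (s : ℝ) ≤ t := NNReal.coe_le_coe.2 hst
  set γ : ℂ := κ * c ^ 2 / 2 with hγ
  have hym : ∀ t, StronglyMeasurable (y t) := fun t => (hy t).mono (𝓕.le t)
  have hZm : StronglyMeasurable Z := hZ.mono (𝓕.le s)
  set Y : ℝ≥0 → Ω → ℂ := fun t ω => Complex.exp (∫ x in (0 : ℝ)..t, y x.toNNReal ω) with hY
  have hYa : StronglyAdapted 𝓕 Y := stronglyAdapted_exp_integral hy hyc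
  have hYc : ∀ ω, Continuous fun t => Y t ω := continuous_exp_integral hyc
  have hYm : ∀ t, StronglyMeasurable (Y t) := fun t => (hYa t).mono (𝓕.le t)
  have hC0 : ∀ _ : Ω, 0 ≤ C := fun ω => (norm_nonneg _).trans (hC 0 ω)
  have hYC : ∀ x ≤ t, ∀ ω, ‖Y x ω‖ ≤ Real.exp (C * t) := fun x hx ω =>
    (norm_exp_integral_le (fun x => hC _ _) x.coe_nonneg).trans (Real.exp_le_exp.2
      (mul_le_mul_of_nonneg_left (NNReal.coe_le_coe.2 hx) (hC0 ω)))
  set E : ℝ≥0 → Ω → ℂ := fun t ω => Complex.exp (c * driving κ B ω t) with hE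
  have hEm : ∀ t, StronglyMeasurable (E t) := fun t =>
    (stronglyAdapted_exp_mul_driving hB κ c t).mono (𝓕.le t)
  have hX : ∀ t ω, expTerm κ B c y t ω = E t ω * Y t ω := fun t ω => rfl
  set W : ℝ → Ω → ℂ := fun x ω =>
    Complex.exp (γ * x) * ((γ + y x.toNNReal ω) * Y x.toNNReal ω) with hW
  have hWc : ∀ ω, Continuous fun x => W x ω := fun ω => by
    have h1 := (hyc ω).comp continuous_real_toNNReal
    have h2 := (hYc ω).comp continuous_real_toNNReal
    exact (by fun_prop : Continuous fun x : ℝ => Complex.exp (γ * x)).mul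
      ((continuous_const.add h1).mul h2)
  have hWm : ∀ x, StronglyMeasurable (W x) := fun x =>
    ((stronglyMeasurable_const.add (hym _)).mul (hYm _)).const_mul _
  have hFTC : ∀ ω, ∫ x in (s : ℝ)..t, W x ω =
      Complex.exp (γ * t) * Y t ω - Complex.exp (γ * s) * Y s ω := fun ω => by
    refine intervalIntegral.integral_eq_sub_of_hasDerivAt (f := fun x : ℝ =>
      Complex.exp (γ * x) * Complex.exp (∫ r in (0 : ℝ)..x, y r.toNNReal ω)) (fun x hx => ?_)
      ((hWc ω).intervalIntegrable _ _)
    rw [Set.uIcc_of_le hst'] at hx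
    have hx0 : 0 ≤ x := s.coe_nonneg.trans hx.1
    have h := hasDerivAt_exp_integral ((hyc ω).comp continuous_real_toNNReal) γ x
    simpa only [hW, hY, Real.coe_toNNReal x hx0, Function.comp] using h
  have hWC : ∀ x ∈ Set.Ioc (s : ℝ) t, ∀ ω, ‖W x ω‖ ≤
      Real.exp (‖γ‖ * t) * ((‖γ‖ + C) * Real.exp (C * t)) := fun x hx ω => by
    have hx0 : 0 ≤ x := s.coe_nonneg.trans hx.1.le
    rw [hW, norm_mul, norm_mul]
    have hC' := hC0 ω
    gcongr
    · refine (Complex.norm_exp_le_exp_norm _).trans (Real.exp_le_exp.2 ?_)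
      rw [norm_mul, Complex.norm_real, Real.norm_of_nonneg hx0]
      exact mul_le_mul_of_nonneg_left hx.2 (norm_nonneg _)
    · exact (norm_add_le _ _).trans (add_le_add le_rfl (hC _ _))
    · exact hYC _ (Real.toNNReal_le_iff_le_coe.2 hx.2) ω
  -- the two applications of Fubini's theorem
  have hI1 : Integrable (Function.uncurry fun x ω => Z ω * W x ω * E t ω)
      ((volume.restrict (Set.Ioc (s : ℝ) t)).prod P) := by
    have hm : StronglyMeasurable (Function.uncurry fun x ω => Z ω * W x ω * E t ω) :=
      stronglyMeasurable_uncurry_of_continuous_of_stronglyMeasurable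
        (fun ω => (continuous_const.mul (hWc ω)).mul continuous_const)
        (fun x => (hZm.mul (hWm x)).mul (hEm t))
    have hd := ((integrable_exp_driving hB κ c.re t).const_mul
      (Real.exp (‖γ‖ * t) * ((‖γ‖ + C) * Real.exp (C * t)))).comp_snd
        (volume.restrict (Set.Ioc (s : ℝ) t))
    refine hd.mono' hm.aestronglyMeasurable ?_
    have h1 : ∀ᵐ x ∂(volume.restrict (Set.Ioc (s : ℝ) t)), x ∈ Set.Ioc (s : ℝ) t :=
      ae_restrict_mem measurableSet_Ioc
    have h2 := (Measure.quasiMeasurePreserving_fst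
      (μ := volume.restrict (Set.Ioc (s : ℝ) t)) (ν := P)).ae h1
    filter_upwards [h2] with p hp
    simp only [Function.uncurry, norm_mul, hE, norm_exp_mul_driving]
    refine mul_le_mul_of_nonneg_right ?_ (Real.exp_pos _).le
    calc ‖Z p.2‖ * ‖W p.1 p.2‖ ≤ 1 * ‖W p.1 p.2‖ :=
          mul_le_mul_of_nonneg_right (hZ1 _) (norm_nonneg _)
      _ ≤ _ := by rw [one_mul]; exact hWC _ hp _
  set D : ℝ → Ω → ℂ := fun x ω =>
    (γ + y x.toNNReal ω) * expTerm κ B c y x.toNNReal ω with hD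
  have hDc : ∀ ω, Continuous fun x => D x ω := fun ω =>
    (continuous_const.add ((hyc ω).comp continuous_real_toNNReal)).mul
      ((continuous_expTerm hB κ c hyc ω).comp continuous_real_toNNReal)
  have hDm : ∀ x, StronglyMeasurable (D x) := fun x =>
    (stronglyMeasurable_const.add (hym _)).mul
      ((stronglyAdapted_expTerm hB κ c hy hyc _).mono (𝓕.le _))
  have hI2 : Integrable (Function.uncurry fun x ω => Z ω * D x ω)
      ((volume.restrict (Set.Ioc (s : ℝ) t)).prod P) := by
    have hm : StronglyMeasurable (Function.uncurry fun x ω => Z ω * D x ω) :=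
      stronglyMeasurable_uncurry_of_continuous_of_stronglyMeasurable
        (fun ω => continuous_const.mul (hDc ω)) (fun x => hZm.mul (hDm x))
    refine integrable_prod_of_le hB hκ (c := c.re) (K := (‖γ‖ + C) * Real.exp (C * t))
      hm.aestronglyMeasurable fun x hx ω => ?_
    have hx' : x.toNNReal ≤ t := Real.toNNReal_le_iff_le_coe.2 hx.2
    have hC' := hC0 ω
    calc ‖Z ω * D x ω‖ = ‖Z ω‖ * ‖D x ω‖ := norm_mul _ _
      _ ≤ 1 * ‖D x ω‖ := by gcongr; exact hZ1 _
      _ = ‖γ + y x.toNNReal ω‖ * (‖E x.toNNReal ω‖ * ‖Y x.toNNReal ω‖) := by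
        rw [one_mul, hD, norm_mul, hX, norm_mul]
      _ ≤ (‖γ‖ + C) * (‖E x.toNNReal ω‖ * Real.exp (C * t)) := by
        gcongr
        · exact (norm_add_le _ _).trans (add_le_add le_rfl (hC _ _))
        · exact hYC _ hx' ω
      _ = _ := by rw [hE, norm_exp_mul_driving]; ring
  have hEi : ∀ r ≤ t, ∀ r' ≤ t, Integrable (fun ω => Z ω * Y r ω * E r' ω) P := fun r hr r' _ => by
    refine integrable_of_norm_le_exp_driving hB κ ((hZm.mul (hYm r)).mul (hEm r'))
      (K := Real.exp (C * t)) (c := c.re) (t := r') fun ω => ?_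
    rw [norm_mul, norm_mul, hE, norm_exp_mul_driving]
    gcongr
    calc ‖Z ω‖ * ‖Y r ω‖ ≤ 1 * Real.exp (C * t) := by gcongr; exacts [hZ1 ω, hYC r hr ω]
      _ = _ := one_mul _
  -- Only the term at `s` needs conditioning: the mean of `Z Y_s E_t` is `exp (γ (t - s))` times
  -- that of `Z Y_s E_s`, so the exponential prefactors cancel.
  have hL : ∫ ω, Z ω * (expTerm κ B c y t ω - expTerm κ B c y s ω) ∂P =
      Complex.exp (-(γ * t)) * ∫ ω, (∫ x in (s : ℝ)..t, Z ω * W x ω * E t ω) ∂P := by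
    have e1 : ∀ ω, ∫ x in (s : ℝ)..t, Z ω * W x ω * E t ω =
        Complex.exp (γ * t) * (Z ω * Y t ω * E t ω) -
          Complex.exp (γ * s) * (Z ω * Y s ω * E t ω) := fun ω => by
      rw [intervalIntegral.integral_mul_const, intervalIntegral.integral_const_mul, hFTC]
      ring
    have e2 := integral_mul_exp_driving hB hκ c hst (hZ.mul (hYa s))
    have e3 : ∀ ω, Z ω * (expTerm κ B c y t ω - expTerm κ B c y s ω) =
        Z ω * Y t ω * E t ω - Z ω * Y s ω * E s ω := fun ω => by rw [hX, hX]; ring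
    simp only [e1, e3]
    rw [integral_sub (hEi t le_rfl t le_rfl) (hEi s hst s hst),
      integral_sub ((hEi t le_rfl t le_rfl).const_mul _) ((hEi s hst t le_rfl).const_mul _),
      integral_const_mul, integral_const_mul]
    rw [show (∫ ω, Z ω * Y s ω * E t ω ∂P) = _ from e2, mul_sub, ← mul_assoc, ← mul_assoc,
      ← Complex.exp_add, ← Complex.exp_add]
    rw [mul_comm _ (Complex.exp (κ * c ^ 2 / 2 * (t - s))), ← mul_assoc, ← Complex.exp_add]
    have z1 : -(γ * (t : ℂ)) + γ * t = 0 := by ring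
    have z2 : -(γ * (t : ℂ)) + γ * s + κ * c ^ 2 / 2 * (t - s) = 0 := by rw [hγ]; ring
    rw [z1, z2, Complex.exp_zero, one_mul, one_mul]
    rfl
  rw [hL]
  have e0 : ∀ ω, ∫ x in (s : ℝ)..t, Z ω * W x ω * E t ω =
      ∫ x in Set.Ioc (s : ℝ) t, Z ω * W x ω * E t ω :=
    fun ω => intervalIntegral.integral_of_le hst'
  have e4 : ∀ ω, Z ω * ∫ x in (s : ℝ)..t,
      (γ + y x.toNNReal ω) * expTerm κ B c y x.toNNReal ω =
        ∫ x in Set.Ioc (s : ℝ) t, Z ω * D x ω := fun ω => by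
    rw [intervalIntegral.integral_of_le hst', ← integral_const_mul]
  simp only [e0, e4]
  -- After Fubini the identity can be checked at each fixed time `x`, where `Z W_x` is `𝓕
  -- x`-measurable and `E_t` may be conditioned on `𝓕 x`.
  rw [← integral_integral_swap hI1]
  rw [← integral_integral_swap hI2, ← integral_const_mul]
  refine setIntegral_congr_fun measurableSet_Ioc fun x hx => ?_
  have hx0 : 0 ≤ x := s.coe_nonneg.trans hx.1.le
  have hx' : x.toNNReal ≤ t := Real.toNNReal_le_iff_le_coe.2 hx.2
  have hsx : s ≤ x.toNNReal := by rw [← NNReal.coe_le_coe, Real.coe_toNNReal x hx0]; exact hx.1.le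
  have hm : StronglyMeasurable[𝓕 x.toNNReal] fun ω => Z ω * W x ω :=
    (hZ.mono (𝓕.mono hsx)).mul (((stronglyMeasurable_const.add (hy _)).mul (hYa _)).const_mul _)
  have e5 := integral_mul_exp_driving hB hκ c hx' hm
  have hxc : ((x.toNNReal : ℝ≥0) : ℝ) = x := Real.coe_toNNReal x hx0
  show Complex.exp (-(γ * t)) * ∫ ω, Z ω * W x ω * E t ω ∂P = ∫ ω, Z ω * D x ω ∂P
  rw [show (∫ ω, Z ω * W x ω * E t ω ∂P) = _ from e5, mul_comm, mul_assoc, ← Complex.exp_add,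
    ← integral_mul_const]
  refine integral_congr_ae (Filter.Eventually.of_forall fun ω => ?_)
  have e6 : Complex.exp (γ * x) * Complex.exp (κ * c ^ 2 / 2 * (t - x) + -(γ * t)) = 1 := by
    rw [← Complex.exp_add, ← Complex.exp_zero]
    congr 1
    rw [hγ]; ring
  simp only [hW, hD, hX, hE, hxc]
  linear_combination Z ω * (γ + y x.toNNReal ω) * Y x.toNNReal ω *
    Complex.exp (c * driving κ B ω x.toNNReal) * e6

end ExpTerm

/-! ### Compensated processes -/

section Compensator

variable {P : Measure Ω} {𝓕 : Filtration ℝ≥0 mΩ} {B : ℝ≥0 → Ω → ℝ}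

/-- The continuous process `D` is the drift of `X`. -/
structure IsDrift (𝓕 : Filtration ℝ≥0 mΩ) (P : Measure Ω) (X D : ℝ≥0 → Ω → ℂ) : Prop where
  continuous : ∀ ω, Continuous fun t => D t ω
  martingale : Martingale (fun t ω => X t ω - ∫ x in (0 : ℝ)..t, D x.toNNReal ω) 𝓕 P

variable {X D X' D' : ℝ≥0 → Ω → ℂ}

theorem IsDrift.intervalIntegrable (h : IsDrift 𝓕 P X D) (ω : Ω) (a b : ℝ) :
    IntervalIntegrable (fun x : ℝ => D x.toNNReal ω) volume a b :=
  ((h.continuous ω).comp continuous_real_toNNReal).intervalIntegrable a b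

theorem IsDrift.add (h : IsDrift 𝓕 P X D) (h' : IsDrift 𝓕 P X' D') :
    IsDrift 𝓕 P (fun t ω => X t ω + X' t ω) (fun t ω => D t ω + D' t ω) := by
  refine ⟨fun ω => (h.continuous ω).add (h'.continuous ω), ?_⟩
  convert h.martingale.add h'.martingale using 1
  funext t ω
  simp only [Pi.add_apply]
  rw [intervalIntegral.integral_add (h.intervalIntegrable ω _ _) (h'.intervalIntegrable ω _ _)]
  ring

theorem _root_.MeasureTheory.Martingale.const_mul {M : ℝ≥0 → Ω → ℂ} (hM : Martingale M 𝓕 P)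
    (c : ℂ) : Martingale (fun t ω => c * M t ω) 𝓕 P := by
  refine ⟨fun t => (hM.stronglyAdapted t).const_mul c, fun s t hst => ?_⟩
  refine (condExp_smul c (M t) (𝓕 s)).trans ?_
  filter_upwards [hM.condExp_ae_eq hst] with ω hω
  simp [hω]

theorem IsDrift.const_mul (h : IsDrift 𝓕 P X D) (c : ℂ) :
    IsDrift 𝓕 P (fun t ω => c * X t ω) (fun t ω => c * D t ω) := by
  refine ⟨fun ω => continuous_const.mul (h.continuous ω), ?_⟩
  convert h.martingale.const_mul c using 1
  funext t ω
  rw [intervalIntegral.integral_const_mul]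
  ring

theorem martingale_of_tendsto {M : ℕ → ℝ≥0 → Ω → ℂ} {N : ℝ≥0 → Ω → ℂ} {G : ℝ≥0 → Ω → ℝ}
    [IsFiniteMeasure P] (hM : ∀ n, Martingale (M n) 𝓕 P)
    (hlim : ∀ t ω, Filter.Tendsto (fun n => M n t ω) Filter.atTop (nhds (N t ω)))
    (hG : ∀ t, Integrable (G t) P) (hle : ∀ n t ω, ‖M n t ω‖ ≤ G t ω) : Martingale N 𝓕 P := by
  have hadp : StronglyAdapted 𝓕 N := fun t =>
    stronglyMeasurable_of_tendsto Filter.atTop (fun n => (hM n).stronglyAdapted t)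
      (tendsto_pi_nhds.2 (hlim t))
  have hint : ∀ t, Integrable (N t) P := fun t =>
    (hG t).mono' ((hadp t).mono (𝓕.le t)).aestronglyMeasurable (Filter.Eventually.of_forall
      fun ω => le_of_tendsto (hlim t ω).norm (Filter.Eventually.of_forall fun n => hle n t ω))
  refine ⟨hadp, fun s t hst => ?_⟩
  refine (ae_eq_condExp_of_forall_setIntegral_eq (𝓕.le s) (hint t)
    (fun A _ _ => (hint s).integrableOn) (fun A hA _ => ?_) (hadp s).aestronglyMeasurable).symm
  have hA' : MeasurableSet A := 𝓕.le s _ hA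
  have key : ∀ r, Filter.Tendsto (fun n => ∫ ω in A, M n r ω ∂P) Filter.atTop
      (nhds (∫ ω in A, N r ω ∂P)) := fun r =>
    tendsto_integral_of_dominated_convergence (G r)
      (fun n => ((hM n).integrable r).aestronglyMeasurable.restrict) (hG r).integrableOn
      (fun n => Filter.Eventually.of_forall fun ω => hle n r ω)
      (Filter.Eventually.of_forall fun ω => hlim r ω)
  refine tendsto_nhds_unique (key s) ((key t).congr fun n => ?_)
  exact ((hM n).setIntegral_eq hst hA).symm

/-- Testing the increment identity with indicators `Z` of events in `𝓕 s` is exactly the martingale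
property of the compensated process. -/
theorem isDrift_expTerm (hB : IsFilteredBrownian 𝓕 B P) {κ : ℝ} (hκ : 0 < κ) (c : ℂ)
    {y : ℝ≥0 → Ω → ℂ} (hy : StronglyAdapted 𝓕 y) (hyc : ∀ ω, Continuous fun t => y t ω) {C : ℝ}
    (hC : ∀ t ω, ‖y t ω‖ ≤ C) :
    IsDrift 𝓕 P (expTerm κ B c y) fun t ω => (κ * c ^ 2 / 2 + y t ω) * expTerm κ B c y t ω := by
  have := hB.isProbabilityMeasure
  set D : ℝ≥0 → Ω → ℂ := fun t ω => (κ * c ^ 2 / 2 + y t ω) * expTerm κ B c y t ω with hD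
  have hDc : ∀ ω, Continuous fun t => D t ω := fun ω =>
    (continuous_const.add (hyc ω)).mul (continuous_expTerm hB κ c hyc ω)
  have hDa : StronglyAdapted 𝓕 D := fun t =>
    (stronglyMeasurable_const.add (hy t)).mul (stronglyAdapted_expTerm hB κ c hy hyc t)
  have hXa := stronglyAdapted_expTerm hB κ c hy hyc
  refine ⟨hDc, ?_⟩
  have hX : ∀ t, Integrable (expTerm κ B c y t) P := fun t =>
    integrable_of_norm_le_exp_driving hB κ ((hXa t).mono (𝓕.le t)) (norm_expTerm_le κ c hC t)
  have hI : ∀ s t : ℝ≥0, Integrable (fun ω => ∫ x in (s : ℝ)..t, D x.toNNReal ω) P := by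
    have h0 : ∀ s t : ℝ≥0, s ≤ t →
        Integrable (fun ω => ∫ x in (s : ℝ)..t, D x.toNNReal ω) P := fun s t hst => by
      have hm : StronglyMeasurable (Function.uncurry fun (x : ℝ) ω => D x.toNNReal ω) :=
        stronglyMeasurable_uncurry_of_continuous_of_stronglyMeasurable
          (fun ω => (hDc ω).comp continuous_real_toNNReal)
          (fun x => (hDa x.toNNReal).mono (𝓕.le _))
      have h := (integrable_prod_of_le hB hκ (s := s) (t := t) (c := c.re)
        (K := (‖(κ * c ^ 2 / 2 : ℂ)‖ + C) * Real.exp (C * t)) hm.aestronglyMeasurable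
        fun x hx ω => ?_).integral_prod_right
      · refine h.congr (Filter.Eventually.of_forall fun ω => ?_)
        exact (intervalIntegral.integral_of_le (NNReal.coe_le_coe.2 hst)).symm
      · have hC' : 0 ≤ C := (norm_nonneg _).trans (hC 0 ω)
        have hx' : (x.toNNReal : ℝ) ≤ t := by
          rw [Real.coe_toNNReal x (s.coe_nonneg.trans hx.1.le)]; exact hx.2
        rw [hD, norm_mul, mul_assoc]
        gcongr
        · exact (norm_add_le _ _).trans (add_le_add le_rfl (hC _ _))
        · refine (norm_expTerm_le κ c hC _ ω).trans ?_
          gcongr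
    intro s t
    rcases le_total s t with h | h
    · exact h0 s t h
    · refine (h0 t s h).neg.congr (Filter.Eventually.of_forall fun ω => ?_)
      exact (intervalIntegral.integral_symm _ _).symm
  have hint : ∀ t, Integrable (fun ω => expTerm κ B c y t ω - ∫ x in (0 : ℝ)..t, D x.toNNReal ω) P :=
    fun t => (hX t).sub (by simpa using hI 0 t)
  have hadp : StronglyAdapted 𝓕 fun t ω =>
      expTerm κ B c y t ω - ∫ x in (0 : ℝ)..t, D x.toNNReal ω := fun t =>
    (hXa t).sub (stronglyAdapted_integral hDa hDc t)
  refine ⟨hadp, fun s t hst => ?_⟩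
  refine (ae_eq_condExp_of_forall_setIntegral_eq (𝓕.le s) (hint t)
    (fun A _ _ => (hint s).integrableOn) (fun A hA _ => ?_) (hadp s).aestronglyMeasurable).symm
  have hA' : MeasurableSet A := 𝓕.le s _ hA
  have hZ : StronglyMeasurable[𝓕 s] (A.indicator fun _ => (1 : ℂ)) :=
    stronglyMeasurable_const.indicator hA
  have h := integral_mul_expTerm_sub hB hκ c hy hyc hC hst hZ fun ω => by
    by_cases hω : ω ∈ A <;> simp [hω]
  have hind : ∀ F : Ω → ℂ, ∫ ω, A.indicator (fun _ => (1 : ℂ)) ω * F ω ∂P = ∫ ω in A, F ω ∂P :=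
    fun F => by
      rw [← integral_indicator hA']
      refine integral_congr_ae (Filter.Eventually.of_forall fun ω => ?_)
      by_cases hω : ω ∈ A <;> simp [hω]
  rw [hind, hind] at h
  have e : ∀ ω, (expTerm κ B c y t ω - ∫ x in (0 : ℝ)..t, D x.toNNReal ω) =
      (expTerm κ B c y s ω - ∫ x in (0 : ℝ)..s, D x.toNNReal ω) +
        ((expTerm κ B c y t ω - expTerm κ B c y s ω) - ∫ x in (s : ℝ)..t, D x.toNNReal ω) :=
    fun ω => by
      have hi : ∀ a b : ℝ, IntervalIntegrable (fun x : ℝ => D x.toNNReal ω) volume a b :=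
        fun a b => ((hDc ω).comp continuous_real_toNNReal).intervalIntegrable a b
      rw [← intervalIntegral.integral_add_adjacent_intervals (hi 0 s) (hi s t)]
      ring
  have hXd : Integrable (fun ω => expTerm κ B c y t ω - expTerm κ B c y s ω) P := (hX t).sub (hX s)
  have hXI : Integrable (fun ω => expTerm κ B c y t ω - expTerm κ B c y s ω -
      ∫ x in (s : ℝ)..t, D x.toNNReal ω) P := hXd.sub (hI s t)
  simp only [e]
  rw [integral_add (hint s).integrableOn hXI.integrableOn,
    integral_sub hXd.integrableOn (hI s t).integrableOn, h]
  simp [hD]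

/-- The common exponential bound justifies dominated convergence both in the time integral and in
the expectations. Monotonicity of `K` lets the value `K t` serve on all of `[0, t]`. -/
theorem isDrift_of_tendsto (hB : IsFilteredBrownian 𝓕 B P) {κ : ℝ} (hκ : 0 < κ)
    {Xn Dn : ℕ → ℝ≥0 → Ω → ℂ} (h : ∀ n, IsDrift 𝓕 P (Xn n) (Dn n))
    (hDc : ∀ ω, Continuous fun t => D t ω)
    (hX : ∀ t ω, Filter.Tendsto (fun n => Xn n t ω) Filter.atTop (nhds (X t ω)))
    (hD : ∀ t ω, Filter.Tendsto (fun n => Dn n t ω) Filter.atTop (nhds (D t ω)))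
    {c : ℝ} {K : ℝ≥0 → ℝ} (hK : Monotone K)
    (hXK : ∀ n t ω, ‖Xn n t ω‖ ≤ K t * Real.exp (c * driving κ B ω t))
    (hDK : ∀ n t ω, ‖Dn n t ω‖ ≤ K t * Real.exp (c * driving κ B ω t)) : IsDrift 𝓕 P X D := by
  have := hB.isProbabilityMeasure
  refine ⟨hDc, ?_⟩
  have hec : ∀ ω, Continuous fun x : ℝ => Real.exp (c * driving κ B ω x.toNNReal) := fun ω =>
    Real.continuous_exp.comp (continuous_const.mul
      ((continuous_driving hB κ ω).comp continuous_real_toNNReal))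
  have hDK' : ∀ n ω (t : ℝ≥0), ∀ x ∈ Set.Ioc (0 : ℝ) t, ‖Dn n x.toNNReal ω‖ ≤
      K t * Real.exp (c * driving κ B ω x.toNNReal) := fun n ω t x hx => by
    refine (hDK _ _ _).trans ?_
    gcongr
    exact hK (Real.toNNReal_le_iff_le_coe.2 hx.2)
  refine martingale_of_tendsto (M := fun n t ω => Xn n t ω - ∫ x in (0 : ℝ)..t, Dn n x.toNNReal ω)
    (G := fun t ω => K t * Real.exp (c * driving κ B ω t) +
      ∫ x in (0 : ℝ)..t, K t * Real.exp (c * driving κ B ω x.toNNReal))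
    (fun n => (h n).martingale) (fun t ω => ?_) (fun t => ?_) (fun n t ω => ?_)
  · refine (hX t ω).sub (intervalIntegral.tendsto_integral_filter_of_dominated_convergence
      (fun x => K t * Real.exp (c * driving κ B ω x.toNNReal)) ?_ ?_ ?_ ?_)
    · exact Filter.Eventually.of_forall fun n =>
        (((h n).continuous ω).comp continuous_real_toNNReal).aestronglyMeasurable
    · refine Filter.Eventually.of_forall fun n => Filter.Eventually.of_forall fun x hx => ?_
      rw [Set.uIoc_of_le t.coe_nonneg] at hx
      exact hDK' n ω t x hx
    · exact ((continuous_const.mul (hec ω)).intervalIntegrable _ _)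
    · exact Filter.Eventually.of_forall fun x _ => hD _ ω
  · refine ((integrable_exp_driving hB κ c t).const_mul _).add ?_
    have h := ((integrable_prod_exp_driving hB hκ c 0 t).const_mul (K t)).integral_prod_right
    refine h.congr (Filter.Eventually.of_forall fun ω => ?_)
    exact (intervalIntegral.integral_of_le t.coe_nonneg).symm
  · refine (norm_sub_le _ _).trans (add_le_add (hXK n t ω) ?_)
    exact intervalIntegral.norm_integral_le_of_norm_le t.coe_nonneg
      (Filter.Eventually.of_forall fun x hx => hDK' n ω t x hx)
      ((continuous_const.mul (hec ω)).intervalIntegrable _ _)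

end Compensator

/-! ### The drift of a function of a rotated exponential process -/

section Ito

variable {P : Measure Ω} {𝓕 : Filtration ℝ≥0 mΩ} {B : ℝ≥0 → Ω → ℝ}

theorem expTerm_mul (κ : ℝ) (c c' : ℂ) {y y' : ℝ≥0 → Ω → ℂ} (hy : ∀ ω, Continuous fun t => y t ω)
    (hy' : ∀ ω, Continuous fun t => y' t ω) (t : ℝ≥0) (ω : Ω) :
    expTerm κ B c y t ω * expTerm κ B c' y' t ω =
      expTerm κ B (c + c') (fun t ω => y t ω + y' t ω) t ω := by
  have h := intervalIntegral.integral_add (μ := volume) (a := 0) (b := t)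
    (f := fun x : ℝ => y x.toNNReal ω) (g := fun x : ℝ => y' x.toNNReal ω)
    (((hy ω).comp continuous_real_toNNReal).intervalIntegrable _ _)
    (((hy' ω).comp continuous_real_toNNReal).intervalIntegrable _ _)
  simp only [expTerm]
  rw [h, Complex.exp_add, add_mul, Complex.exp_add]
  ring

theorem expTerm_pow (κ : ℝ) (c : ℂ) (y : ℝ≥0 → Ω → ℂ) (k : ℕ) (t : ℝ≥0) (ω : Ω) :
    expTerm κ B c y t ω ^ k = expTerm κ B (k * c) (fun t ω => k * y t ω) t ω := by
  simp only [expTerm]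
  rw [mul_pow, ← Complex.exp_nat_mul, ← Complex.exp_nat_mul, intervalIntegral.integral_const_mul,
    mul_assoc]

theorem conj_expTerm (κ : ℝ) (c : ℂ) (y : ℝ≥0 → Ω → ℂ) (t : ℝ≥0) (ω : Ω) :
    (starRingEnd ℂ) (expTerm κ B c y t ω) =
      expTerm κ B ((starRingEnd ℂ) c) (fun t ω => (starRingEnd ℂ) (y t ω)) t ω := by
  simp only [expTerm, map_mul, ← Complex.exp_conj, Complex.conj_ofReal,
    intervalIntegral.integral_of_le t.coe_nonneg, integral_conj]

/-- The drift rate of `exp (c θ + ∫ v) f(w) g(w̄)` relative to `exp (c θ + ∫ v)`, where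
`w = w₀ exp (-i θ + ∫ α)`, in terms of the values `f₀, f₁, f₂` of `f, (z∂) f, (z∂)² f` at `w`, and
of those for `g` at `w̄`. -/
def itoRate (κ : ℝ) (c v α f₀ f₁ f₂ g₀ g₁ g₂ : ℂ) : ℂ :=
  (v + κ * c ^ 2 / 2) * (f₀ * g₀) + (α - κ * c * Complex.I) * (f₁ * g₀) +
    ((starRingEnd ℂ) α + κ * c * Complex.I) * (f₀ * g₁) -
      κ / 2 * (f₂ * g₀ - 2 * (f₁ * g₁) + f₀ * g₂)

theorem norm_itoRate_le (κ : ℝ) (c : ℂ) {v α f₀ f₁ f₂ g₀ g₁ g₂ : ℂ} {Cv Cα K : ℝ} (hv : ‖v‖ ≤ Cv)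
    (hα : ‖α‖ ≤ Cα) (h0 : ‖f₀‖ ≤ K) (h1 : ‖f₁‖ ≤ K) (h2 : ‖f₂‖ ≤ K) (h0' : ‖g₀‖ ≤ K)
    (h1' : ‖g₁‖ ≤ K) (h2' : ‖g₂‖ ≤ K) :
    ‖itoRate κ c v α f₀ f₁ f₂ g₀ g₁ g₂‖ ≤
      (Cv + ‖κ * c ^ 2 / 2‖) * (K * K) + (Cα + ‖κ * c * Complex.I‖) * (K * K) +
        (Cα + ‖κ * c * Complex.I‖) * (K * K) + ‖(κ : ℂ) / 2‖ * (K * K + 2 * (K * K) + K * K) := by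
  have hm : ∀ {x y : ℂ}, ‖x‖ ≤ K → ‖y‖ ≤ K → ‖x * y‖ ≤ K * K := fun {x y} hx hy => by
    rw [norm_mul]
    exact mul_le_mul hx hy (norm_nonneg _) ((norm_nonneg _).trans hx)
  have hm' : ∀ {x y : ℂ} {L L' : ℝ}, ‖x‖ ≤ L → ‖y‖ ≤ L' → ‖x * y‖ ≤ L * L' :=
    fun {x y L L'} hx hy => by
      rw [norm_mul]
      exact mul_le_mul hx hy (norm_nonneg _) ((norm_nonneg _).trans hx)
  rw [itoRate]
  refine (norm_sub_le _ _).trans (add_le_add ((norm_add_le _ _).trans (add_le_add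
    ((norm_add_le _ _).trans (add_le_add ?_ ?_)) ?_)) ?_)
  · exact hm' ((norm_add_le _ _).trans (add_le_add hv le_rfl)) (hm h0 h0')
  · exact hm' ((norm_sub_le _ _).trans (add_le_add hα le_rfl)) (hm h1 h0')
  · refine hm' ((norm_add_le _ _).trans (add_le_add ?_ le_rfl)) (hm h0 h1')
    rwa [RCLike.norm_conj]
  · refine hm' le_rfl ((norm_add_le _ _).trans (add_le_add ((norm_sub_le _ _).trans
      (add_le_add (hm h2 h0') ?_)) (hm h0 h2')))
    exact hm' (by simp) (hm h1 h1')

open Polynomial in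
/-- The Euler operator `z ∂` on polynomials. -/
def euler (p : ℂ[X]) : ℂ[X] := X * derivative p

open Polynomial in
theorem euler_monomial (k : ℕ) (a : ℂ) : euler (monomial k a) = monomial k (k * a) := by
  rw [euler, derivative_monomial]
  rcases k with _ | k
  · simp
  · rw [X_mul_monomial]
    simp [mul_comm]

-- Multiplying `exp (c θ + ∫ v)` by `w^k w̄^l` gives another exponential process, with coefficient
-- `c - ik + il` and rate `v + k α + l ᾱ`. The Euler operator acts on monomials as multiplication by
-- the degree, so `itoRate` only reorganizes the drift already known for such a process.
open Polynomial in
theorem isDrift_monomial (hB : IsFilteredBrownian 𝓕 B P) {κ : ℝ} (hκ : 0 < κ) (c w₀ : ℂ)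
    {v α : ℝ≥0 → Ω → ℂ} (hv : StronglyAdapted 𝓕 v) (hvc : ∀ ω, Continuous fun t => v t ω) {Cv : ℝ}
    (hCv : ∀ t ω, ‖v t ω‖ ≤ Cv) (hα : StronglyAdapted 𝓕 α)
    (hαc : ∀ ω, Continuous fun t => α t ω) {Cα : ℝ} (hCα : ∀ t ω, ‖α t ω‖ ≤ Cα)
    {w : ℝ≥0 → Ω → ℂ} (hw : ∀ t ω, w t ω = w₀ * expTerm κ B (-Complex.I) α t ω) (k l : ℕ)
    (a b : ℂ) :
    IsDrift 𝓕 P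
      (fun t ω => expTerm κ B c v t ω *
        ((monomial k a).eval (w t ω) * (monomial l b).eval ((starRingEnd ℂ) (w t ω))))
      (fun t ω => expTerm κ B c v t ω * itoRate κ c (v t ω) (α t ω)
        ((monomial k a).eval (w t ω)) ((euler (monomial k a)).eval (w t ω))
        ((euler (euler (monomial k a))).eval (w t ω))
        ((monomial l b).eval ((starRingEnd ℂ) (w t ω)))
        ((euler (monomial l b)).eval ((starRingEnd ℂ) (w t ω)))
        ((euler (euler (monomial l b))).eval ((starRingEnd ℂ) (w t ω)))) := by
  have hαc' : ∀ ω, Continuous fun t => (starRingEnd ℂ) (α t ω) := fun ω =>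
    Complex.continuous_conj.comp (hαc ω)
  have hα' : StronglyAdapted 𝓕 fun t ω => (starRingEnd ℂ) (α t ω) := fun t =>
    Complex.continuous_conj.comp_stronglyMeasurable (hα t)
  set c' : ℂ := c + k * -Complex.I + l * Complex.I with hc'
  set y : ℝ≥0 → Ω → ℂ := fun t ω => v t ω + k * α t ω + l * (starRingEnd ℂ) (α t ω) with hy
  have hya : StronglyAdapted 𝓕 y := fun t =>
    ((hv t).add ((hα t).const_mul _)).add ((hα' t).const_mul _)
  have hyc : ∀ ω, Continuous fun t => y t ω := fun ω =>
    ((hvc ω).add (continuous_const.mul (hαc ω))).add (continuous_const.mul (hαc' ω))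
  have hyC : ∀ t ω, ‖y t ω‖ ≤ Cv + k * Cα + l * Cα := fun t ω => by
    refine (norm_add_le _ _).trans (add_le_add ((norm_add_le _ _).trans
      (add_le_add (hCv t ω) ?_)) ?_)
    · rw [norm_mul, Complex.norm_natCast]
      exact mul_le_mul_of_nonneg_left (hCα t ω) k.cast_nonneg
    · rw [norm_mul, Complex.norm_natCast, RCLike.norm_conj]
      exact mul_le_mul_of_nonneg_left (hCα t ω) l.cast_nonneg
  have h := (isDrift_expTerm hB hκ c' hya hyc hyC).const_mul
    (a * b * w₀ ^ k * (starRingEnd ℂ) w₀ ^ l)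
  have hX : ∀ t ω, expTerm κ B c v t ω * (w t ω ^ k * (starRingEnd ℂ) (w t ω) ^ l) =
      w₀ ^ k * (starRingEnd ℂ) w₀ ^ l * expTerm κ B c' y t ω := fun t ω => by
    rw [hw, map_mul, conj_expTerm, mul_pow, mul_pow, expTerm_pow, expTerm_pow]
    have e1 := expTerm_mul (B := B) κ c (k * -Complex.I) (y' := fun t ω => k * α t ω) hvc
      (fun ω => continuous_const.mul (hαc ω)) t ω
    have e2 := expTerm_mul (B := B) κ (c + k * -Complex.I) (l * Complex.I)
      (y := fun t ω => v t ω + k * α t ω) (y' := fun t ω => l * (starRingEnd ℂ) (α t ω))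
      (fun ω => (hvc ω).add (continuous_const.mul (hαc ω)))
      (fun ω => continuous_const.mul (hαc' ω)) t ω
    rw [hc', hy, ← e2, ← e1, map_neg, Complex.conj_I, neg_neg]
    ring
  convert h using 1
  · funext t ω
    rw [eval_monomial, eval_monomial]
    linear_combination a * b * hX t ω
  · funext t ω
    simp only [euler_monomial, eval_monomial, itoRate]
    have hI : Complex.I ^ 2 = -1 := Complex.I_sq
    -- Expanding `(c - i (k - l))²` produces the mixed terms with `κ c i` and the second-order term
    -- `-κ/2 (k - l)²`.
    have e3 : ((κ : ℂ) * c' ^ 2 / 2 + y t ω) = v t ω + κ * c ^ 2 / 2 + (α t ω - κ * c * Complex.I) * k +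
        ((starRingEnd ℂ) (α t ω) + κ * c * Complex.I) * l - κ / 2 * (k ^ 2 - 2 * (k * l) + l ^ 2) := by
      simp only [hc', hy]
      linear_combination (κ / 2 * (k - l) ^ 2 : ℂ) * hI
    rw [e3]
    linear_combination a * b * (v t ω + κ * c ^ 2 / 2 + (α t ω - κ * c * Complex.I) * k +
        ((starRingEnd ℂ) (α t ω) + κ * c * Complex.I) * l -
          κ / 2 * (k ^ 2 - 2 * (k * l) + l ^ 2)) * hX t ω

open Polynomial in
theorem euler_add (p q : ℂ[X]) : euler (p + q) = euler p + euler q := by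
  simp [euler, mul_add]

open Polynomial in
theorem isDrift_polynomial (hB : IsFilteredBrownian 𝓕 B P) {κ : ℝ} (hκ : 0 < κ) (c w₀ : ℂ)
    {v α : ℝ≥0 → Ω → ℂ} (hv : StronglyAdapted 𝓕 v) (hvc : ∀ ω, Continuous fun t => v t ω) {Cv : ℝ}
    (hCv : ∀ t ω, ‖v t ω‖ ≤ Cv) (hα : StronglyAdapted 𝓕 α)
    (hαc : ∀ ω, Continuous fun t => α t ω) {Cα : ℝ} (hCα : ∀ t ω, ‖α t ω‖ ≤ Cα)
    {w : ℝ≥0 → Ω → ℂ} (hw : ∀ t ω, w t ω = w₀ * expTerm κ B (-Complex.I) α t ω) (p q : ℂ[X]) :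
    IsDrift 𝓕 P
      (fun t ω => expTerm κ B c v t ω * (p.eval (w t ω) * q.eval ((starRingEnd ℂ) (w t ω))))
      (fun t ω => expTerm κ B c v t ω * itoRate κ c (v t ω) (α t ω)
        (p.eval (w t ω)) ((euler p).eval (w t ω)) ((euler (euler p)).eval (w t ω))
        (q.eval ((starRingEnd ℂ) (w t ω))) ((euler q).eval ((starRingEnd ℂ) (w t ω)))
        ((euler (euler q)).eval ((starRingEnd ℂ) (w t ω)))) := by
  induction p using Polynomial.induction_on' with
  | add p₁ p₂ h₁ h₂ =>
    convert h₁.add h₂ using 1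
    · funext t ω
      rw [eval_add]; ring
    · funext t ω
      simp only [euler_add, eval_add, itoRate]; ring
  | monomial k a =>
    induction q using Polynomial.induction_on' with
    | add q₁ q₂ h₁ h₂ =>
      convert h₁.add h₂ using 1
      · funext t ω
        rw [eval_add]; ring
      · funext t ω
        simp only [euler_add, eval_add, itoRate]; ring
    | monomial l b => exact isDrift_monomial hB hκ c w₀ hv hvc hCv hα hαc hCα hw k l a b

end Ito

/-! ### Polynomial approximation of holomorphic functions -/

open Polynomial Filter in
theorem tendsto_and_eventually_bound {F : ℕ → ℂ → ℂ} {f : ℂ → ℂ} {ρ R : ℝ} (hρ : ρ < R)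
    (hF : TendstoLocallyUniformlyOn F f atTop (Metric.ball 0 R))
    (hf : ContinuousOn f (Metric.ball 0 R)) :
    (∀ z ∈ Metric.closedBall (0 : ℂ) ρ, Tendsto (fun n => F n z) atTop (nhds (f z))) ∧
      ∃ K, ∀ᶠ n in atTop, ∀ z ∈ Metric.closedBall (0 : ℂ) ρ, ‖F n z‖ ≤ K := by
  have hsub := Metric.closedBall_subset_ball (x := (0 : ℂ)) hρ
  refine ⟨fun z hz => hF.tendsto_at (hsub hz), ?_⟩
  have hU := (tendstoLocallyUniformlyOn_iff_forall_isCompact Metric.isOpen_ball).1 hF _ hsub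
    (isCompact_closedBall 0 ρ)
  obtain ⟨K, hK⟩ := (isCompact_closedBall (0 : ℂ) ρ).exists_bound_of_continuousOn (hf.mono hsub)
  refine ⟨K + 1, ?_⟩
  filter_upwards [Metric.tendstoUniformlyOn_iff.1 hU 1 one_pos] with n hn z hz
  have h1 := hn z hz
  rw [dist_comm, dist_eq_norm] at h1
  calc ‖F n z‖ = ‖f z + (F n z - f z)‖ := by ring_nf
    _ ≤ K + 1 := (norm_add_le _ _).trans (add_le_add (hK z hz) h1.le)

open Polynomial Filter in
/-- Polynomial approximation of a holomorphic function on the unit disc, together with the first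
two powers of the Euler operator, boundedly on a smaller disc. -/
theorem exists_polynomial_approx {f : ℂ → ℂ} (hf : DifferentiableOn ℂ f (Metric.ball 0 1)) {ρ : ℝ}
    (hρ : ρ < 1) :
    ∃ (p : ℕ → ℂ[X]) (K : ℝ), ∀ z ∈ Metric.closedBall (0 : ℂ) ρ,
      (Tendsto (fun n => (p n).eval z) atTop (nhds (f z)) ∧
        Tendsto (fun n => (euler (p n)).eval z) atTop (nhds (z * deriv f z)) ∧
        Tendsto (fun n => (euler (euler (p n))).eval z) atTop
          (nhds (z * deriv f z + z ^ 2 * deriv (deriv f) z))) ∧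
      ∀ n, ‖(p n).eval z‖ ≤ K ∧ ‖(euler (p n)).eval z‖ ≤ K ∧ ‖(euler (euler (p n))).eval z‖ ≤ K := by
  -- A radius strictly between `max ρ 0` and `1`. The maximum keeps it positive, as the power series
  -- requires, even if `ρ` is negative.
  obtain ⟨R, hR1, hR2⟩ := exists_between (max_lt hρ one_pos)
  have hR0 : 0 < R := (le_max_right _ _).trans_lt hR1
  have hρR : ρ < R := (le_max_left _ _).trans_lt hR1
  lift R to ℝ≥0 using hR0.le
  have hfR : DifferentiableOn ℂ f (Metric.ball 0 R) :=
    hf.mono (Metric.ball_subset_ball hR2.le)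
  have hps := (hf.mono (Metric.closedBall_subset_ball hR2)).hasFPowerSeriesOnBall
    (NNReal.coe_pos.1 hR0)
  set s := cauchyPowerSeries f 0 R with hs
  set p : ℕ → ℂ[X] := fun n => ∑ k ∈ Finset.range n, monomial k (s.coeff k) with hp
  have hpe : ∀ n z, s.partialSum n z = (p n).eval z := fun n z => by
    simp only [FormalMultilinearSeries.partialSum, hp, eval_finsetSum, eval_monomial,
      FormalMultilinearSeries.apply_eq_pow_smul_coeff, smul_eq_mul, mul_comm]
  have h0 : TendstoLocallyUniformlyOn (fun n z => (p n).eval z) f atTop (Metric.ball 0 R) := by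
    have h := hps.tendstoLocallyUniformlyOn'
    rw [Metric.eball_coe] at h
    simpa only [sub_zero, hpe] using h
  have h1 := h0.deriv (Eventually.of_forall fun n => (p n).differentiable.differentiableOn)
    Metric.isOpen_ball
  have e1 : (deriv ∘ fun n z => (p n).eval z) = fun n z => (derivative (p n)).eval z := by
    funext n z
    simp
  rw [e1] at h1
  have h2 := h1.deriv (Eventually.of_forall fun n =>
    (derivative (p n)).differentiable.differentiableOn) Metric.isOpen_ball
  have e2 : (deriv ∘ fun n z => (derivative (p n)).eval z) =
      fun n z => (derivative (derivative (p n))).eval z := by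
    funext n z
    simp
  rw [e2] at h2
  have c1 := hfR.deriv Metric.isOpen_ball
  have c2 := c1.deriv Metric.isOpen_ball
  obtain ⟨t0, K0, b0⟩ := tendsto_and_eventually_bound hρR h0 hfR.continuousOn
  obtain ⟨t1, K1, b1⟩ := tendsto_and_eventually_bound hρR h1 c1.continuousOn
  obtain ⟨t2, K2, b2⟩ := tendsto_and_eventually_bound hρR h2 c2.continuousOn
  obtain ⟨N, hN⟩ := eventually_atTop.1 (b0.and (b1.and b2))
  have ev1 : ∀ n z, (euler (p n)).eval z = z * (derivative (p n)).eval z := fun n z => by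
    simp [euler]
  have ev2 : ∀ n z, (euler (euler (p n))).eval z =
      z * (derivative (p n)).eval z + z ^ 2 * (derivative (derivative (p n))).eval z :=
    fun n z => by
      simp [euler]
      ring
  -- The uniform bounds hold only from some index on, so the first `N` partial sums are discarded.
  refine ⟨fun n => p (n + N), max K0 (max K1 (K1 + K2)), fun z hz => ⟨⟨?_, ?_, ?_⟩, fun n => ?_⟩⟩
  · exact (tendsto_add_atTop_iff_nat N).2 (t0 z hz)
  · simp only [ev1]
    exact ((tendsto_add_atTop_iff_nat N).2 (t1 z hz)).const_mul z
  · simp only [ev2]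
    exact (((tendsto_add_atTop_iff_nat N).2 (t1 z hz)).const_mul z).add
      (((tendsto_add_atTop_iff_nat N).2 (t2 z hz)).const_mul (z ^ 2))
  · have hz1 : ‖z‖ ≤ 1 := (mem_closedBall_zero_iff.1 hz).trans hρ.le
    obtain ⟨q0, q1, q2⟩ := hN (n + N) (Nat.le_add_left _ _)
    have q1' : ‖z * (derivative (p (n + N))).eval z‖ ≤ K1 := by
      rw [norm_mul]
      exact (mul_le_of_le_one_left (norm_nonneg _) hz1).trans (q1 z hz)
    have q2' : ‖z ^ 2 * (derivative (derivative (p (n + N)))).eval z‖ ≤ K2 := by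
      rw [norm_mul, norm_pow]
      exact (mul_le_of_le_one_left (norm_nonneg _) (pow_le_one₀ (norm_nonneg _) hz1)).trans
        (q2 z hz)
    refine ⟨(q0 z hz).trans (le_max_left _ _), ?_, ?_⟩
    · rw [ev1]
      exact q1'.trans ((le_max_left _ _).trans (le_max_right _ _))
    · rw [ev2]
      exact (norm_add_le _ _).trans ((add_le_add q1' q2').trans
        ((le_max_right _ _).trans (le_max_right _ _)))

/-! ### Itô's formula for holomorphic times antiholomorphic functions -/

section Ito

variable {P : Measure Ω} {𝓕 : Filtration ℝ≥0 mΩ} {B : ℝ≥0 → Ω → ℝ}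

theorem continuous_itoRate_comp {T : Type*} [TopologicalSpace T] (κ : ℝ) (c : ℂ)
    {v α f₀ f₁ f₂ g₀ g₁ g₂ : T → ℂ} (hv : Continuous v) (hα : Continuous α) (h0 : Continuous f₀)
    (h1 : Continuous f₁) (h2 : Continuous f₂) (h0' : Continuous g₀) (h1' : Continuous g₁)
    (h2' : Continuous g₂) :
    Continuous fun t => itoRate κ c (v t) (α t) (f₀ t) (f₁ t) (f₂ t) (g₀ t) (g₁ t) (g₂ t) := by
  have := Complex.continuous_conj.comp hα
  have h : Continuous fun t => (starRingEnd ℂ) (α t) := this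
  simp only [itoRate]
  fun_prop

theorem tendsto_itoRate (κ : ℝ) (c v α : ℂ) {f₀ f₁ f₂ g₀ g₁ g₂ : ℕ → ℂ}
    {F₀ F₁ F₂ G₀ G₁ G₂ : ℂ} (h0 : Filter.Tendsto f₀ Filter.atTop (nhds F₀))
    (h1 : Filter.Tendsto f₁ Filter.atTop (nhds F₁)) (h2 : Filter.Tendsto f₂ Filter.atTop (nhds F₂))
    (h0' : Filter.Tendsto g₀ Filter.atTop (nhds G₀))
    (h1' : Filter.Tendsto g₁ Filter.atTop (nhds G₁))
    (h2' : Filter.Tendsto g₂ Filter.atTop (nhds G₂)) :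
    Filter.Tendsto (fun n => itoRate κ c v α (f₀ n) (f₁ n) (f₂ n) (g₀ n) (g₁ n) (g₂ n))
      Filter.atTop (nhds (itoRate κ c v α F₀ F₁ F₂ G₀ G₁ G₂)) :=
  ((((h0.mul h0').const_mul _).add ((h1.mul h0').const_mul _)).add
    ((h0.mul h1').const_mul _)).sub
      ((((h2.mul h0').sub ((h1.mul h1').const_mul _)).add (h0.mul h2')).const_mul _)

/-- **Itô's formula** for a product of a holomorphic and an antiholomorphic function of a rotated
exponential process in the unit disc. -/
theorem isDrift_holomorphic (hB : IsFilteredBrownian 𝓕 B P) {κ : ℝ} (hκ : 0 < κ) (c w₀ : ℂ)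
    {v α : ℝ≥0 → Ω → ℂ} (hv : StronglyAdapted 𝓕 v) (hvc : ∀ ω, Continuous fun t => v t ω) {Cv : ℝ}
    (hCv : ∀ t ω, ‖v t ω‖ ≤ Cv) (hα : StronglyAdapted 𝓕 α)
    (hαc : ∀ ω, Continuous fun t => α t ω) {Cα : ℝ} (hCα : ∀ t ω, ‖α t ω‖ ≤ Cα)
    {w : ℝ≥0 → Ω → ℂ} (hw : ∀ t ω, w t ω = w₀ * expTerm κ B (-Complex.I) α t ω) {ρ : ℝ}
    (hρ : ρ < 1) (hwρ : ∀ t ω, ‖w t ω‖ ≤ ρ) {f g : ℂ → ℂ}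
    (hf : DifferentiableOn ℂ f (Metric.ball 0 1)) (hg : DifferentiableOn ℂ g (Metric.ball 0 1)) :
    IsDrift 𝓕 P
      (fun t ω => expTerm κ B c v t ω * (f (w t ω) * g ((starRingEnd ℂ) (w t ω))))
      (fun t ω => expTerm κ B c v t ω * itoRate κ c (v t ω) (α t ω)
        (f (w t ω)) (w t ω * deriv f (w t ω))
        (w t ω * deriv f (w t ω) + w t ω ^ 2 * deriv (deriv f) (w t ω))
        (g ((starRingEnd ℂ) (w t ω)))
        ((starRingEnd ℂ) (w t ω) * deriv g ((starRingEnd ℂ) (w t ω)))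
        ((starRingEnd ℂ) (w t ω) * deriv g ((starRingEnd ℂ) (w t ω)) +
          (starRingEnd ℂ) (w t ω) ^ 2 * deriv (deriv g) ((starRingEnd ℂ) (w t ω)))) := by
  obtain ⟨p, Kp, hp⟩ := exists_polynomial_approx hf hρ
  obtain ⟨q, Kq, hq⟩ := exists_polynomial_approx hg hρ
  have hwm : ∀ t ω, w t ω ∈ Metric.closedBall (0 : ℂ) ρ := fun t ω =>
    mem_closedBall_zero_iff.2 (hwρ t ω)
  have hwm' : ∀ t ω, (starRingEnd ℂ) (w t ω) ∈ Metric.closedBall (0 : ℂ) ρ := fun t ω =>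
    mem_closedBall_zero_iff.2 (by rw [RCLike.norm_conj]; exact hwρ t ω)
  have hwc : ∀ ω, Continuous fun t => w t ω := fun ω => by
    simp only [hw]
    exact continuous_const.mul (continuous_expTerm hB κ _ hαc ω)
  have hwc' : ∀ ω, Continuous fun t => (starRingEnd ℂ) (w t ω) := fun ω =>
    Complex.continuous_conj.comp (hwc ω)
  have hball : Metric.closedBall (0 : ℂ) ρ ⊆ Metric.ball 0 1 := Metric.closedBall_subset_ball hρ
  have hcomp : ∀ {F : ℂ → ℂ} {u : ℝ≥0 → ℂ}, DifferentiableOn ℂ F (Metric.ball 0 1) →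
      Continuous u → (∀ t, u t ∈ Metric.closedBall (0 : ℂ) ρ) → Continuous fun t => F (u t) :=
    fun hF hu hm => hF.continuousOn.comp_continuous hu fun t => hball (hm t)
  have hf1 := hf.deriv Metric.isOpen_ball
  have hf2 := hf1.deriv Metric.isOpen_ball
  have hg1 := hg.deriv Metric.isOpen_ball
  have hg2 := hg1.deriv Metric.isOpen_ball
  set K := max Kp Kq with hK
  set L : ℝ := (Cv + ‖κ * c ^ 2 / 2‖) * (K * K) + (Cα + ‖κ * c * Complex.I‖) * (K * K) +
    (Cα + ‖κ * c * Complex.I‖) * (K * K) + ‖(κ : ℂ) / 2‖ * (K * K + 2 * (K * K) + K * K) with hL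
  have bp := fun n t ω => (hp _ (hwm t ω)).2 n
  have bq := fun n t ω => (hq _ (hwm' t ω)).2 n
  -- The dominating factor must be monotone in time, hence the absolute value of `Cv` and the
  -- maximum with `0`.
  refine isDrift_of_tendsto hB hκ
    (fun n => isDrift_polynomial hB hκ c w₀ hv hvc hCv hα hαc hCα hw (p n) (q n))
    (fun ω => ?_) (fun t ω => ?_) (fun t ω => ?_) (c := c.re)
    (K := fun t => Real.exp (|Cv| * t) * max (K * K) (max L 0)) ?_ (fun n t ω => ?_) (fun n t ω => ?_)
  · refine (continuous_expTerm hB κ c hvc ω).mul (continuous_itoRate_comp κ c (hvc ω) (hαc ω) ?_ ?_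
      ?_ ?_ ?_ ?_)
    · exact hcomp hf (hwc ω) (hwm · ω)
    · exact (hwc ω).mul (hcomp hf1 (hwc ω) (hwm · ω))
    · exact ((hwc ω).mul (hcomp hf1 (hwc ω) (hwm · ω))).add
        (((hwc ω).pow 2).mul (hcomp hf2 (hwc ω) (hwm · ω)))
    · exact hcomp hg (hwc' ω) (hwm' · ω)
    · exact (hwc' ω).mul (hcomp hg1 (hwc' ω) (hwm' · ω))
    · exact ((hwc' ω).mul (hcomp hg1 (hwc' ω) (hwm' · ω))).add
        (((hwc' ω).pow 2).mul (hcomp hg2 (hwc' ω) (hwm' · ω)))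
  · obtain ⟨⟨h0, h1, h2⟩, -⟩ := hp _ (hwm t ω)
    obtain ⟨⟨h0', h1', h2'⟩, -⟩ := hq _ (hwm' t ω)
    exact (h0.mul h0').const_mul _
  · obtain ⟨⟨h0, h1, h2⟩, -⟩ := hp _ (hwm t ω)
    obtain ⟨⟨h0', h1', h2'⟩, -⟩ := hq _ (hwm' t ω)
    exact (tendsto_itoRate κ c _ _ h0 h1 h2 h0' h1' h2').const_mul _
  · intro s t hst
    have : (s : ℝ) ≤ t := NNReal.coe_le_coe.2 hst
    show Real.exp (|Cv| * s) * _ ≤ Real.exp (|Cv| * t) * _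
    gcongr
  · rw [norm_mul, mul_right_comm]
    refine mul_le_mul ((norm_expTerm_le κ c hCv t ω).trans ?_) (le_trans ?_ (le_max_left _ _))
      (norm_nonneg _) (by positivity)
    · gcongr
      exact le_abs_self _
    · obtain ⟨b0, -, -⟩ := bp n t ω
      obtain ⟨b0', -, -⟩ := bq n t ω
      rw [norm_mul]
      exact mul_le_mul (b0.trans (le_max_left _ _)) (b0'.trans (le_max_right _ _)) (norm_nonneg _)
        ((norm_nonneg _).trans (b0.trans (le_max_left _ _)))
  · rw [norm_mul, mul_right_comm]
    refine mul_le_mul ((norm_expTerm_le κ c hCv t ω).trans ?_)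
      (le_trans ?_ ((le_max_left L 0).trans (le_max_right _ _))) (norm_nonneg _) (by positivity)
    · gcongr
      exact le_abs_self _
    · obtain ⟨b0, b1, b2⟩ := bp n t ω
      obtain ⟨b0', b1', b2'⟩ := bq n t ω
      exact norm_itoRate_le κ c (hCv t ω) (hCα t ω) (b0.trans (le_max_left _ _))
        (b1.trans (le_max_left _ _)) (b2.trans (le_max_left _ _)) (b0'.trans (le_max_right _ _))
        (b1'.trans (le_max_right _ _)) (b2'.trans (le_max_right _ _))

end Ito

/-! ### The drift of the 1-point function -/

/-- `(1 - w) ^ p` for the principal branch. -/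
def oneSubPow (p w : ℂ) : ℂ := Complex.exp (p * Complex.log (1 - w))

theorem hasDerivAt_oneSubPow (p : ℂ) {w : ℂ} (hw : ‖w‖ < 1) :
    HasDerivAt (oneSubPow p) (-p / (1 - w) * oneSubPow p w) w := by
  have h1 : HasDerivAt (fun w : ℂ => 1 - w) (-1) w := (hasDerivAt_id w).const_sub 1
  have hs : (1 - w) ∈ Complex.slitPlane := by
    refine Complex.mem_slitPlane_iff.2 (Or.inl ?_)
    have := (Complex.re_le_norm w).trans_lt hw
    simp only [Complex.sub_re, Complex.one_re]
    linarith
  refine ((h1.clog hs).const_mul p).cexp.congr_deriv ?_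
  rw [oneSubPow]
  ring

theorem differentiableOn_oneSubPow (p : ℂ) : DifferentiableOn ℂ (oneSubPow p) (Metric.ball 0 1) :=
  fun _ hw => (hasDerivAt_oneSubPow p
    (mem_ball_zero_iff.1 hw)).differentiableAt.differentiableWithinAt

theorem deriv_oneSubPow (p : ℂ) {w : ℂ} (hw : ‖w‖ < 1) :
    w * deriv (oneSubPow p) w = -p * (w / (1 - w)) * oneSubPow p w := by
  rw [(hasDerivAt_oneSubPow p hw).deriv]
  ring

theorem deriv_deriv_oneSubPow (p : ℂ) {w : ℂ} (hw : ‖w‖ < 1) :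
    w ^ 2 * deriv (deriv (oneSubPow p)) w = p * (p - 1) * (w / (1 - w)) ^ 2 * oneSubPow p w := by
  have he : deriv (oneSubPow p) =ᶠ[nhds w] fun w => -p / (1 - w) * oneSubPow p w := by
    filter_upwards [Metric.isOpen_ball.mem_nhds (mem_ball_zero_iff.2 hw)] with z hz
    exact (hasDerivAt_oneSubPow p (mem_ball_zero_iff.1 hz)).deriv
  have h0 := one_sub_ne_zero_of_norm_lt hw
  have h1 : HasDerivAt (fun w : ℂ => 1 - w) (-1) w := (hasDerivAt_id w).const_sub 1
  have h2 := ((hasDerivAt_const w (-p)).div h1 h0).mul (hasDerivAt_oneSubPow p hw)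
  rw [he.deriv_eq, show deriv (fun w => -p / (1 - w) * oneSubPow p w) w = _ from h2.deriv]
  simp only [Pi.div_apply]
  field_simp
  ring

theorem measurable_oneSubPow (p : ℂ) : Measurable (oneSubPow p) := by
  unfold oneSubPow
  exact Complex.measurable_exp.comp
    ((Complex.measurable_log.comp (measurable_const.sub measurable_id)).const_mul p)

/-- The drift of the 1-point function relative to its value, as a function of `w`. -/
def vertexDrift (κ : ℝ) (σ σs σq σqs w : ℂ) : ℂ :=
  ((σ + σq) * (σ + σq - aParam κ) / 2 + (σs + σqs) * (σs + σqs - aParam κ) / 2 -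
      κ * vertexGap κ σ σs σq σqs ^ 2 / 2) +
    σ * (2 * (σ + σq) + κ * aParam κ * vertexGap κ σ σs σq σqs) * (w / (1 - w)) +
    σs * (2 * (σs + σqs) - κ * aParam κ * vertexGap κ σ σs σq σqs) *
      ((starRingEnd ℂ) w / (1 - (starRingEnd ℂ) w))

theorem mul_aParam_sq {κ : ℝ} (hκ : 0 < κ) : (κ : ℂ) * (aParam κ : ℂ) ^ 2 = 2 := by
  rw [aParam, ← Complex.ofReal_pow, Real.sq_sqrt (by positivity), ← Complex.ofReal_mul,
    mul_div_cancel₀ _ hκ.ne']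
  norm_num

theorem bParam_eq {κ : ℝ} (hκ : 0 < κ) : (bParam κ : ℂ) = κ * aParam κ / 4 - aParam κ := by
  have h : Real.sqrt (κ / 8) = κ * Real.sqrt (2 / κ) / 4 := by
    rw [show κ / 8 = (κ / 4) ^ 2 * (2 / κ) by field_simp; norm_num, Real.sqrt_mul (by positivity),
      Real.sqrt_sq (by positivity)]
    ring
  rw [bParam, aParam, h]
  push_cast
  ring

/-- Each total dimension `h + ν̂ + ĥ_q` collapses to `x (x - a) / 2` with `x = σ + σ_q`, as the
terms in `b` cancel. The difference of two such expressions factors. -/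
theorem vertexGap_eq (κ : ℝ) (σ σs σq σqs : ℂ) :
    vertexGap κ σ σs σq σqs = ((σ + σq) - (σs + σqs)) * ((σ + σq) + (σs + σqs) - aParam κ) / 2 := by
  simp only [vertexGap, nodeDim, nodeExp, rootDim]
  ring

/-- In terms of `s = w / (1 - w)`, `radialPhi w = 1 + 2s` and `radialPsi w = 1 + 4s + 2s²`, while
the Euler derivatives of `(1 - w)^p` are polynomials in `s`. The coefficient of `s²` vanishes
because `κ a² = 2` and `b = κ a / 4 - a`, which accounts for the value of `h`. That of `s s̄`
vanishes because the covariation term `κ a² σσ_*` cancels the rate `-2 σσ_*` of `(1 - |w|²)^{σσ_*}`.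
-/
theorem itoRate_vertex {κ : ℝ} (hκ : 0 < κ) (σ σs σq σqs : ℂ) {w : ℂ} (hw : ‖w‖ < 1) :
    itoRate κ (-(vertexGap κ σ σs σq σqs * Complex.I)) (vertexRate κ σ σs σq σqs w) (radialPhi w)
        (oneSubPow (aParam κ * σ) w) (w * deriv (oneSubPow (aParam κ * σ)) w)
        (w * deriv (oneSubPow (aParam κ * σ)) w + w ^ 2 * deriv (deriv (oneSubPow (aParam κ * σ))) w)
        (oneSubPow (aParam κ * σs) ((starRingEnd ℂ) w))
        ((starRingEnd ℂ) w * deriv (oneSubPow (aParam κ * σs)) ((starRingEnd ℂ) w))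
        ((starRingEnd ℂ) w * deriv (oneSubPow (aParam κ * σs)) ((starRingEnd ℂ) w) +
          (starRingEnd ℂ) w ^ 2 * deriv (deriv (oneSubPow (aParam κ * σs))) ((starRingEnd ℂ) w)) =
      oneSubPow (aParam κ * σ) w * oneSubPow (aParam κ * σs) ((starRingEnd ℂ) w) *
        vertexDrift κ σ σs σq σqs w := by
  have hw' : ‖(starRingEnd ℂ) w‖ < 1 := by rwa [RCLike.norm_conj]
  rw [deriv_oneSubPow _ hw, deriv_oneSubPow _ hw', deriv_deriv_oneSubPow _ hw,
    deriv_deriv_oneSubPow _ hw']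
  have h0 := one_sub_ne_zero_of_norm_lt hw
  have h0' := one_sub_ne_zero_of_norm_lt hw'
  have hφ : ∀ {z : ℂ}, 1 - z ≠ 0 → radialPhi z = 1 + 2 * (z / (1 - z)) := fun {z} hz => by
    rw [radialPhi]; field_simp; ring
  have hψ : ∀ {z : ℂ}, 1 - z ≠ 0 → radialPsi z = 1 + 4 * (z / (1 - z)) + 2 * (z / (1 - z)) ^ 2 :=
    fun {z} hz => by rw [radialPsi]; field_simp; ring
  have hsp : w * (starRingEnd ℂ) w / ((1 - w) * (1 - (starRingEnd ℂ) w)) =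
      w / (1 - w) * ((starRingEnd ℂ) w / (1 - (starRingEnd ℂ) w)) := (div_mul_div_comm _ _ _ _).symm
  rw [itoRate, conj_radialPhi, vertexRate, mul_div_assoc (-2 : ℂ), hsp, hφ h0, hφ h0', hψ h0, hψ h0', vertexDrift]
  have hI : Complex.I ^ 2 = -1 := Complex.I_sq
  have ha := mul_aParam_sq hκ
  have hb := bParam_eq hκ
  have hG : nodeDim κ σ + nodeExp κ σ σq + rootDim κ σq =
      (σ + σq) * (σ + σq - aParam κ) / 2 := by
    simp only [nodeDim, nodeExp, rootDim]; ring
  have hG' : nodeDim κ σs + nodeExp κ σs σqs + rootDim κ σqs =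
      (σs + σqs) * (σs + σqs - aParam κ) / 2 := by
    simp only [nodeDim, nodeExp, rootDim]; ring
  have hn : ∀ σ σq, nodeExp κ σ σq = (bParam κ - aParam κ / 2 + σq) * σ := fun _ _ => rfl
  have hd : ∀ σ, nodeDim κ σ = σ ^ 2 / 2 - bParam κ * σ := fun _ => rfl
  generalize vertexGap κ σ σs σq σqs = Δ
  generalize w / (1 - w) = s
  generalize (starRingEnd ℂ) w / (1 - (starRingEnd ℂ) w) = s'
  generalize oneSubPow (aParam κ * σ) w = f
  generalize oneSubPow (aParam κ * σs) ((starRingEnd ℂ) w) = g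
  rw [← hG, ← hG']
  generalize rootDim κ σq = hq
  generalize rootDim κ σqs = hqs
  simp only [hn, hd]
  rw [hb]
  generalize (aParam κ : ℂ) = a at *
  linear_combination f * g * (κ * Δ ^ 2 / 2 - κ * Δ * a * σ * s + κ * Δ * a * σs * s') * hI -
    f * g * (σ * s - σs * s') ^ 2 / 2 * ha

/-! ### Adaptedness and drift along the truncated flow -/

section Flow

variable {P : Measure Ω} {𝓕 : Filtration ℝ≥0 mΩ} {B : ℝ≥0 → Ω → ℝ}

theorem measurable_uncurry_cutField (r : ℝ) : Measurable (Function.uncurry (cutField r)) := by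
  have h := (continuous_cutWeight r).measurable
  have h1 : Measurable fun p : ℂ × ℂ => ((cutWeight r ‖p.2‖ : ℝ) : ℂ) :=
    Complex.measurable_ofReal.comp (h.comp measurable_snd.norm)
  have h2 : Measurable fun p : ℂ × ℂ => p.2 * (p.1 + p.2) / (p.1 - p.2) := by fun_prop
  exact h1.mul h2

theorem stronglyAdapted_cutFlow (hB : IsFilteredBrownian 𝓕 B P) (κ : ℝ) {r : ℝ} (hr : r < 1)
    (ζ : ℂ) : StronglyAdapted 𝓕 fun (t : ℝ≥0) ω => cutFlow r (driving κ B ω) ζ t := by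
  have hθ := continuous_driving hB κ
  refine stronglyAdapted_of_hasDerivAt (G := cutField r) (K := cutConst r) (x := ζ)
    (ξ := fun t ω => drivingPoint (driving κ B ω) t) (u := fun t ω => cutFlow r (driving κ B ω) ζ t)
    (measurable_uncurry_cutField r) (fun t => ?_)
    (fun t ω => lipschitzWith_cutField hr (norm_drivingPoint _ t))
    (fun u ω => continuous_cutField_left hr (continuous_drivingPoint (hθ ω))
      (norm_drivingPoint _) u)
    (fun t ω u => norm_cutField_le hr (norm_drivingPoint _ t) u)
    (fun ω => (cutFlow_spec hr (hθ ω) ζ).1) fun ω t => (cutFlow_spec hr (hθ ω) ζ).2 t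
  simp only [drivingPoint_coe]
  exact Measurable.stronglyMeasurable (Complex.measurable_exp.comp ((Complex.measurable_ofReal.comp
    (stronglyAdapted_driving hB κ t).measurable).mul_const _))

theorem stronglyAdapted_cutCentered (hB : IsFilteredBrownian 𝓕 B P) (κ : ℝ) {r : ℝ} (hr : r < 1)
    (ζ : ℂ) : StronglyAdapted 𝓕 fun (t : ℝ≥0) ω => cutCentered r (driving κ B ω) ζ t := by
  intro t
  simp only [cutCentered, Real.toNNReal_coe]
  refine (stronglyAdapted_cutFlow hB κ hr ζ t).mul (Measurable.stronglyMeasurable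
    (Complex.measurable_exp.comp ((Complex.measurable_ofReal.comp
      (stronglyAdapted_driving hB κ t).measurable).mul_const _).neg))

/-- The logarithmic derivative of the truncated flow. -/
def cutRate (r : ℝ) (w : ℂ) : ℂ := cutWeight r ‖w‖ * radialPhi w

theorem continuousOn_radialPhi : ContinuousOn radialPhi (Metric.ball 0 1) :=
  continuousOn_const.add (continuousOn_const.div (continuousOn_const.sub continuousOn_id)
    fun _ hw => one_sub_ne_zero_of_norm_lt (mem_ball_zero_iff.1 hw))

theorem continuousOn_radialPsi : ContinuousOn radialPsi (Metric.ball 0 1) :=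
  continuousOn_const.add (continuousOn_const.div ((continuousOn_const.sub continuousOn_id).pow 2)
    fun _ hw => pow_ne_zero 2 (one_sub_ne_zero_of_norm_lt (mem_ball_zero_iff.1 hw)))

theorem conj_mem_unitBall {w : ℂ} (hw : w ∈ Metric.ball (0 : ℂ) 1) :
    (starRingEnd ℂ) w ∈ Metric.ball (0 : ℂ) 1 := by
  rw [mem_ball_zero_iff] at hw ⊢
  rwa [RCLike.norm_conj]

theorem continuousOn_cutRate (r : ℝ) : ContinuousOn (cutRate r) (Metric.ball 0 1) :=
  ((Complex.continuous_ofReal.comp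
    ((continuous_cutWeight r).comp continuous_norm)).continuousOn).mul continuousOn_radialPhi

theorem continuousOn_vertexRate (κ : ℝ) (σ σs σq σqs : ℂ) :
    ContinuousOn (vertexRate κ σ σs σq σqs) (Metric.ball 0 1) := by
  have hconj : ContinuousOn (starRingEnd ℂ) (Metric.ball (0 : ℂ) 1) :=
    Complex.continuous_conj.continuousOn
  have hm : Set.MapsTo (starRingEnd ℂ) (Metric.ball (0 : ℂ) 1) (Metric.ball (0 : ℂ) 1) :=
    fun _ hw => conj_mem_unitBall hw
  have h1 := continuousOn_radialPhi
  have h2 := continuousOn_radialPsi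
  have h1' := continuousOn_radialPhi.comp hconj hm
  have h2' := continuousOn_radialPsi.comp hconj hm
  have h3 : ContinuousOn (fun w : ℂ => -2 * (w * (starRingEnd ℂ) w) /
      ((1 - w) * (1 - (starRingEnd ℂ) w))) (Metric.ball 0 1) :=
    (continuousOn_const.mul (continuousOn_id.mul hconj)).div
      ((continuousOn_const.sub continuousOn_id).mul (continuousOn_const.sub hconj))
      fun w hw => mul_ne_zero (one_sub_ne_zero_of_norm_lt (mem_ball_zero_iff.1 hw))
        (one_sub_ne_zero_of_norm_lt (mem_ball_zero_iff.1 (conj_mem_unitBall hw)))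
  exact ((((continuousOn_const.mul h2).add (continuousOn_const.mul h2')).add
    ((continuousOn_const.mul h1).add (continuousOn_const.mul h1'))).add continuousOn_const).add
    (continuousOn_const.mul h3)

theorem measurable_radialPhi : Measurable radialPhi := by
  unfold radialPhi
  fun_prop

theorem measurable_vertexRate (κ : ℝ) (σ σs σq σqs : ℂ) :
    Measurable (vertexRate κ σ σs σq σqs) := by
  have := Complex.continuous_conj.measurable
  unfold vertexRate radialPhi radialPsi
  fun_prop

theorem measurable_cutRate (r : ℝ) : Measurable (cutRate r) :=
  (Complex.measurable_ofReal.comp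
    ((continuous_cutWeight r).measurable.comp measurable_norm)).mul measurable_radialPhi

theorem cutCentered_coe_toNNReal (r : ℝ) (θ : ℝ≥0 → ℝ) (ζ : ℂ) (x : ℝ) :
    cutCentered r θ ζ (x.toNNReal : ℝ) = cutCentered r θ ζ x := by
  simp only [cutCentered, Real.toNNReal_coe]

/-- The cut-off only rescales the logarithmic derivative of the flow, and the rotation contributes
`-iθ`. The centered flow thus has the exponential form that Itô's formula above requires. -/
theorem cutCentered_eq (hB : IsFilteredBrownian 𝓕 B P) (κ : ℝ) {r : ℝ} (hr : r < 1) {ζ : ℂ}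
    (hζ : ‖ζ‖ ≤ (1 + r) / 2) (t : ℝ≥0) (ω : Ω) :
    cutCentered r (driving κ B ω) ζ t = ζ * expTerm κ B (-Complex.I)
      (fun (t : ℝ≥0) ω => cutRate r (cutCentered r (driving κ B ω) ζ t)) t ω := by
  have hθ := continuous_driving hB κ ω
  set θ := driving κ B ω with hθdef
  have hρ : (1 + r) / 2 < 1 := by linarith
  have hlt : ∀ x, ‖cutCentered r θ ζ x‖ < 1 := fun x =>
    (norm_cutCentered_le hr hθ hζ x).trans_lt hρ
  obtain ⟨h0, hd⟩ := cutFlow_spec hr hθ ζ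
  have hk : Continuous fun x : ℝ => cutRate r (cutCentered r θ ζ x) :=
    (continuousOn_cutRate r).comp_continuous (continuous_cutCentered hr hθ ζ)
      fun x => mem_ball_zero_iff.2 (hlt x)
  have h := eq_mul_exp_integral_of_hasDerivWithinAt (y := cutFlow r θ ζ)
    (k := fun x => cutRate r (cutCentered r θ ζ x)) t.coe_nonneg hk.continuousOn
    (fun s hs => by
      refine (hd s).hasDerivWithinAt.congr_deriv ?_
      have hne : cutCentered r θ ζ s ≠ 1 := fun h1 => by
        have := hlt s
        rw [h1, norm_one] at this
        exact lt_irrefl _ this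
      have hns : ‖cutCentered r θ ζ s‖ = ‖cutFlow r θ ζ s‖ := by
        rw [norm_cutCentered, Real.coe_toNNReal s hs.1]
      rw [cutField, cutRate, hns, ← radialPhi_cutCentered r θ ζ hs.1 hne]
      ring) t ⟨t.coe_nonneg, le_rfl⟩
  rw [h0] at h
  rw [expTerm, ← hθdef]
  simp only [cutCentered_coe_toNNReal]
  rw [cutCentered, Real.toNNReal_coe, h, mul_assoc, mul_comm (Complex.exp _), neg_mul,
    mul_comm Complex.I]

/-- The 1-point function along the truncated flow is a semimartingale with the expected drift. -/
theorem exists_isDrift_vertexModel (hB : IsFilteredBrownian 𝓕 B P) {κ : ℝ} (hκ : 0 < κ)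
    (σ σs σq σqs : ℂ) {r : ℝ} (hr : r < 1) {ζ : ℂ} (hζ : ‖ζ‖ ≤ (1 + r) / 2) :
    ∃ D : ℝ≥0 → Ω → ℂ, StronglyAdapted 𝓕 D ∧
      IsDrift 𝓕 P (fun t ω => vertexModel κ σ σs σq σqs (driving κ B ω)
        (cutCentered r (driving κ B ω) ζ) t) D ∧
      ∀ (t : ℝ≥0) ω, ‖cutFlow r (driving κ B ω) ζ t‖ ≤ r →
        D t ω = vertexModel κ σ σs σq σqs (driving κ B ω) (cutCentered r (driving κ B ω) ζ) t *
          vertexDrift κ σ σs σq σqs (cutCentered r (driving κ B ω) ζ t) := by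
  have hθ := continuous_driving hB κ
  have hρ : (1 + r) / 2 < 1 := by linarith
  set w : ℝ≥0 → Ω → ℂ := fun t ω => cutCentered r (driving κ B ω) ζ t with hwdef
  have hwρ : ∀ t ω, ‖w t ω‖ ≤ (1 + r) / 2 := fun t ω => norm_cutCentered_le hr (hθ ω) hζ t
  have hwlt : ∀ t ω, ‖w t ω‖ < 1 := fun t ω => (hwρ t ω).trans_lt hρ
  have hwc : ∀ ω, Continuous fun t => w t ω := fun ω =>
    (continuous_cutCentered hr (hθ ω) ζ).comp NNReal.continuous_coe
  have hwa : StronglyAdapted 𝓕 w := stronglyAdapted_cutCentered hB κ hr ζ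
  have hcomp : ∀ {F : ℂ → ℂ}, ContinuousOn F (Metric.ball 0 1) → ∀ ω, Continuous fun t => F (w t ω) :=
    fun hF ω => hF.comp_continuous (hwc ω) fun t => mem_ball_zero_iff.2 (hwlt t ω)
  have hbound : ∀ {F : ℂ → ℂ}, ContinuousOn F (Metric.ball 0 1) → ∃ C, ∀ t ω, ‖F (w t ω)‖ ≤ C :=
    fun hF => by
      obtain ⟨C, hC⟩ := (isCompact_closedBall (0 : ℂ) ((1 + r) / 2)).exists_bound_of_continuousOn
        (hF.mono (Metric.closedBall_subset_ball hρ))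
      exact ⟨C, fun t ω => hC _ (mem_closedBall_zero_iff.2 (hwρ t ω))⟩
  have hmeas : ∀ {F : ℂ → ℂ}, Measurable F → StronglyAdapted 𝓕 fun t ω => F (w t ω) :=
    fun hF t => (hF.comp (hwa t).measurable).stronglyMeasurable
  obtain ⟨Cv, hCv⟩ := hbound (continuousOn_vertexRate κ σ σs σq σqs)
  obtain ⟨Cα, hCα⟩ := hbound (continuousOn_cutRate r)
  set c : ℂ := -(vertexGap κ σ σs σq σqs * Complex.I) with hc
  set v : ℝ≥0 → Ω → ℂ := fun t ω => vertexRate κ σ σs σq σqs (w t ω) with hv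
  set f := oneSubPow (aParam κ * σ) with hf
  set g := oneSubPow (aParam κ * σs) with hg
  have hva : StronglyAdapted 𝓕 v := hmeas (measurable_vertexRate κ σ σs σq σqs)
  have hvc := hcomp (continuousOn_vertexRate κ σ σs σq σqs)
  have hD := isDrift_holomorphic hB hκ c ζ (v := v) (α := fun t ω => cutRate r (w t ω)) (w := w)
    hva hvc hCv
    (hmeas (measurable_cutRate r)) (hcomp (continuousOn_cutRate r)) hCα
    (fun t ω => cutCentered_eq hB κ hr hζ t ω) hρ hwρ
    (differentiableOn_oneSubPow (aParam κ * σ)) (differentiableOn_oneSubPow (aParam κ * σs))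
  have hX : ∀ t ω, expTerm κ B c v t ω * (f (w t ω) * g ((starRingEnd ℂ) (w t ω))) =
      vertexModel κ σ σs σq σqs (driving κ B ω) (cutCentered r (driving κ B ω) ζ) t := fun t ω => by
    simp only [expTerm, vertexModel, hv, hwdef, cutCentered_coe_toNNReal, hf, hg, oneSubPow, hc]
    ring
  simp only [← hf, ← hg, hX] at hD
  refine ⟨_, ?_, hD, ?_⟩
  rotate_left
  · intro t ω hle
    -- Inside the disc of radius `r` the cut-off is `1`, so the rate in Itô's formula is that of the
    -- genuine Loewner flow.
    have h1 : cutRate r (w t ω) = radialPhi (w t ω) := by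
      rw [cutRate, cutWeight_eq_one hr, Complex.ofReal_one, one_mul]
      rw [hwdef, norm_cutCentered, Real.toNNReal_coe]
      exact hle
    have h2 := itoRate_vertex hκ σ σs σq σqs (hwlt t ω)
    simp only [h1, hv, hc]
    rw [h2, ← hX]
    simp only [hf, hg, hv, hc, hwdef]
    ring
  · have hconj : Measurable (starRingEnd ℂ) := Complex.continuous_conj.measurable
    have hfm : ∀ p, Measurable (oneSubPow p) := measurable_oneSubPow
    have hfd : ∀ p, Measurable (deriv (oneSubPow p)) := fun p => measurable_deriv _
    have hfdd : ∀ p, Measurable (deriv (deriv (oneSubPow p))) := fun p => measurable_deriv _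
    have hrate : Measurable fun z : ℂ => itoRate κ c (vertexRate κ σ σs σq σqs z) (cutRate r z)
        (f z) (z * deriv f z) (z * deriv f z + z ^ 2 * deriv (deriv f) z)
        (g ((starRingEnd ℂ) z)) ((starRingEnd ℂ) z * deriv g ((starRingEnd ℂ) z))
        ((starRingEnd ℂ) z * deriv g ((starRingEnd ℂ) z) +
          (starRingEnd ℂ) z ^ 2 * deriv (deriv g) ((starRingEnd ℂ) z)) := by
      have e1 := measurable_vertexRate κ σ σs σq σqs
      have e2 := measurable_cutRate r
      have f0 := hfm (aParam κ * σ)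
      have f1 := hfd (aParam κ * σ)
      have f2 := hfdd (aParam κ * σ)
      have g0 := (hfm (aParam κ * σs)).comp hconj
      have g1 := (hfd (aParam κ * σs)).comp hconj
      have g2 := (hfdd (aParam κ * σs)).comp hconj
      have e3 := hconj.comp e2
      simp only [Function.comp_def] at g0 g1 g2 e3
      simp only [itoRate, hf, hg]
      fun_prop
    exact fun t => ((stronglyAdapted_expTerm hB κ c hva hvc) t).mul (hmeas hrate t)

end Flow

/-! ### The exit times of the flow from smaller discs -/

/-- The first time at which the Loewner flow leaves the disc of radius `r`. -/
def hitTime (r : ℝ) (θ : ℝ≥0 → ℝ) (ζ : ℂ) : WithTop ℝ≥0 :=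
  firstTime (fun t : ℝ≥0 => ‖cutFlow r θ ζ t‖) r

section HitTime

variable {θ : ℝ≥0 → ℝ} {ζ : ℂ} {r : ℝ}

theorem continuous_norm_cutFlow (hθ : Continuous θ) (hr : r < 1) (ζ : ℂ) :
    Continuous fun t : ℝ≥0 => ‖cutFlow r θ ζ t‖ :=
  ((continuous_cutFlow hr hθ ζ).comp NNReal.continuous_coe).norm

/-- Truncated flows for different radii are different functions. Rephrasing the exit time through
genuine solutions makes these times comparable with each other and with the lifetime. -/
theorem lt_hitTime_iff (hθ : Continuous θ) (hr : r < 1) {t : ℝ≥0} :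
    (t : WithTop ℝ≥0) < hitTime r θ ζ ↔
      ∃ u, IsLoewnerSolution θ ζ t u ∧ ∀ s ∈ Set.Icc 0 (t : ℝ), ‖u s‖ < r := by
  rw [hitTime, lt_firstTime_iff (continuous_norm_cutFlow hθ hr ζ)]
  constructor
  · intro h
    have h' : ∀ s ∈ Set.Icc 0 (t : ℝ), ‖cutFlow r θ ζ s‖ < r := fun s hs => by
      lift s to ℝ≥0 using hs.1
      exact h s (by exact_mod_cast hs.2)
    exact ⟨_, isLoewnerSolution_cutFlow hr hθ fun s hs => (h' s hs).le, h'⟩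
  · rintro ⟨u, hu, hur⟩ s hs
    have hs' : (s : ℝ) ∈ Set.Icc 0 (t : ℝ) := ⟨s.coe_nonneg, by exact_mod_cast hs⟩
    have h1 := hu.eqOn_cutFlow hr hθ (fun s hs => (hur s hs).le) hs'
    have := hur s hs'
    rwa [h1] at this

theorem hitTime_mono (hθ : Continuous θ) {r' : ℝ} (hrr' : r ≤ r') (hr' : r' < 1) :
    hitTime r θ ζ ≤ hitTime r' θ ζ := by
  refine le_of_forall_lt fun c hc => ?_
  lift c to ℝ≥0 using hc.ne_top
  obtain ⟨u, hu, h⟩ := (lt_hitTime_iff hθ (hrr'.trans_lt hr')).1 hc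
  exact (lt_hitTime_iff hθ hr').2 ⟨u, hu, fun s hs => (h s hs).trans_le hrr'⟩

theorem norm_cutFlow_le_of_le_hitTime (hθ : Continuous θ) (hr : r < 1) (hζ : ‖ζ‖ ≤ r) {t : ℝ≥0}
    (ht : (t : WithTop ℝ≥0) ≤ hitTime r θ ζ) {s : ℝ} (hs : s ∈ Set.Icc 0 (t : ℝ)) :
    ‖cutFlow r θ ζ s‖ ≤ r := by
  lift s to ℝ≥0 using hs.1
  refine le_of_le_firstTime (continuous_norm_cutFlow hθ hr ζ) ?_
    ((WithTop.coe_le_coe.2 (by exact_mod_cast hs.2)).trans ht)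
  simpa [(cutFlow_spec hr hθ ζ).1] using hζ

theorem hitTime_pos (hθ : Continuous θ) (hr : r < 1) (hζ : ‖ζ‖ < r) : 0 < hitTime r θ ζ := by
  refine (lt_firstTime_iff (continuous_norm_cutFlow hθ hr ζ) (t := 0)).2 fun s hs => ?_
  obtain rfl : s = 0 := le_antisymm hs zero_le
  simpa [(cutFlow_spec hr hθ ζ).1] using hζ

theorem le_loewnerTime {t : ℝ≥0} {u : ℝ → ℂ} (hu : IsLoewnerSolution θ ζ t u) :
    (t : WithTop ℝ≥0) ≤ loewnerTime θ ζ :=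
  le_sSup ⟨t, rfl, u, hu⟩

/-- At such a time the flow is still in the closed disc of radius `r`. Truncation at a slightly
larger radius continues the same solution past `t`, which gives the strict inequality. -/
theorem coe_lt_loewnerTime_of_le_hitTime (hθ : Continuous θ) (hr : r < 1) (hζ : ‖ζ‖ ≤ r) {t : ℝ≥0}
    (ht : (t : WithTop ℝ≥0) ≤ hitTime r θ ζ) : (t : WithTop ℝ≥0) < loewnerTime θ ζ := by
  obtain ⟨r', h1, h2⟩ := exists_between hr
  have hle := fun s hs => norm_cutFlow_le_of_le_hitTime hθ hr hζ ht (s := s) hs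
  have hsol := isLoewnerSolution_cutFlow hr hθ hle
  have heq := hsol.eqOn_cutFlow h2 hθ fun s hs => (hle s hs).trans h1.le
  have hlt : (t : WithTop ℝ≥0) < hitTime r' θ ζ :=
    (lt_hitTime_iff hθ h2).2 ⟨_, hsol, fun s hs => (hle s hs).trans_lt h1⟩
  obtain ⟨t', ht1, ht2⟩ : ∃ t' : ℝ≥0, t < t' ∧ (t' : WithTop ℝ≥0) < hitTime r' θ ζ := by
    have hnt : ∀ᶠ x in nhds t, ‖cutFlow r' θ ζ (x : ℝ≥0)‖ < r' := by
      refine (continuous_norm_cutFlow hθ h2 ζ).continuousAt.eventually_lt_const ?_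
      show ‖cutFlow r' θ ζ (t : ℝ)‖ < r'
      rw [← heq ⟨t.coe_nonneg, le_rfl⟩]
      exact (hle t ⟨t.coe_nonneg, le_rfl⟩).trans_lt h1
    obtain ⟨l, hl, hIoc⟩ := exists_Ico_subset_of_mem_nhds hnt ⟨t + 1, by simp⟩
    obtain ⟨t', h3, h4⟩ := exists_between hl
    refine ⟨t', h3, (lt_firstTime_iff (continuous_norm_cutFlow hθ h2 ζ)).2 fun s hs => ?_⟩
    rcases le_total s t with hst | hst
    · exact (lt_firstTime_iff (continuous_norm_cutFlow hθ h2 ζ)).1 hlt s hst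
    · exact hIoc ⟨hst, hs.trans_lt h4⟩
  obtain ⟨u, hu, -⟩ := (lt_hitTime_iff hθ h2).1 ht2
  exact (WithTop.coe_lt_coe.2 ht1).trans_le (le_loewnerTime hu)

/-- On the compact interval `[0, t]` the modulus of the solution has a maximum, and it is below `1`
because solutions stay in the open disc. Any radius between that maximum and `1` works. -/
theorem exists_lt_hitTime (hθ : Continuous θ) (hζ : ‖ζ‖ < 1) {t : ℝ≥0}
    (ht : (t : WithTop ℝ≥0) < loewnerTime θ ζ) :
    ∃ r, ‖ζ‖ < r ∧ r < 1 ∧ (t : WithTop ℝ≥0) < hitTime r θ ζ := by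
  obtain ⟨_, ⟨t', rfl, u, hu⟩, htt'⟩ := lt_sSup_iff.1 ht
  have hu' := hu.mono (WithTop.coe_le_coe.1 htt'.le)
  obtain ⟨s, hs, hmax⟩ := (isCompact_Icc (a := (0 : ℝ)) (b := t)).exists_isMaxOn
    ⟨0, le_rfl, t.coe_nonneg⟩ hu'.continuousOn.norm
  have h1 := hu'.norm_lt_one hθ hζ hs
  obtain ⟨r, hr1, hr2⟩ := exists_between h1
  refine ⟨r, lt_of_le_of_lt ?_ hr1, hr2, (lt_hitTime_iff hθ hr2).2
    ⟨u, hu', fun x hx => lt_of_le_of_lt (hmax hx) hr1⟩⟩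
  rw [← hu'.1]
  exact hmax ⟨le_rfl, t.coe_nonneg⟩

theorem continuous_vertexModel (hθ : Continuous θ) (hr : r < 1) (hζ : ‖ζ‖ ≤ (1 + r) / 2)
    (κ : ℝ) (σ σs σq σqs : ℂ) :
    Continuous fun t : ℝ≥0 => vertexModel κ σ σs σq σqs θ (cutCentered r θ ζ) t := by
  have hball : ∀ x, cutCentered r θ ζ x ∈ Metric.ball (0 : ℂ) 1 := fun x =>
    mem_ball_zero_iff.2 ((norm_cutCentered_le hr hθ hζ x).trans_lt (by linarith))
  have hc := continuous_cutCentered hr hθ ζ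
  have h1 : Continuous fun x => vertexRate κ σ σs σq σqs (cutCentered r θ ζ x) :=
    (continuousOn_vertexRate κ σ σs σq σqs).comp_continuous hc hball
  have h2 : Continuous fun t : ℝ≥0 => ∫ x in (0 : ℝ)..t,
      vertexRate κ σ σs σq σqs (cutCentered r θ ζ x) :=
    (intervalIntegral.continuous_primitive (fun a b => h1.intervalIntegrable a b) 0).comp
      NNReal.continuous_coe
  have h3 : Continuous fun t : ℝ≥0 => oneSubPow (aParam κ * σ) (cutCentered r θ ζ t) :=
    ((differentiableOn_oneSubPow _).continuousOn.comp_continuous hc hball).comp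
      NNReal.continuous_coe
  have h4 : Continuous fun t : ℝ≥0 =>
      oneSubPow (aParam κ * σs) ((starRingEnd ℂ) (cutCentered r θ ζ t)) :=
    ((differentiableOn_oneSubPow _).continuousOn.comp_continuous
      (Complex.continuous_conj.comp hc) fun x => conj_mem_unitBall (hball x)).comp
      NNReal.continuous_coe
  exact (((Complex.continuous_exp.comp (continuous_const.mul
    (Complex.continuous_ofReal.comp hθ))).mul (Complex.continuous_exp.comp h2)).mul h3).mul h4

end HitTime

theorem isStoppingTime_hitTime {P : Measure Ω} {𝓕 : Filtration ℝ≥0 mΩ} {B : ℝ≥0 → Ω → ℝ}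
    (hB : IsFilteredBrownian 𝓕 B P) (κ : ℝ) {r : ℝ} (hr : r < 1) (ζ : ℂ) :
    IsStoppingTime 𝓕 fun ω => hitTime r (driving κ B ω) ζ :=
  isStoppingTime_firstTime (Z := fun t ω => ‖cutFlow r (driving κ B ω) ζ t‖)
    (fun t => (stronglyAdapted_cutFlow hB κ hr ζ t).norm)
    (fun ω => continuous_norm_cutFlow (continuous_driving hB κ ω) hr ζ) r

/-! ### Martingale-observables and vanishing drift -/

section Observable

variable {P : Measure Ω} {𝓕 : Filtration ℝ≥0 mΩ} {B : ℝ≥0 → Ω → ℝ} {κ : ℝ} {D : Set ℂ} {q : ℂ}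
  {g₀ : ℂ → ℂ} {σ σs σq σqs : ℂ}

theorem exists_stoppedProcess_eq (τ : Ω → WithTop ℝ≥0) (t : ℝ≥0) (ω : Ω) :
    ∃ s : ℝ≥0, (s : WithTop ℝ≥0) = min (t : WithTop ℝ≥0) (τ ω) ∧ s ≤ t ∧ (s : WithTop ℝ≥0) ≤ τ ω ∧
      ∀ u : ℝ≥0 → Ω → ℂ, stoppedProcess u τ t ω = u s ω := by
  have hs := coe_untopA_of_ne_top (x := min (t : WithTop ℝ≥0) (τ ω))
    (ne_top_of_le_ne_top WithTop.coe_ne_top (min_le_left _ _))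
  refine ⟨_, hs, ?_, ?_, fun u => rfl⟩
  · rw [← WithTop.coe_le_coe, hs]
    exact min_le_left _ _
  · rw [hs]
    exact min_le_right _ _

/-- The radii `1 - (1 - |ζ|) / (n + 2)`. -/
def exhaustionRadius (ζ : ℂ) (n : ℕ) : ℝ := 1 - (1 - ‖ζ‖) / (n + 2)

theorem exhaustionRadius_lt_one {ζ : ℂ} (hζ : ‖ζ‖ < 1) (n : ℕ) : exhaustionRadius ζ n < 1 := by
  have : 0 < (1 - ‖ζ‖) / (n + 2) := div_pos (by linarith) (by positivity)
  rw [exhaustionRadius]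
  linarith

theorem lt_exhaustionRadius {ζ : ℂ} (hζ : ‖ζ‖ < 1) (n : ℕ) : ‖ζ‖ < exhaustionRadius ζ n := by
  have : (1 - ‖ζ‖) / (n + 2) < 1 - ‖ζ‖ := by
    refine div_lt_self (by linarith) ?_
    have : (0 : ℝ) ≤ n := n.cast_nonneg
    linarith
  rw [exhaustionRadius]
  linarith

theorem monotone_exhaustionRadius {ζ : ℂ} (hζ : ‖ζ‖ < 1) : Monotone (exhaustionRadius ζ) :=
  fun m n hmn => by
    have h1 : (m : ℝ) ≤ n := Nat.cast_le.2 hmn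
    have h2 : 0 ≤ 1 - ‖ζ‖ := by linarith
    unfold exhaustionRadius
    gcongr

theorem exists_le_exhaustionRadius (ζ : ℂ) {r : ℝ} (hr : r < 1) :
    ∃ N, ∀ n ≥ N, r ≤ exhaustionRadius ζ n := by
  have h : Filter.Tendsto (exhaustionRadius ζ) Filter.atTop (nhds (1 - 0)) := by
    refine tendsto_const_nhds.sub (Filter.Tendsto.div_atTop tendsto_const_nhds ?_)
    exact Filter.tendsto_atTop_add_const_right _ _ tendsto_natCast_atTop_atTop
  rw [sub_zero] at h
  obtain ⟨N, hN⟩ := Filter.eventually_atTop.1 (h.eventually_const_lt hr)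
  exact ⟨N, fun n hn => (hN n hn).le⟩

/-- Up to its exit from a smaller disc, the 1-point function is a constant times the truncated
model, whose drift vanishes there. The model stopped at that time therefore coincides with its
stopped compensated martingale. -/
theorem isMartingaleObservable_of_vertexDrift_eq_zero (hB : IsFilteredBrownian 𝓕 B P) (hκ : 0 < κ)
    (hg : IsUniformization D q g₀) (h0 : ∀ w, vertexDrift κ σ σs σq σqs w = 0) :
    IsMartingaleObservable κ D q g₀ 𝓕 P B (vertexEvolution κ σ σs σq σqs q) := by
  have := hB.isProbabilityMeasure
  intro z hz
  set ζ := g₀ z with hζdef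
  have hζ : ‖ζ‖ < 1 := hg.norm_lt_one hz.1
  have hθ := continuous_driving hB κ
  set ρ := exhaustionRadius ζ with hρ
  have hρ1 : ∀ n, ρ n < 1 := exhaustionRadius_lt_one hζ
  have hρζ : ∀ n, ‖ζ‖ < ρ n := lt_exhaustionRadius hζ
  -- The cap at `n` keeps the stopping times finite. It is needed for the strict inequality `T n <
  -- τ` when the lifetime is infinite.
  set T : ℕ → Ω → WithTop ℝ≥0 := fun n ω =>
    min (hitTime (ρ n) (driving κ B ω) ζ) ((n : ℝ≥0) : WithTop ℝ≥0) with hT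
  have hTle : ∀ n ω, T n ω ≤ hitTime (ρ n) (driving κ B ω) ζ := fun n ω => min_le_left _ _
  have hTlt : ∀ n ω, T n ω < loewnerTime (driving κ B ω) ζ := fun n ω => by
    have hne : T n ω ≠ ⊤ := ne_top_of_le_ne_top WithTop.coe_ne_top (min_le_right _ _)
    obtain ⟨s, hs⟩ := WithTop.ne_top_iff_exists.1 hne
    rw [← hs]
    exact coe_lt_loewnerTime_of_le_hitTime (hθ ω) (hρ1 n) (hρζ n).le (hs.trans_le (hTle n ω))
  have hTst : ∀ n, IsStoppingTime 𝓕 (T n) := fun n =>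
    (isStoppingTime_hitTime hB κ (hρ1 n) ζ).min (isStoppingTime_const 𝓕 (n : ℝ≥0))
  refine ⟨T, hTst, Filter.Eventually.of_forall fun ω => ⟨?_, fun n => hTlt n ω, ?_, ?_⟩, fun n => ?_⟩
  · intro m n hmn
    refine min_le_min (hitTime_mono (hθ ω) (monotone_exhaustionRadius hζ hmn) (hρ1 n)) ?_
    exact WithTop.coe_le_coe.2 (Nat.cast_le.2 hmn)
  · rintro _ ⟨n, rfl⟩
    exact (hTlt n ω).le
  · intro b hb
    by_contra! hlt
    lift b to ℝ≥0 using hlt.ne_top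
    obtain ⟨r, -, hr1, hr⟩ := exists_lt_hitTime (hθ ω) hζ hlt
    obtain ⟨N, hN⟩ := exists_le_exhaustionRadius ζ hr1
    obtain ⟨m, hm⟩ := exists_nat_gt b
    have h1 : (b : WithTop ℝ≥0) < T (max N m) ω := by
      refine lt_min (hr.trans_le (hitTime_mono (hθ ω) (hN _ (le_max_left _ _)) (hρ1 _))) ?_
      exact WithTop.coe_lt_coe.2 (hm.trans_le (Nat.cast_le.2 (le_max_right _ _)))
    exact absurd (hb ⟨_, rfl⟩) (not_le.2 h1)
  · have hζ' : ‖ζ‖ ≤ (1 + ρ n) / 2 := by linarith [hρζ n]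
    obtain ⟨Dr, -, hD, hDeq⟩ := exists_isDrift_vertexModel hB hκ σ σs σq σqs (hρ1 n) hζ'
    have hNc : ∀ ω, Continuous fun t : ℝ≥0 => vertexModel κ σ σs σq σqs (driving κ B ω)
        (cutCentered (ρ n) (driving κ B ω) ζ) t - ∫ x in (0 : ℝ)..t, Dr x.toNNReal ω := fun ω =>
      (continuous_vertexModel (hθ ω) (hρ1 n) hζ' κ σ σs σq σqs).sub
        (continuous_integral_toNNReal (hD.continuous ω))
    have hM := (martingale_stoppedProcess hD.martingale hNc (hTst n)).const_mul
      (vertexConst κ σ σs σq σqs ζ (Complex.log (deriv g₀ z)) (Complex.log (deriv g₀ q)))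
    convert hM using 1
    funext t ω
    obtain ⟨s, -, -, hs, hu⟩ := exists_stoppedProcess_eq (T n) t ω
    have hle := fun x hx => norm_cutFlow_le_of_le_hitTime (hθ ω) (hρ1 n) (hρζ n).le
      (hs.trans (hTle n ω)) (s := x) hx
    rw [hu, hu, vertexEvolution_eq hg (hθ ω) (driving_zero hB κ ω) hz κ σ σs σq σqs (hρ1 n) hle]
    have hI : ∫ x in (0 : ℝ)..s, Dr x.toNNReal ω = 0 := by
      refine intervalIntegral.integral_zero_ae (Filter.Eventually.of_forall fun x hx => ?_)
      rw [Set.uIoc_of_le s.coe_nonneg] at hx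
      rw [hDeq, h0, mul_zero]
      rw [Real.coe_toNNReal x hx.1.le]
      exact hle x ⟨hx.1.le, hx.2⟩
    rw [hI, sub_zero]

theorem stoppedProcess_continuous {u : ℝ≥0 → Ω → ℂ} {τ : Ω → WithTop ℝ≥0} {ω : Ω} {T : ℝ≥0}
    (hT : τ ω = T) {v : ℝ≥0 → ℂ} (hv : Continuous v) (huv : ∀ s ≤ T, u s ω = v s) :
    Continuous fun t => stoppedProcess u τ t ω := by
  have h : (fun t => stoppedProcess u τ t ω) = fun t => v (min t T) := by
    funext t
    obtain ⟨s, hs, hst, hsτ, hu⟩ := exists_stoppedProcess_eq τ t ω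
    rw [hT, ← WithTop.coe_min, WithTop.coe_inj] at hs
    rw [hu, hs, huv _ (min_le_right _ _)]
  rw [h]
  exact hv.comp (continuous_id.min continuous_const)

/-- If the drift at time `0` were `d ≠ 0`, it would keep a component of size at least half in the
direction of `d` during a positive random time. Optional stopping gives its integral mean zero up to
that time, so every localizing time `T n` would have to vanish almost surely, contradicting that
they increase to a positive lifetime. -/
theorem vertexDrift_eq_zero_of_isMartingaleObservable (hB : IsFilteredBrownian 𝓕 B P) (hκ : 0 < κ)
    (hg : IsUniformization D q g₀)
    (hM : IsMartingaleObservable κ D q g₀ 𝓕 P B (vertexEvolution κ σ σs σq σqs q)) {z : ℂ}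
    (hz : z ∈ D \ {q}) : vertexDrift κ σ σs σq σqs (g₀ z) = 0 := by
  have := hB.isProbabilityMeasure
  obtain ⟨T, hTst, hTτ, hTM⟩ := hM z hz
  have hζ : ‖g₀ z‖ < 1 := hg.norm_lt_one hz.1
  have hθ := continuous_driving hB κ
  have hθ0 := driving_zero hB κ
  have hEq : ∀ {r : ℝ}, r < 1 → ∀ {ω : Ω} {t : ℝ≥0},
      (∀ s ∈ Set.Icc 0 (t : ℝ), ‖cutFlow r (driving κ B ω) (g₀ z) s‖ ≤ r) →
        vertexEvolution κ σ σs σq σqs q (centeredMap g₀ (driving κ B ω)) z t =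
          vertexConst κ σ σs σq σqs (g₀ z) (Complex.log (deriv g₀ z)) (Complex.log (deriv g₀ q)) *
            vertexModel κ σ σs σq σqs (driving κ B ω) (cutCentered r (driving κ B ω) (g₀ z)) t :=
    by
      intro r hr ω t h
      exact vertexEvolution_eq hg (hθ ω) (hθ0 ω) hz κ σ σs σq σqs hr h
  set ζ := g₀ z with hζdef
  set C := vertexConst κ σ σs σq σqs ζ (Complex.log (deriv g₀ z)) (Complex.log (deriv g₀ q)) with hC
  have hC0 : C ≠ 0 := vertexConst_ne_zero κ σ σs σq σqs _ _ _
  set M : ℝ≥0 → Ω → ℂ := fun t ω =>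
    vertexEvolution κ σ σs σq σqs q (centeredMap g₀ (driving κ B ω)) z t with hMdef
  obtain ⟨r, hr1, hr⟩ := exists_between hζ
  have hζr : ‖ζ‖ ≤ (1 + r) / 2 := by linarith
  obtain ⟨Dr, hDa, hD, hDeq⟩ := exists_isDrift_vertexModel hB hκ σ σs σq σqs hr hζr
  set X : ℝ≥0 → Ω → ℂ := fun t ω => vertexModel κ σ σs σq σqs (driving κ B ω)
    (cutCentered r (driving κ B ω) ζ) t with hX
  have hW0 : ∀ ω, cutCentered r (driving κ B ω) ζ 0 = ζ := fun ω => by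
    simp [cutCentered, hθ0, (cutFlow_spec hr (hθ ω) ζ).1]
  by_contra hne
  -- the initial drift
  obtain ⟨d, hd, hd0⟩ : ∃ d : ℂ, (∀ ω, Dr 0 ω = d) ∧ d ≠ 0 := by
    refine ⟨Complex.exp (aParam κ * σ * Complex.log (1 - ζ)) *
      Complex.exp (aParam κ * σs * Complex.log (1 - (starRingEnd ℂ) ζ)) *
        vertexDrift κ σ σs σq σqs ζ, fun ω => ?_,
      mul_ne_zero (mul_ne_zero (Complex.exp_ne_zero _) (Complex.exp_ne_zero _)) hne⟩
    rw [hDeq]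
    · simp [vertexModel, hW0, hθ0]
    · simpa [(cutFlow_spec hr (hθ ω) ζ).1] using hr1.le
  have hd2 : 0 < ‖d‖ ^ 2 := by positivity
  -- The complex drift is projected onto its initial direction. `Y` is real, continuous and starts
  -- at `‖d‖ ^ 2`.
  set Y : ℝ≥0 → Ω → ℝ := fun t ω => ((starRingEnd ℂ) d * Dr t ω).re with hY
  have hYc : ∀ ω, Continuous fun t => Y t ω := fun ω =>
    Complex.continuous_re.comp (continuous_const.mul (hD.continuous ω))
  have hY0 : ∀ ω, Y 0 ω = ‖d‖ ^ 2 := fun ω => by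
    show ((starRingEnd ℂ) d * Dr 0 ω).re = ‖d‖ ^ 2
    rw [hd, mul_comm, Complex.mul_conj, Complex.ofReal_re, Complex.normSq_eq_norm_sq]
  set R : Ω → WithTop ℝ≥0 := fun ω =>
    min (firstTime (fun t => -Y t ω) (-(‖d‖ ^ 2 / 2))) (hitTime r (driving κ B ω) ζ) with hR
  have hRst : IsStoppingTime 𝓕 R := by
    refine (isStoppingTime_firstTime (Z := fun t ω => -Y t ω) (fun t => ?_)
      (fun ω => (hYc ω).neg) _).min (isStoppingTime_hitTime hB κ hr ζ)
    exact (Complex.continuous_re.comp_stronglyMeasurable ((hDa t).const_mul _)).neg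
  have hRpos : ∀ ω, 0 < R ω := fun ω => by
    refine lt_min ((lt_firstTime_iff (hYc ω).neg (t := 0)).2 fun s hs => ?_)
      (hitTime_pos (hθ ω) hr hr1)
    obtain rfl : s = 0 := le_antisymm hs zero_le
    have := hY0 ω
    show -Y 0 ω < -(‖d‖ ^ 2 / 2)
    linarith
  have hNc : ∀ᵐ ω ∂P, Continuous fun t : ℝ≥0 => X t ω - ∫ x in (0 : ℝ)..t, Dr x.toNNReal ω :=
    Filter.Eventually.of_forall fun ω =>
      (continuous_vertexModel (hθ ω) hr hζr κ σ σs σq σqs).sub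
        (continuous_integral_toNNReal (hD.continuous ω))
  have hMc : ∀ n, ∀ᵐ ω ∂P, Continuous fun t : ℝ≥0 => stoppedProcess M (T n) t ω := fun n => by
    -- As `T n < τ`, the path up to `T n` stays in a disc of some radius `r' < 1` depending on `ω`.
    -- Continuity is inherited from the model truncated at `r'`.
    filter_upwards [hTτ] with ω hω
    have hlt := hω.2.1 n
    obtain ⟨t, ht⟩ := WithTop.ne_top_iff_exists.1 hlt.ne_top
    rw [← ht] at hlt
    obtain ⟨r', h1, h2, h3⟩ := exists_lt_hitTime (hθ ω) hζ hlt
    refine stoppedProcess_continuous ht.symm (v := fun t => C * vertexModel κ σ σs σq σqs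
      (driving κ B ω) (cutCentered r' (driving κ B ω) ζ) t) (continuous_const.mul
        (continuous_vertexModel (hθ ω) h2 (by linarith) κ σ σs σq σqs)) fun s hs => ?_
    refine hEq h2 fun x hx => norm_cutFlow_le_of_le_hitTime (hθ ω) h2 h1.le h3.le ?_
    exact ⟨hx.1, hx.2.trans (by exact_mod_cast hs)⟩
  -- the stopped time vanishes
  have key : ∀ n, ∀ᵐ ω ∂P, min (1 : WithTop ℝ≥0) (min (R ω) (T n ω)) = 0 := fun n => by
    have hS : IsStoppingTime 𝓕 fun ω => min (R ω) (T n ω) := hRst.min (hTst n)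
    -- Two martingales are stopped at the same time `min 1 (min R (T n))`: the compensated model and
    -- the 1-point function, a multiple of the model. Comparing their means isolates the integral of
    -- the drift.
    obtain ⟨iN, eN⟩ := integrable_stoppedProcess_of_martingale hD.martingale hNc hS 1
    obtain ⟨iM, eM⟩ := integrable_stoppedProcess_of_martingale (hTM n) (hMc n) hRst 1
    rw [stoppedProcess_stoppedProcess'] at iM eM
    choose s hs hs1 hsS hsu using fun ω => exists_stoppedProcess_eq (fun ω => min (R ω) (T n ω)) 1 ω
    have hsle : ∀ ω, ∀ x ∈ Set.Icc 0 (s ω : ℝ), ‖cutFlow r (driving κ B ω) ζ x‖ ≤ r := fun ω x hx =>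
      norm_cutFlow_le_of_le_hitTime (hθ ω) hr hr1.le
        ((hsS ω).trans ((min_le_left _ _).trans (min_le_right _ _))) hx
    have hMX : ∀ ω, M (s ω) ω = C * X (s ω) ω := fun ω => hEq hr (hsle ω)
    have hM0 : ∀ ω, stoppedProcess M (T n) 0 ω = C * X 0 ω := fun ω => by
      obtain ⟨s', -, hs', -, hu⟩ := exists_stoppedProcess_eq (T n) 0 ω
      obtain rfl : s' = 0 := le_antisymm hs' zero_le
      rw [hu]
      refine hEq hr fun x hx => ?_
      refine hsle ω x ⟨hx.1, hx.2.trans ?_⟩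
      simp
    have hfM : stoppedProcess M (fun ω => min (R ω) (T n ω)) 1 = fun ω => C * X (s ω) ω :=
      funext fun ω => (hsu ω M).trans (hMX ω)
    have hfN : stoppedProcess (fun (t : ℝ≥0) ω => X t ω - ∫ x in (0 : ℝ)..t, Dr x.toNNReal ω)
        (fun ω => min (R ω) (T n ω)) 1 =
          fun ω => X (s ω) ω - ∫ x in (0 : ℝ)..s ω, Dr x.toNNReal ω := funext fun ω => hsu ω _
    rw [hfM] at iM eM
    rw [hfN] at iN eN
    have iX : Integrable (fun ω => X (s ω) ω) P := by
      have := iM.const_mul C⁻¹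
      simpa [hC0] using this
    have iI : Integrable (fun ω => ∫ x in (0 : ℝ)..s ω, Dr x.toNNReal ω) P := by
      refine (iX.sub iN).congr (Filter.Eventually.of_forall fun ω => ?_)
      simp
    have eI : ∫ ω, (∫ x in (0 : ℝ)..s ω, Dr x.toNNReal ω) ∂P = 0 := by
      rw [integral_sub iX iI] at eN
      simp only [hM0, integral_const_mul, mul_right_inj' hC0] at eM
      rw [eM] at eN
      simpa using eN
    have iR : Integrable (fun ω => ((starRingEnd ℂ) d * ∫ x in (0 : ℝ)..s ω, Dr x.toNNReal ω).re) P :=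
      (iI.const_mul _).re
    have eR : ∫ ω, ((starRingEnd ℂ) d * ∫ x in (0 : ℝ)..s ω, Dr x.toNNReal ω).re ∂P = 0 := by
      have h := integral_re (iI.const_mul ((starRingEnd ℂ) d))
      rw [integral_const_mul, eI, mul_zero] at h
      simpa using h
    have hlow : ∀ ω, ‖d‖ ^ 2 / 2 * s ω ≤
        ((starRingEnd ℂ) d * ∫ x in (0 : ℝ)..s ω, Dr x.toNNReal ω).re := fun ω => by
      have hc : Continuous fun x : ℝ => (starRingEnd ℂ) d * Dr x.toNNReal ω :=
        continuous_const.mul ((hD.continuous ω).comp continuous_real_toNNReal)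
      have h1 : ((starRingEnd ℂ) d * ∫ x in (0 : ℝ)..s ω, Dr x.toNNReal ω).re =
          ∫ x in (0 : ℝ)..s ω, Y x.toNNReal ω := by
        rw [← intervalIntegral.integral_const_mul]
        exact (Complex.reCLM.intervalIntegral_comp_comm (hc.intervalIntegrable _ _)).symm
      rw [h1]
      have h2 : (∫ _x in (0 : ℝ)..s ω, ‖d‖ ^ 2 / 2) ≤ ∫ x in (0 : ℝ)..s ω, Y x.toNNReal ω := by
        refine intervalIntegral.integral_mono_on (s ω).coe_nonneg (by simp)
          (((hYc ω).comp continuous_real_toNNReal).intervalIntegrable _ _) fun x hx => ?_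
        have h3 : -Y x.toNNReal ω ≤ -(‖d‖ ^ 2 / 2) := le_of_le_firstTime (z := fun t => -Y t ω)
          (hYc ω).neg (by have := hY0 ω; show -Y 0 ω ≤ -(‖d‖ ^ 2 / 2); linarith)
          ((WithTop.coe_le_coe.2 (Real.toNNReal_le_iff_le_coe.2 hx.2)).trans
            ((hsS ω).trans ((min_le_left _ _).trans (min_le_left _ _))))
        linarith
      refine le_trans (le_of_eq ?_) h2
      rw [intervalIntegral.integral_const, sub_zero, smul_eq_mul, mul_comm]
    have hnn : 0 ≤ fun ω => ((starRingEnd ℂ) d * ∫ x in (0 : ℝ)..s ω, Dr x.toNNReal ω).re := fun ω =>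
      le_trans (by positivity) (hlow ω)
    filter_upwards [(integral_eq_zero_iff_of_nonneg hnn iR).1 eR] with ω hω
    have h4 := hlow ω
    rw [show ((starRingEnd ℂ) d * ∫ x in (0 : ℝ)..s ω, Dr x.toNNReal ω).re = 0 from hω] at h4
    have h5 : (s ω : ℝ) ≤ 0 := by
      by_contra! h
      have : 0 < ‖d‖ ^ 2 / 2 * s ω := by positivity
      linarith
    have h6 : s ω = 0 := le_antisymm (by exact_mod_cast h5) zero_le
    have h7 := hs ω
    rw [h6] at h7
    exact h7.symm
  have hfalse : ∀ᵐ ω ∂P, False := by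
    filter_upwards [ae_all_iff.2 key, hTτ] with ω h1 hω
    obtain ⟨-, h2, h3⟩ := hω
    have h4 : ∀ n, T n ω = 0 := fun n => by
      by_contra hne0
      have hpos : 0 < T n ω := pos_iff_ne_zero.2 hne0
      have : (0 : WithTop ℝ≥0) < min 1 (min (R ω) (T n ω)) :=
        lt_min one_pos (lt_min (hRpos ω) hpos)
      exact this.ne' (h1 n)
    -- The lifetime is the least upper bound of the `T n`, so it would be `0`. But `T 0` lies
    -- strictly below it.
    have h5 : loewnerTime (driving κ B ω) ζ ≤ 0 := h3.2 (by rintro _ ⟨n, rfl⟩; exact (h4 n).le)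
    exact absurd ((zero_le (a := T 0 ω)).trans_lt (h2 0)) (not_lt.2 h5)
  exact hfalse.exists.elim fun _ h => h

end Observable

/-! ### The zeros of the drift -/

section Algebra

variable {κ : ℝ} {σ σs σq σqs : ℂ}

/-- With `x = σ + σ_q`, neutrality gives `σ_* + σ_{q*} = -x` and `Δ = -a x`. All three coefficients
then vanish by `κ a² = 2`. -/
theorem vertexDrift_eq_zero (hκ : 0 < κ) (h : σ + σs + σq + σqs = 0) (w : ℂ) :
    vertexDrift κ σ σs σq σqs w = 0 := by
  have ha := mul_aParam_sq hκ
  rw [vertexDrift, vertexGap_eq]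
  generalize w / (1 - w) = s
  generalize (starRingEnd ℂ) w / (1 - (starRingEnd ℂ) w) = s'
  generalize (aParam κ : ℂ) = a at *
  have hy : σqs = -σ - σs - σq := by linear_combination h
  subst hy
  linear_combination (-(σ + σq) ^ 2 / 2 - σ * (σ + σq) * s + σs * (σ + σq) * s') * ha

/-- At the points `1/2`, `1/3` and `(1 + i)/2` the quantity `w / (1 - w)` takes the values `1`,
`1/2` and `i`. The two real points determine `c₀` and `c₁ + c₂`, and the third determines `c₁ - c₂`.
-/
theorem coefficients_eq_zero {c₀ c₁ c₂ : ℂ}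
    (h : ∀ w : ℂ, w ≠ 0 → ‖w‖ < 1 →
      c₀ + c₁ * (w / (1 - w)) + c₂ * ((starRingEnd ℂ) w / (1 - (starRingEnd ℂ) w)) = 0) :
    c₀ = 0 ∧ c₁ = 0 ∧ c₂ = 0 := by
  have h1 := h (1 / 2) (by norm_num) (by norm_num)
  have h2 := h (1 / 3) (by norm_num) (by norm_num)
  have h3 := h ((1 + Complex.I) / 2) (by
      intro h0
      have := congrArg Complex.re h0
      norm_num at this) (by
      have hsq : ‖(1 + Complex.I) / 2‖ ^ 2 = 1 / 2 := by
        rw [← Complex.normSq_eq_norm_sq, Complex.normSq_apply]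
        norm_num
      nlinarith [norm_nonneg ((1 + Complex.I) / 2)])
  have e1 : (starRingEnd ℂ) (1 / 2 : ℂ) = 1 / 2 := by simp [Complex.conj_ofNat]
  have e2 : (starRingEnd ℂ) (1 / 3 : ℂ) = 1 / 3 := by simp [Complex.conj_ofNat]
  have e3 : (starRingEnd ℂ) ((1 + Complex.I) / 2) = (1 - Complex.I) / 2 := by
    simp [Complex.conj_ofNat, sub_eq_add_neg]
  have hI : Complex.I ^ 2 = -1 := Complex.I_sq
  have n1 : (1 : ℂ) - (1 + Complex.I) / 2 ≠ 0 := fun h0 => by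
    have := congrArg Complex.re h0
    norm_num at this
  have n2 : (1 : ℂ) - (1 - Complex.I) / 2 ≠ 0 := fun h0 => by
    have := congrArg Complex.re h0
    norm_num at this
  have q1 : (1 + Complex.I) / 2 / (1 - (1 + Complex.I) / 2) = Complex.I := by
    rw [div_eq_iff n1]
    linear_combination hI / 2
  have q2 : (1 - Complex.I) / 2 / (1 - (1 - Complex.I) / 2) = -Complex.I := by
    rw [div_eq_iff n2]
    linear_combination hI / 2
  rw [e1] at h1
  rw [e2] at h2
  rw [e3, q1, q2] at h3
  norm_num at h1 h2
  have h0 : c₀ = 0 := by linear_combination 2 * h2 - h1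
  have h4 : c₁ + c₂ = 0 := by linear_combination h1 - h0
  have h5 : c₁ - c₂ = 0 := by
    refine (mul_eq_zero.1 (?_ : (c₁ - c₂) * Complex.I = 0)).resolve_right Complex.I_ne_zero
    linear_combination h3 - h0
  exact ⟨h0, by linear_combination (h4 + h5) / 2, by linear_combination (h4 - h5) / 2⟩

theorem coefficients_of_vertexDrift_eq_zero
    (h : ∀ w : ℂ, w ≠ 0 → ‖w‖ < 1 → vertexDrift κ σ σs σq σqs w = 0) :
    (σ + σq) * (σ + σq - aParam κ) + (σs + σqs) * (σs + σqs - aParam κ) =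
        κ * vertexGap κ σ σs σq σqs ^ 2 ∧
      (σ ≠ 0 → 2 * (σ + σq) + κ * aParam κ * vertexGap κ σ σs σq σqs = 0) ∧
      (σs ≠ 0 → 2 * (σs + σqs) - κ * aParam κ * vertexGap κ σ σs σq σqs = 0) := by
  obtain ⟨h0, h1, h2⟩ := coefficients_eq_zero h
  exact ⟨by linear_combination 2 * h0, (mul_eq_zero.1 h1).resolve_left,
    (mul_eq_zero.1 h2).resolve_left⟩

theorem aParam_ne_zero (hκ : 0 < κ) : (aParam κ : ℂ) ≠ 0 := fun h => by
  have := mul_aParam_sq hκ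
  simp [h] at this

/-- A nonzero node charge gives a linear relation that determines `Δ`, whereas for a zero charge
that relation is absent. Substituting for `Δ` in the constant coefficient leaves a polynomial in
`σ_q`, `σ_{q*}` that factors into linear forms, each one neutrality after an admissible reflection.
The reflection is harmless: `ĥ_q` is symmetric under `σ_q ↦ a - σ_q`, and `σ_q` otherwise enters
only through `ν̂`, which is zero when `σ = 0`. -/
theorem exists_neutral_of_vertexDrift_eq_zero (hκ : 0 < κ)
    (h : ∀ w : ℂ, w ≠ 0 → ‖w‖ < 1 → vertexDrift κ σ σs σq σqs w = 0) :
    ∃ τ τs : ℂ, (τ = σq ∨ (σ = 0 ∧ τ = aParam κ - σq)) ∧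
      (τs = σqs ∨ (σs = 0 ∧ τs = aParam κ - σqs)) ∧ σ + σs + τ + τs = 0 := by
  obtain ⟨h0, h1, h2⟩ := coefficients_of_vertexDrift_eq_zero h
  have ha := mul_aParam_sq hκ
  have ha0 := aParam_ne_zero hκ
  have hG := vertexGap_eq κ σ σs σq σqs
  generalize vertexGap κ σ σs σq σqs = Δ at *
  generalize (aParam κ : ℂ) = a at *
  have hκ0 : (κ : ℂ) ≠ 0 := Complex.ofReal_ne_zero.2 hκ.ne'
  by_cases hσ : σ = 0
  · by_cases hσs : σs = 0
    · subst hσ hσs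
      -- With both node charges zero only the constant coefficient remains, and it has degree four.
      -- Its factors correspond to no reflection, one of `σ_q`, one of `σ_{q*}`, and both.
      have hp : (σq + σqs) * ((σq - σqs - a) * ((σq - σqs + a) * (σq + σqs - 2 * a))) = 0 := by
        subst hG
        linear_combination (-2 * a ^ 2) * h0 -
          ((σq - σqs) * (σq + σqs - a)) ^ 2 / 2 * ha
      rcases mul_eq_zero.1 hp with h3 | h3
      · exact ⟨σq, σqs, Or.inl rfl, Or.inl rfl, by linear_combination h3⟩
      rcases mul_eq_zero.1 h3 with h3 | h3
      · exact ⟨a - σq, σqs, Or.inr ⟨rfl, rfl⟩, Or.inl rfl, by linear_combination -h3⟩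
      rcases mul_eq_zero.1 h3 with h3 | h3
      · exact ⟨σq, a - σqs, Or.inl rfl, Or.inr ⟨rfl, rfl⟩, by linear_combination h3⟩
      · exact ⟨a - σq, a - σqs, Or.inr ⟨rfl, rfl⟩, Or.inr ⟨rfl, rfl⟩, by linear_combination -h3⟩
    · subst hσ
      have h3 := h2 hσs
      -- The linear relation `κ a Δ = 2 (σ_* + σ_{q*})` is multiplied by `a` and solved with `κ a² =
      -- 2`.
      have hΔ : Δ = a * (σs + σqs) := by linear_combination -Δ / 2 * ha - a / 2 * h3
      have hp : (σq + (σs + σqs)) * (σq - (σs + σqs) - a) = 0 := by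
        rw [hΔ] at h0
        linear_combination h0 + (σs + σqs) ^ 2 * ha
      rcases mul_eq_zero.1 hp with h4 | h4
      · exact ⟨σq, σqs, Or.inl rfl, Or.inl rfl, by linear_combination h4⟩
      · exact ⟨a - σq, σqs, Or.inr ⟨rfl, rfl⟩, Or.inl rfl, by linear_combination -h4⟩
  · by_cases hσs : σs = 0
    · subst hσs
      have h3 := h1 hσ
      have hΔ : Δ = -(a * (σ + σq)) := by linear_combination -Δ / 2 * ha + a / 2 * h3
      have hp : ((σ + σq) + σqs) * (σqs - (σ + σq) - a) = 0 := by
        rw [hΔ] at h0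
        linear_combination h0 + (σ + σq) ^ 2 * ha
      rcases mul_eq_zero.1 hp with h4 | h4
      · exact ⟨σq, σqs, Or.inl rfl, Or.inl rfl, by linear_combination h4⟩
      · exact ⟨σq, a - σqs, Or.inl rfl, Or.inr ⟨rfl, rfl⟩, by linear_combination -h4⟩
    · exact ⟨σq, σqs, Or.inl rfl, Or.inl rfl, by linear_combination (h1 hσ + h2 hσs) / 2⟩

end Algebra

/-- Every point of the punctured disc is `g₀ z` for some `z ≠ q`, so the drift condition at time `0`
covers the whole punctured disc. Hence no later position of the flow needs to be examined. -/
theorem IsUniformization.vertexDrift_eq_zero {P : Measure Ω} {𝓕 : Filtration ℝ≥0 mΩ}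
    {B : ℝ≥0 → Ω → ℝ} {κ : ℝ} {D : Set ℂ} {q : ℂ} {g₀ : ℂ → ℂ} {σ σs σq σqs : ℂ}
    (hg : IsUniformization D q g₀) (hB : IsFilteredBrownian 𝓕 B P) (hκ : 0 < κ)
    (hM : IsMartingaleObservable κ D q g₀ 𝓕 P B (vertexEvolution κ σ σs σq σqs q)) (w : ℂ)
    (hw : w ≠ 0) (hw1 : ‖w‖ < 1) : vertexDrift κ σ σs σq σqs w = 0 := by
  obtain ⟨z, hz, rfl⟩ := hg.bijOn.surjOn (mem_ball_zero_iff.2 hw1)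
  refine vertexDrift_eq_zero_of_isMartingaleObservable hB hκ hg hM ⟨hz, ?_⟩
  rintro rfl
  exact hw hg.map_mark

end RadialSLE

end

theorem mainTheorem4 {Ω : Type*} {mΩ : MeasurableSpace Ω}
    (P : Measure Ω) (𝓕 : Filtration ℝ≥0 mΩ) (B : ℝ≥0 → Ω → ℝ)
    (hB : RadialSLE.IsFilteredBrownian 𝓕 B P)
    (κ : ℝ) (hκ : 0 < κ)
    (D : Set ℂ) (q : ℂ) (g₀ : ℂ → ℂ) (hg : RadialSLE.IsUniformization D q g₀)
    (σ σs σq σqs : ℂ) :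
    -- neutrality is sufficient
    (σ + σs + σq + σqs = 0 →
      RadialSLE.IsMartingaleObservable κ D q g₀ 𝓕 P B
        (RadialSLE.vertexEvolution κ σ σs σq σqs q)) ∧
    -- neutrality is necessary when both charges at the node are non-zero
    (σ ≠ 0 → σs ≠ 0 →
      RadialSLE.IsMartingaleObservable κ D q g₀ 𝓕 P B
        (RadialSLE.vertexEvolution κ σ σs σq σqs q) →
      σ + σs + σq + σqs = 0) ∧
    -- in general it is necessary up to the substitutions `σq ↦ a - σq` (if `σ = 0`) and
    -- `σqs ↦ a - σqs` (if `σs = 0`), which do not change the 1-point function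
    (RadialSLE.IsMartingaleObservable κ D q g₀ 𝓕 P B
        (RadialSLE.vertexEvolution κ σ σs σq σqs q) →
      ∃ τ τs : ℂ,
        (τ = σq ∨ (σ = 0 ∧ τ = RadialSLE.aParam κ - σq)) ∧
        (τs = σqs ∨ (σs = 0 ∧ τs = RadialSLE.aParam κ - σqs)) ∧
        σ + σs + τ + τs = 0) := by
  refine ⟨fun h => RadialSLE.isMartingaleObservable_of_vertexDrift_eq_zero hB hκ hg
    (RadialSLE.vertexDrift_eq_zero hκ h), fun hσ hσs hM => ?_,
    fun hM => RadialSLE.exists_neutral_of_vertexDrift_eq_zero hκ (hg.vertexDrift_eq_zero hB hκ hM)⟩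
  obtain ⟨-, h1, h2⟩ :=
    RadialSLE.coefficients_of_vertexDrift_eq_zero (hg.vertexDrift_eq_zero hB hκ hM)
  -- The terms `± κ a Δ` of the two conditions cancel, and what is left is twice the neutrality
  -- condition.
  linear_combination (h1 hσ + h2 hσs) / 2
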